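/- Let $\Omega\subset\mathbb R^d$ be a nonempty bounded open set and let $V\subset H^1(\Omega)$ be a closed subspace with $H^1_0(\Omega)\subset V$. Exact problem. Let $\alpha,\sigma:\Omega\to\mathbb R$ be measurable with $0<\alpha_{\min}\le\alpha\le\alpha_{\max}<\infty$ and $0\le\sigma\le\sigma_{\max}<\infty$ a.e., let $f\in L^2(\Omega)$, and set $a(w,v)=\int_\Omega \alpha\nabla w\cdot\nabla v+\sigma wv\,dx$ and $\ell(v)=\int_\Omega fv\,dx$. Assume that $a$ is coercive on $V$ and let $u\in V$ be the solution of $a(u,v)=\ell(v)$ for all $v\in V$. Auxiliary problem. Let $\tilde\alpha,\tilde\sigma,\tilde f$ be further functions satisfying the same kind of conditions, with $\tilde\alpha\ge\tilde\alpha_{\min}>0$ a.e., and let $\tilde a,\tilde\ell$ be the corresponding bilinear form and functional. Data. Let $B_1,\dots,B_m\subset\Omega$ be open and nonempty, and let $K_1,\dots,K_m\subset\mathbb R^d$ be convex with $B_i\subset K_i$, $\operatorname{int}K_i\subset\Omega$ and $\Omega\subset\bigcup_i\overline{K_i}$. Put $M=\max_{x\in\Omega}|\{i: x\in K_i\}|$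 and $R=\max_i\operatorname{diam}K_i$. Put $\eta=1$ if $B_i=K_i$ for all $i$, and $\eta=3\max_i|K_i|/|B_i|$ otherwise. Let $\delta>0$ and $b_1,\dots,b_m\in\mathbb R$. Write $\langle v\rangle_{B}=|B|^{-1}\int_{B}v\,dx$ and set $$b(w,v)=\sum_{i=1}^m|B_i|\,\langle w\rangle_{B_i}\,\langle v\rangle_{B_i},\qquad \widetilde{b(u,v)}=\sum_{i=1}^m b_i|B_i|\,\langle v\rangle_{B_i},$$ $$\tilde c(w,v)=\tilde a(w,v)+\delta^{-1}b(w,v),\qquad \tilde r(v)=\tilde\ell(v)+\delta^{-1}\widetilde{b(u,v)},$$ $$\tilde J(v)=\tfrac12\tilde c(v,v)-\tilde r(v),\qquad \|v\|_{\tilde c}=\tilde c(v,v)^{1/2},\qquad \Gamma=\eta\max\Bigl\{\frac{R^2M}{\pi^2\tilde\alpha_{\min}},\delta\Bigr\}.$$ We say that a functional $F$ on $V$ is in $L^2(\Omega)$ if there is $g\in L^2(\Omega)$ with $F(v)=\int_\Omega gv\,dx$ for all $v\in V$, and then $\|F\|_{L^2(\Omega)}:=\|g\|_{L^2(\Omega)}$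 ($g$ is unique since $V$ is dense in $L^2(\Omega)$). Assume that $\tilde\ell-\tilde a(u,\cdot)\in L^2(\Omega)$ and set $$\mathbb E_{\mathrm{pde}}=\|\tilde\ell-\tilde a(u,\cdot)\|_{L^2(\Omega)},\qquad \mathbb E_{\mathrm{data}}=\|\widetilde{b(u,\cdot)}-b(u,\cdot)\|_{L^2(\Omega)}.$$ Theorem. The functional $\tilde J$ has a unique minimizer $\tilde u$ over $V$. Let $V_h\subset V$ be an arbitrary subset (not necessarily a subspace) and let $\tilde u_h\in V_h$ be any global minimizer of $\tilde J$ over $V_h$. Then $$\|\tilde u_h-u\|_{L^2(\Omega)}\le\sqrt\Gamma\,\|\tilde u_h-u\|_{\tilde c}\le 2\sqrt\Gamma\,\|\tilde u-u\|_{\tilde c}+\inf_{v\in V_h}\sqrt\Gamma\,\|v-u\|_{\tilde c}\le 2\Gamma\bigl(\mathbb E_{\mathrm{pde}}+\delta^{-1}\mathbb E_{\mathrm{data}}\bigr)+\inf_{v\in V_h}\sqrt\Gamma\,\|v-u\|_{\tilde c}.$$ -/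

import Mathlib

open MeasureTheory Set Filter
open scoped ContDiff ENNReal

noncomputable section

namespace PDELearning

/-- Euclidean space `ℝ^d`. -/
abbrev E (d : ℕ) : Type := EuclideanSpace ℝ (Fin d)

/-- The Lebesgue space `L²(Ω)`. -/
abbrev L2 {d : ℕ} (Ω : Set (E d)) : Type := Lp ℝ 2 (volume.restrict Ω)

/-- The space `L²(Ω; ℝ^d)` of square integrable vector fields. -/
abbrev L2Vec {d : ℕ} (Ω : Set (E d)) : Type := Lp (E d) 2 (volume.restrict Ω)

/-- Test functions, that is, the elements of `C_c^∞(Ω)`. -/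
structure IsTestFunction {d : ℕ} (Ω : Set (E d)) (φ : E d → ℝ) : Prop where
  contDiff : ContDiff ℝ ∞ φ
  hasCompactSupport : HasCompactSupport φ
  tsupport_subset : tsupport φ ⊆ Ω

/-- The partial derivative `∂φ/∂x_j`. -/
def partialDeriv {d : ℕ} (j : Fin d) (φ : E d → ℝ) (x : E d) : ℝ :=
  fderiv ℝ φ x (EuclideanSpace.single j 1)

/-- `g` is the weak gradient of `v` in `Ω`. -/
def IsWeakGradient {d : ℕ} (Ω : Set (E d)) (v : L2 Ω) (g : L2Vec Ω) : Prop :=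
  ∀ φ : E d → ℝ, IsTestFunction Ω φ → ∀ j : Fin d,
    ∫ x in Ω, v x * partialDeriv j φ x = - ∫ x in Ω, g x j * φ x

section helpers

variable {d : ℕ} {Ω : Set (E d)}

theorem IsTestFunction.memLp {φ : E d → ℝ} (h : IsTestFunction Ω φ) :
    MemLp φ 2 (volume.restrict Ω) :=
  (h.contDiff.continuous.memLp_of_hasCompactSupport h.hasCompactSupport).restrict Ω

theorem IsTestFunction.memLp_partialDeriv {φ : E d → ℝ} (h : IsTestFunction Ω φ) (j : Fin d) :
    MemLp (partialDeriv j φ) 2 (volume.restrict Ω) := by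
  have hc : Continuous (partialDeriv j φ) :=
    (h.contDiff.continuous_fderiv (by simp)).clm_apply continuous_const
  have hs : HasCompactSupport (partialDeriv j φ) :=
    h.hasCompactSupport.fderiv_apply ℝ (EuclideanSpace.single j 1)
  exact (hc.memLp_of_hasCompactSupport hs).restrict Ω

theorem memLp_coord (g : L2Vec Ω) (j : Fin d) :
    MemLp (fun x => g x j) 2 (volume.restrict Ω) :=
  (EuclideanSpace.proj (𝕜 := ℝ) j).comp_memLp' (Lp.memLp g)

theorem integrable_value_mul (v : L2 Ω) {φ : E d → ℝ} (h : IsTestFunction Ω φ) (j : Fin d) :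
    Integrable (fun x => v x * partialDeriv j φ x) (volume.restrict Ω) :=
  (Lp.memLp v).integrable_mul (h.memLp_partialDeriv j)

theorem integrable_coord_mul (g : L2Vec Ω) {φ : E d → ℝ} (h : IsTestFunction Ω φ) (j : Fin d) :
    Integrable (fun x => g x j * φ x) (volume.restrict Ω) :=
  (memLp_coord g j).integrable_mul h.memLp

theorem IsWeakGradient.zero : IsWeakGradient Ω 0 0 := by
  intro φ _ j
  have h1 : (fun x => (0 : L2 Ω) x * partialDeriv j φ x) =ᵐ[volume.restrict Ω] fun _ => 0 := by
    filter_upwards [Lp.coeFn_zero ℝ 2 (volume.restrict Ω)] with x hx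
    simp only [hx, Pi.zero_apply, zero_mul]
  have h2 : (fun x => (0 : L2Vec Ω) x j * φ x) =ᵐ[volume.restrict Ω] fun _ => 0 := by
    filter_upwards [Lp.coeFn_zero (E d) 2 (volume.restrict Ω)] with x hx
    simp only [hx, Pi.zero_apply, PiLp.zero_apply, zero_mul]
  rw [integral_congr_ae h1, integral_congr_ae h2]
  simp

theorem IsWeakGradient.add {v w : L2 Ω} {g k : L2Vec Ω} (hv : IsWeakGradient Ω v g)
    (hw : IsWeakGradient Ω w k) : IsWeakGradient Ω (v + w) (g + k) := by
  intro φ hφ j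
  have h1 : (fun x => (v + w : L2 Ω) x * partialDeriv j φ x) =ᵐ[volume.restrict Ω]
      fun x => v x * partialDeriv j φ x + w x * partialDeriv j φ x := by
    filter_upwards [Lp.coeFn_add v w] with x hx
    simp only [hx, Pi.add_apply, add_mul]
  have h2 : (fun x => (g + k : L2Vec Ω) x j * φ x) =ᵐ[volume.restrict Ω]
      fun x => g x j * φ x + k x j * φ x := by
    filter_upwards [Lp.coeFn_add g k] with x hx
    simp only [hx, Pi.add_apply, PiLp.add_apply, add_mul]
  rw [integral_congr_ae h1, integral_congr_ae h2,
    integral_add (integrable_value_mul v hφ j) (integrable_value_mul w hφ j),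
    integral_add (integrable_coord_mul g hφ j) (integrable_coord_mul k hφ j),
    hv φ hφ j, hw φ hφ j]
  ring

theorem IsWeakGradient.smul (c : ℝ) {v : L2 Ω} {g : L2Vec Ω} (hv : IsWeakGradient Ω v g) :
    IsWeakGradient Ω (c • v) (c • g) := by
  intro φ hφ j
  have h1 : (fun x => (c • v : L2 Ω) x * partialDeriv j φ x) =ᵐ[volume.restrict Ω]
      fun x => c * (v x * partialDeriv j φ x) := by
    filter_upwards [Lp.coeFn_smul c v] with x hx
    simp only [hx, Pi.smul_apply, smul_eq_mul, mul_assoc]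
  have h2 : (fun x => (c • g : L2Vec Ω) x j * φ x) =ᵐ[volume.restrict Ω]
      fun x => c * (g x j * φ x) := by
    filter_upwards [Lp.coeFn_smul c g] with x hx
    simp only [hx, Pi.smul_apply, PiLp.smul_apply, smul_eq_mul, mul_assoc]
  rw [integral_congr_ae h1, integral_congr_ae h2, integral_const_mul, integral_const_mul,
    hv φ hφ j]
  ring

end helpers

/-- The Sobolev space `H¹(Ω)`, realized as the space of all pairs `(v, ∇v)` of a function
`v ∈ L²(Ω)` and its weak gradient `∇v ∈ L²(Ω; ℝ^d)` (which is determined by `v` if `Ω` is open).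
The norm inherited from the `ℓ²`-product is `(‖v‖² + ‖∇v‖²)^{1/2}`. -/
def H1 {d : ℕ} (Ω : Set (E d)) : Submodule ℝ (WithLp 2 (L2 Ω × L2Vec Ω)) where
  carrier := {p | IsWeakGradient Ω p.fst p.snd}
  zero_mem' := IsWeakGradient.zero
  add_mem' := fun ha hb => IsWeakGradient.add ha hb
  smul_mem' := fun c _ ha => IsWeakGradient.smul c ha

/-- The function `v ∈ L²(Ω)` underlying an element of `H¹(Ω)`. -/
def toL2 {d : ℕ} {Ω : Set (E d)} (v : H1 Ω) : L2 Ω := (v : WithLp 2 (L2 Ω × L2Vec Ω)).fst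

/-- The weak gradient of an element of `H¹(Ω)`. -/
def grad {d : ℕ} {Ω : Set (E d)} (v : H1 Ω) : L2Vec Ω :=
  (v : WithLp 2 (L2 Ω × L2Vec Ω)).snd

/-- `H¹₀(Ω)`: the closure of `C_c^∞(Ω)` in `H¹(Ω)`. -/
def H10 {d : ℕ} (Ω : Set (E d)) : Set (H1 Ω) :=
  closure {v | ∃ φ : E d → ℝ, IsTestFunction Ω φ ∧ toL2 v =ᵐ[volume.restrict Ω] φ}

/-- The coefficients `α` (bounded, with positive lower bound `αmin`) and `σ` (bounded and
nonnegative) of an elliptic operator on `Ω`. -/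
structure IsEllipticCoeff {d : ℕ} (Ω : Set (E d)) (α σ : E d → ℝ) (αmin : ℝ) : Prop where
  pos : 0 < αmin
  aestronglyMeasurable_α : AEStronglyMeasurable α (volume.restrict Ω)
  aestronglyMeasurable_σ : AEStronglyMeasurable σ (volume.restrict Ω)
  le_α : ∀ᵐ x ∂(volume.restrict Ω), αmin ≤ α x
  α_le : ∃ αmax : ℝ, ∀ᵐ x ∂(volume.restrict Ω), α x ≤ αmax
  σ_nonneg : ∀ᵐ x ∂(volume.restrict Ω), 0 ≤ σ x
  σ_le : ∃ σmax : ℝ, ∀ᵐ x ∂(volume.restrict Ω), σ x ≤ σmax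

/-- The bilinear form `a(w,v) = ∫_Ω α ∇w · ∇v + σ w v dx`. -/
def aForm {d : ℕ} {Ω : Set (E d)} (α σ : E d → ℝ) (w v : H1 Ω) : ℝ :=
  ∫ x in Ω, (α x * inner ℝ (grad w x) (grad v x) + σ x * toL2 w x * toL2 v x)

/-- The linear functional `ℓ(v) = ∫_Ω f v dx`. -/
def load {d : ℕ} {Ω : Set (E d)} (f : E d → ℝ) (v : H1 Ω) : ℝ :=
  ∫ x in Ω, f x * toL2 v x

/-- The data sets `B_i` (open, nonempty, contained in `Ω`) and their convex extensions `K_i`,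
whose closures cover `Ω`. The sets `K_i` lie in `Ω` up to boundary points. They have Lipschitz
boundary automatically, being convex with nonempty interior (and bounded if `Ω` is). -/
structure IsDataCover {d m : ℕ} (Ω : Set (E d)) (B K : Fin m → Set (E d)) : Prop where
  isOpen_B : ∀ i, IsOpen (B i)
  nonempty_B : ∀ i, (B i).Nonempty
  B_subset : ∀ i, B i ⊆ Ω
  convex_K : ∀ i, Convex ℝ (K i)
  B_subset_K : ∀ i, B i ⊆ K i
  interior_K_subset : ∀ i, interior (K i) ⊆ Ω
  cover : Ω ⊆ ⋃ i, closure (K i)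

/-- The maximal overlap `M = max_{x ∈ Ω} |{i | x ∈ K_i}|`. -/
def maxOverlap {d m : ℕ} (Ω : Set (E d)) (K : Fin m → Set (E d)) : ℕ :=
  sSup ((fun x => {i : Fin m | x ∈ K i}.ncard) '' Ω)

/-- The maximal diameter `R = max_i diam K_i`. -/
def maxDiam {d m : ℕ} (K : Fin m → Set (E d)) : ℝ := ⨆ i, Metric.diam (K i)

open Classical in
/-- The mismatch `η` of the `B_i` and `K_i`: it is `1` if `B_i = K_i` for all `i`, and
`3 max_i |K_i| / |B_i|` otherwise. -/
def mismatch {d m : ℕ} (B K : Fin m → Set (E d)) : ℝ :=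
  if ∀ i, B i = K i then 1 else 3 * ⨆ i, volume.real (K i) / volume.real (B i)

/-- The constant `Γ = η max {R² M / (π² αmin), δ}`. -/
def Gam {d m : ℕ} (Ω : Set (E d)) (B K : Fin m → Set (E d)) (αmin δ : ℝ) : ℝ :=
  mismatch B K * max (maxDiam K ^ 2 * (maxOverlap Ω K : ℝ) / (Real.pi ^ 2 * αmin)) δ

/-- The data form `b(w,v) = ∑_i |B_i| ⨍_{B_i} w ⨍_{B_i} v`. -/
def bForm {d m : ℕ} {Ω : Set (E d)} (B : Fin m → Set (E d)) (w v : H1 Ω) : ℝ :=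
  ∑ i, volume.real (B i) * (⨍ x in B i, toL2 w x) * (⨍ x in B i, toL2 v x)

/-- The inexact data functional `v ↦ ∑_i β_i |B_i| ⨍_{B_i} v` for given data `β_1, …, β_m`. -/
def dataTerm {d m : ℕ} {Ω : Set (E d)} (B : Fin m → Set (E d)) (β : Fin m → ℝ) (v : H1 Ω) : ℝ :=
  ∑ i, β i * volume.real (B i) * (⨍ x in B i, toL2 v x)

/-- The augmented form `c(w,v) = a(w,v) + δ⁻¹ b(w,v)`. -/
def cForm {d m : ℕ} {Ω : Set (E d)} (α σ : E d → ℝ) (B : Fin m → Set (E d)) (δ : ℝ)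
    (w v : H1 Ω) : ℝ :=
  aForm α σ w v + δ⁻¹ * bForm B w v

/-- The energy norm `‖v‖_c = c(v,v)^{1/2}`. -/
def cNorm {d m : ℕ} {Ω : Set (E d)} (α σ : E d → ℝ) (B : Fin m → Set (E d)) (δ : ℝ)
    (v : H1 Ω) : ℝ :=
  Real.sqrt (cForm α σ B δ v v)

/-- The augmented right hand side `r(v) = ℓ(v) + δ⁻¹ ∑_i β_i |B_i| ⨍_{B_i} v`. -/
def rhs {d m : ℕ} {Ω : Set (E d)} (f : E d → ℝ) (B : Fin m → Set (E d)) (β : Fin m → ℝ) (δ : ℝ)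
    (v : H1 Ω) : ℝ :=
  load f v + δ⁻¹ * dataTerm B β v

/-- The regularized functional `J(v) = ½ c(v,v) - r(v)`. -/
def J {d m : ℕ} {Ω : Set (E d)} (α σ f : E d → ℝ) (B : Fin m → Set (E d)) (β : Fin m → ℝ)
    (δ : ℝ) (v : H1 Ω) : ℝ :=
  1 / 2 * cForm α σ B δ v v - rhs f B β δ v

/-- `v` is a global minimizer over the set `S` of the functional `F`. -/
def IsMinimizer {X : Type*} (F : X → ℝ) (S : Set X) (v : X) : Prop :=
  v ∈ S ∧ ∀ w ∈ S, F v ≤ F w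

/-- `g ∈ L²(Ω)` represents the functional `F` on `V`, that is, `F(v) = ∫_Ω g v dx` for `v ∈ V`. -/
def Represents {d : ℕ} {Ω : Set (E d)} (V : Submodule ℝ (H1 Ω)) (F : H1 Ω → ℝ) (g : L2 Ω) :
    Prop :=
  ∀ v ∈ V, F v = ∫ x in Ω, g x * toL2 v x

/-- `F ∈ L²(Ω)` for a functional `F` on `V`. -/
def IsL2Functional {d : ℕ} {Ω : Set (E d)} (V : Submodule ℝ (H1 Ω)) (F : H1 Ω → ℝ) : Prop :=
  ∃ g : L2 Ω, Represents V F g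

/-- The `L²(Ω)`-norm of a functional `F ∈ L²(Ω)` on `V`, that is, the norm of the function `g`
representing it. If `V` contains `H¹₀(Ω)`, then it is dense in `L²(Ω)`, hence `g` is unique and
the set below has exactly one element. -/
def functionalL2Norm {d : ℕ} {Ω : Set (E d)} (V : Submodule ℝ (H1 Ω)) (F : H1 Ω → ℝ) : ℝ :=
  sInf {s | ∃ g : L2 Ω, Represents V F g ∧ s = ‖g‖}

/-- The PDE error `‖ℓ - a(u,·)‖_{L²(Ω)}`. -/
def Epde {d : ℕ} {Ω : Set (E d)} (V : Submodule ℝ (H1 Ω)) (α σ f : E d → ℝ) (u : H1 Ω) : ℝ :=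
  functionalL2Norm V fun v => load f v - aForm α σ u v

/-- The data error `‖∑_i β_i |B_i| ⨍_{B_i}(·) - b(u,·)‖_{L²(Ω)}`. -/
def Edata {d m : ℕ} {Ω : Set (E d)} (V : Submodule ℝ (H1 Ω)) (B : Fin m → Set (E d))
    (β : Fin m → ℝ) (u : H1 Ω) : ℝ :=
  functionalL2Norm V fun v => dataTerm B β v - bForm B u v

end PDELearning

end

open PDELearning

/-!
The heart of the theorem is the estimate `‖v‖² ≤ Γ c(v,v)` in `L²(Ω)` for all `v ∈ H¹(Ω)`
(`norm_toL2_sq_le_cForm`). With it, `c` is coercive on `H¹(Ω)`, so the minimizer `ut` exists and is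
the solution of `c(ut, v) = r(v)` for `v ∈ V`; `J` exceeds its minimum by half the squared energy
distance to `ut` (`J_sub_J`), so that a minimizer over `Vh` is a best approximation of `ut` in the
energy norm, and two triangle inequalities give the second bound. Testing the equation for
`e = ut - u` with `e` itself gives `‖e‖_c² ≤ (Epde + δ⁻¹ Edata) ‖e‖` and hence the third bound.

The estimate of the `L²` norm is summed up from estimates on the `K_i`, which rest on the
Payne–Weinberger inequality (`payne_weinberger`): on a convex set of diameter `D` the Poincaré
constant is at most `D / π`. Its proof uses needles. If a smooth `f` with mean zero violates the
inequality on `C`, then so it does on one of the halves into which a hyperplane cuts `C` evenly with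
respect to the integral of `f`. There is such a hyperplane through every point, with a normal in any
given plane. Cutting through a dense set of points, in all pairs of coordinate directions, shrinks
`C` to a set near a line (`IsLocalizer.exists_thin`), where `f` is nearly a function of one variable
(`poincare_thin`). For functions of one variable `⟪e, x⟫` on a convex set, the inequality is a
weighted inequality on an interval (`ridge_variance_le`). The weight is log-concave by the
Prékopa–Leindler inequality (`prekopaLeindler_euclidean`), it becomes smooth after convolution with
a Gaussian, and for smooth log-concave weights the inequality follows by completing squares
(`weighted_poincare_interval`). Functions in `H¹` are treated by mollification on slightly shrunken
sets, with Fatou's lemma applied to the double integral of `(v(x) - v(y))²`.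
-/

/-! ### The Prékopa–Leindler inequality -/

namespace PDELearning

theorem ennreal_mul_le_sq_of_add_le {a b c : ℝ≥0∞} (h : a + b ≤ 2 * c) : a * b ≤ c ^ 2 := by
  rcases eq_or_ne c ⊤ with rfl | hc
  · simp
  have hfin : a + b ≠ ⊤ := ne_top_of_le_ne_top (ENNReal.mul_ne_top (by simp) hc) h
  have ha : a ≠ ⊤ := fun h' => hfin (by simp [h'])
  have hb : b ≠ ⊤ := fun h' => hfin (by simp [h'])
  lift a to NNReal using ha
  lift b to NNReal using hb
  lift c to NNReal using hc
  norm_cast at h ⊢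
  rw [← NNReal.coe_le_coe] at h ⊢
  push_cast at h ⊢
  nlinarith [sq_nonneg ((a : ℝ) - b), a.coe_nonneg, b.coe_nonneg, c.coe_nonneg]

theorem volume_preimage_half_add (b : ℝ) (s : Set ℝ) :
    volume ((fun x : ℝ => (x + b) / 2) ⁻¹' s) = 2 * volume s := by
  have h1 : (fun x : ℝ => (x + b) / 2) ⁻¹' s
      = (fun x => x + b) ⁻¹' ((fun x => (1 / 2 : ℝ) * x) ⁻¹' s) := by
    ext x
    simp only [mem_preimage]
    rw [show (x + b) / 2 = 1 / 2 * (x + b) by ring]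
  rw [h1, measure_preimage_add_right, Real.volume_preimage_mul_left (by norm_num)]
  norm_num

/-- The Brunn–Minkowski inequality on the line, for compact sets. The two half-size copies of `A`
and `B` that are glued at `(max A + min B) / 2` overlap in a single point. -/
theorem volume_add_le_of_isCompact {A B H : Set ℝ} (hA : IsCompact A) (hB : IsCompact B)
    (hA0 : A.Nonempty) (hB0 : B.Nonempty) (hH : ∀ x ∈ A, ∀ y ∈ B, (x + y) / 2 ∈ H) :
    volume A + volume B ≤ 2 * volume H := by
  obtain ⟨a, ha, hmax⟩ := hA.exists_isGreatest hA0
  obtain ⟨b, hb, hmin⟩ := hB.exists_isLeast hB0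
  set c := (a + b) / 2 with hc
  have h1 : volume A ≤ 2 * volume (H ∩ Iic c) := by
    rw [← volume_preimage_half_add b]
    refine measure_mono fun x hx => ⟨hH x hx b hb, ?_⟩
    have := hmax hx
    simp only [mem_Iic, hc]
    linarith
  have h2 : volume B ≤ 2 * volume (H ∩ Ici c) := by
    rw [← volume_preimage_half_add a]
    refine measure_mono fun x hx => ⟨?_, ?_⟩
    · simpa only [mem_preimage, add_comm x a] using hH a ha x hx
    have := hmin hx
    simp only [mem_Ici, hc]
    linarith
  have h3 : volume (H ∩ Ici c) = volume (H \ Iic c) := by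
    rw [sdiff_eq, compl_Iic]
    exact measure_congr ((ae_eq_refl H).inter Ioi_ae_eq_Ici.symm)
  calc volume A + volume B ≤ 2 * volume (H ∩ Iic c) + 2 * volume (H \ Iic c) := by
        rw [← h3]; exact add_le_add h1 h2
    _ = 2 * volume H := by rw [← mul_add, measure_inter_add_sdiff _ measurableSet_Iic]

/-- The Brunn–Minkowski inequality on the line. -/
theorem volume_add_le {A B H : Set ℝ} (hA : MeasurableSet A) (hB : MeasurableSet B)
    (hA0 : A.Nonempty) (hB0 : B.Nonempty) (hH : ∀ x ∈ A, ∀ y ∈ B, (x + y) / 2 ∈ H) :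
    volume A + volume B ≤ 2 * volume H := by
  rw [hA.measure_eq_iSup_isCompact, hB.measure_eq_iSup_isCompact]
  obtain ⟨a, ha⟩ := hA0
  obtain ⟨b, hb⟩ := hB0
  simp only [iSup_and']
  refine ENNReal.biSup_add_biSup_le' (p := fun K => K ⊆ A ∧ IsCompact K)
    (q := fun K => K ⊆ B ∧ IsCompact K) ⟨∅, by simp⟩ ⟨∅, by simp⟩ ?_
  rintro K ⟨hKA, hK⟩ L ⟨hLB, hL⟩
  -- the compact sets are enlarged by one point to make them nonempty
  refine (add_le_add (measure_mono (subset_insert a K)) (measure_mono (subset_insert b L))).trans ?_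
  refine volume_add_le_of_isCompact (hK.insert a) (hL.insert b) (insert_nonempty _ _)
    (insert_nonempty _ _) fun x hx y hy => hH x ?_ y ?_
  · exact insert_subset ha hKA hx
  · exact insert_subset hb hLB hy

/-- A measure on a real vector space satisfies the Prékopa–Leindler inequality at the midpoint. -/
def PrekopaLeindler {X : Type*} [AddCommGroup X] [Module ℝ X] [MeasurableSpace X]
    (μ : Measure X) : Prop :=
  ∀ f g h : X → ℝ≥0∞, Measurable f → Measurable g → Measurable h →
    (∀ x y, f x * g y ≤ h ((1 / 2 : ℝ) • (x + y)) ^ 2) →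
    (∫⁻ x, f x ∂μ) * (∫⁻ x, g x ∂μ) ≤ (∫⁻ x, h x ∂μ) ^ 2

/-- Truncation reduces the Prékopa–Leindler inequality to bounded `f` and `g`. -/
theorem PrekopaLeindler.of_bounded {X : Type*} [AddCommGroup X] [Module ℝ X] [MeasurableSpace X]
    {μ : Measure X}
    (H : ∀ f g h : X → ℝ≥0∞, Measurable f → Measurable g → Measurable h →
      (∃ n : ℕ, (∀ x, f x ≤ n) ∧ ∀ x, g x ≤ n) →
      (∀ x y, f x * g y ≤ h ((1 / 2 : ℝ) • (x + y)) ^ 2) →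
      (∫⁻ x, f x ∂μ) * (∫⁻ x, g x ∂μ) ≤ (∫⁻ x, h x ∂μ) ^ 2) : PrekopaLeindler μ := by
  intro f g h hf hg hh hfgh
  have key : ∀ f : X → ℝ≥0∞, Measurable f →
      ∫⁻ x, f x ∂μ = ⨆ n : ℕ, ∫⁻ x, min (f x) n ∂μ := by
    intro f hf
    rw [← lintegral_iSup (fun n => hf.min measurable_const)
      (fun n m hnm x => min_le_min le_rfl (by exact_mod_cast hnm))]
    refine lintegral_congr fun x => ?_
    refine le_antisymm ?_ (iSup_le fun n => min_le_left _ _)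
    rcases eq_or_ne (f x) ⊤ with hx | hx
    · simp [hx, ENNReal.iSup_natCast]
    · obtain ⟨n, hn⟩ := ENNReal.exists_nat_gt hx
      exact le_iSup_of_le n (by simp [hn.le])
  have mono : ∀ f : X → ℝ≥0∞, Monotone fun n : ℕ => ∫⁻ x, min (f x) n ∂μ := fun f n m hnm =>
    lintegral_mono fun x => min_le_min le_rfl (by exact_mod_cast hnm)
  rw [key f hf, key g hg]
  simp only [ENNReal.iSup_mul, ENNReal.mul_iSup]
  refine iSup_le fun k => iSup_le fun n => ?_
  refine (mul_le_mul' (mono f (le_max_left n k)) (mono g (le_max_right n k))).trans ?_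
  refine H _ _ h (hf.min measurable_const) (hg.min measurable_const) hh
    ⟨max n k, fun x => min_le_right _ _, fun x => min_le_right _ _⟩ fun x y => ?_
  exact (mul_le_mul' (min_le_left _ _) (min_le_left _ _)).trans (hfgh x y)

/-- The Prékopa–Leindler inequality on the line. After normalizing the suprema of `f` and `g` to
`1`, the Brunn–Minkowski inequality applies to all superlevel sets, and the layer cake formula
gives `∫ f + ∫ g ≤ 2 ∫ h`. -/
theorem prekopaLeindler_real : PrekopaLeindler (volume : Measure ℝ) := by
  refine PrekopaLeindler.of_bounded ?_
  rintro f g h hf hg hh ⟨n, hfn, hgn⟩ hfgh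
  set A := ⨆ x, f x with hA
  set B := ⨆ x, g x with hB
  have hAtop : A ≠ ⊤ := ne_top_of_le_ne_top (by simp) (iSup_le hfn)
  have hBtop : B ≠ ⊤ := ne_top_of_le_ne_top (by simp) (iSup_le hgn)
  have hfA : ∀ x, f x ≤ A := le_iSup f
  have hgB : ∀ x, g x ≤ B := le_iSup g
  rcases eq_or_ne A 0 with hA0 | hA0
  · have : ∀ x, f x = 0 := fun x => le_antisymm ((hfA x).trans hA0.le) bot_le
    simp [this]
  rcases eq_or_ne B 0 with hB0 | hB0
  · have : ∀ x, g x = 0 := fun x => le_antisymm ((hgB x).trans hB0.le) bot_le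
    simp [this]
  set a := A.toReal with ha
  set b := B.toReal with hb
  have ha0 : 0 < a := ENNReal.toReal_pos hA0 hAtop
  have hb0 : 0 < b := ENNReal.toReal_pos hB0 hBtop
  set s := ENNReal.ofReal √(a * b) with hs
  have hs0 : s ≠ 0 := by simp only [hs, ne_eq, ENNReal.ofReal_eq_zero, not_le]; positivity
  have hsfin : s ≠ ⊤ := ENNReal.ofReal_ne_top
  have hs2 : s ^ 2 = A * B := by
    rw [hs, ← ENNReal.ofReal_pow (by positivity), Real.sq_sqrt (by positivity),
      ENNReal.ofReal_mul ha0.le, ENNReal.ofReal_toReal hAtop, ENNReal.ofReal_toReal hBtop]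
  have lay : ∀ (F : ℝ → ℝ≥0∞) (S : ℝ≥0∞), Measurable F → (∀ x, F x ≤ S) → S ≠ 0 → S ≠ ⊤ →
      ∫⁻ x, F x = S * ∫⁻ t in Ioi (0 : ℝ), volume {x | ENNReal.ofReal t * S < F x} := by
    intro F S hF hFS h0 htop
    have e1 : ∀ x, F x = S * ENNReal.ofReal ((F x / S).toReal) := fun x => by
      rw [ENNReal.ofReal_toReal (ENNReal.div_ne_top (ne_top_of_le_ne_top htop (hFS x)) h0),
        ENNReal.mul_div_cancel h0 htop]
    have hm : Measurable fun x => (F x / S).toReal := (hF.div_const S).ennreal_toReal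
    rw [lintegral_congr e1, lintegral_const_mul _ hm.ennreal_ofReal,
      lintegral_eq_lintegral_meas_lt _ (Eventually.of_forall fun x => ENNReal.toReal_nonneg)
        hm.aemeasurable]
    congr 1
    refine setLIntegral_congr_fun measurableSet_Ioi fun t ht => ?_
    congr 1
    ext x
    simp only [mem_ofPred_eq]
    rw [← ENNReal.ofReal_lt_iff_lt_toReal (le_of_lt ht)
      (ENNReal.div_ne_top (ne_top_of_le_ne_top htop (hFS x)) h0),
      ENNReal.lt_div_iff_mul_lt (Or.inl h0) (Or.inl htop)]
  -- truncating `h` at `s` makes the layer cake formula for bounded functions applicable to it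
  set h' : ℝ → ℝ≥0∞ := fun x => min (h x) s with hh'
  have hh'm : Measurable h' := hh.min measurable_const
  have main : (∫⁻ t in Ioi (0 : ℝ), volume {x | ENNReal.ofReal t * A < f x})
      + (∫⁻ t in Ioi (0 : ℝ), volume {x | ENNReal.ofReal t * B < g x})
      ≤ 2 * ∫⁻ t in Ioi (0 : ℝ), volume {x | ENNReal.ofReal t * s < h' x} := by
    have mk : ∀ (F : ℝ → ℝ≥0∞) (S : ℝ≥0∞),
        Measurable fun t : ℝ => volume {x | ENNReal.ofReal t * S < F x} := fun F S =>
      Antitone.measurable fun t u htu => measure_mono fun x hx =>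
        lt_of_le_of_lt (mul_le_mul_left (ENNReal.ofReal_le_ofReal htu) S) hx
    rw [← lintegral_add_left (mk f A), ← lintegral_const_mul _ (mk h' s)]
    refine setLIntegral_mono ((mk h' s).const_mul 2) fun t ht => ?_
    have ht0 : (0 : ℝ) < t := ht
    rcases lt_or_ge t 1 with ht1 | ht1
    · have hlt : ENNReal.ofReal t < 1 := by simpa using ht1
      have sub : ∀ S : ℝ≥0∞, S ≠ 0 → S ≠ ⊤ → ENNReal.ofReal t * S < S := fun S h0 htop => by
        simpa using (ENNReal.mul_lt_mul_iff_left h0 htop).2 hlt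
      refine volume_add_le (measurableSet_lt measurable_const hf)
        (measurableSet_lt measurable_const hg) (lt_iSup_iff.1 (sub A hA0 hAtop))
        (lt_iSup_iff.1 (sub B hB0 hBtop)) fun x hx y hy => ?_
      simp only [mem_ofPred_eq] at hx hy
      refine lt_min ?_ (sub s hs0 hsfin)
      have h1 := hfgh x y
      have h2 : (ENNReal.ofReal t * s) ^ 2 < h ((x + y) / 2) ^ 2 := by
        calc (ENNReal.ofReal t * s) ^ 2 = (ENNReal.ofReal t * A) * (ENNReal.ofReal t * B) := by
              rw [mul_pow, hs2]; ring
          _ < f x * g y := ENNReal.mul_lt_mul hx hy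
          _ ≤ _ := by
            refine h1.trans (le_of_eq ?_)
            rw [smul_eq_mul, show (1 / 2 : ℝ) * (x + y) = (x + y) / 2 by ring]
      exact lt_of_pow_lt_pow_left' 2 h2
    · have hle : 1 ≤ ENNReal.ofReal t := by simpa using ht1
      have e1 : {x | ENNReal.ofReal t * A < f x} = ∅ := by
        ext x; simpa using (hfA x).trans (by simpa using mul_le_mul_left hle A)
      have e2 : {x | ENNReal.ofReal t * B < g x} = ∅ := by
        ext x; simpa using (hgB x).trans (by simpa using mul_le_mul_left hle B)
      simp [e1, e2]
  have := ennreal_mul_le_sq_of_add_le main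
  calc (∫⁻ x, f x) * ∫⁻ x, g x
      = s ^ 2 * ((∫⁻ t in Ioi (0 : ℝ), volume {x | ENNReal.ofReal t * A < f x})
        * (∫⁻ t in Ioi (0 : ℝ), volume {x | ENNReal.ofReal t * B < g x})) := by
        rw [lay f A hf hfA hA0 hAtop, lay g B hg hgB hB0 hBtop, hs2]; ring
    _ ≤ s ^ 2 * (∫⁻ t in Ioi (0 : ℝ), volume {x | ENNReal.ofReal t * s < h' x}) ^ 2 := by
        gcongr
    _ = (∫⁻ x, h' x) ^ 2 := by
        rw [lay h' s hh'm (fun x => min_le_right _ _) hs0 hsfin, mul_pow]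
    _ ≤ (∫⁻ x, h x) ^ 2 := by
        gcongr with x; exact min_le_left _ _

theorem PrekopaLeindler.prod {X Y : Type*} [AddCommGroup X] [Module ℝ X] [MeasurableSpace X]
    [AddCommGroup Y] [Module ℝ Y] [MeasurableSpace Y] {μ : Measure X} {ν : Measure Y} [SFinite ν]
    (hμ : PrekopaLeindler μ) (hν : PrekopaLeindler ν) : PrekopaLeindler (μ.prod ν) := by
  intro f g h hf hg hh hfgh
  rw [lintegral_prod _ hf.aemeasurable, lintegral_prod _ hg.aemeasurable,
    lintegral_prod _ hh.aemeasurable]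
  refine hμ _ _ _ hf.lintegral_prod_right' hg.lintegral_prod_right' hh.lintegral_prod_right'
    fun x x' => ?_
  refine hν _ _ _ (hf.comp measurable_prodMk_left) (hg.comp measurable_prodMk_left)
    (hh.comp measurable_prodMk_left) fun y y' => ?_
  exact hfgh (x, y) (x', y')

theorem PrekopaLeindler.of_measurePreserving {X Y : Type*} [AddCommGroup X] [Module ℝ X]
    [MeasurableSpace X] [AddCommGroup Y] [Module ℝ Y] [MeasurableSpace Y] {μ : Measure X}
    {ν : Measure Y} (hμ : PrekopaLeindler μ) (e : X → Y) (he : MeasurePreserving e μ ν)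
    (hadd : ∀ x y, e ((1 / 2 : ℝ) • (x + y)) = (1 / 2 : ℝ) • (e x + e y)) :
    PrekopaLeindler ν := by
  intro f g h hf hg hh hfgh
  rw [← he.lintegral_comp hf, ← he.lintegral_comp hg, ← he.lintegral_comp hh]
  refine hμ _ _ _ (hf.comp he.measurable) (hg.comp he.measurable) (hh.comp he.measurable)
    fun x y => ?_
  rw [hadd]
  exact hfgh _ _

theorem prekopaLeindler_pi (n : ℕ) : PrekopaLeindler (volume : Measure (Fin n → ℝ)) := by
  induction n with
  | zero =>
    intro f g h _ _ _ hfgh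
    have : (volume : Measure (Fin 0 → ℝ)) = Measure.dirac 0 := by
      rw [volume_pi, Measure.pi_of_empty]
      congr 1
      exact Subsingleton.elim _ _
    rw [this]
    simp only [lintegral_dirac]
    simpa using hfgh 0 0
  | succ n ih =>
    refine (prekopaLeindler_real.prod ih).of_measurePreserving
      (MeasurableEquiv.piFinSuccAbove (fun _ : Fin (n + 1) => ℝ) 0).symm
      ((volume_preserving_piFinSuccAbove (fun _ : Fin (n + 1) => ℝ) 0).symm _) fun x y => ?_
    ext i
    refine Fin.cases ?_ (fun j => ?_) i <;>
      simp [MeasurableEquiv.piFinSuccAbove, Fin.insertNthEquiv] <;> ring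

/-- The Prékopa–Leindler inequality on Euclidean space. -/
theorem prekopaLeindler_euclidean (d : ℕ) : PrekopaLeindler (volume : Measure (E d)) :=
  (prekopaLeindler_pi d).of_measurePreserving (WithLp.toLp 2)
    (PiLp.volume_preserving_toLp (Fin d)) fun x y => by
      ext i; simp; ring

/-! ### A weighted Poincaré inequality on an interval -/

/-- The sharp weighted Poincaré inequality on an interval of length less than `π / c`, for a
log-concave weight `exp L`. With `h(t) = ∫_a^t exp(L) g`, which vanishes at both ends, and
`θ = L' / 2 + c cot s` for an affine function `s` with values in `(0, π)`, two completed squares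
give `c² (θ h² exp(-L) - 2 g h)' ≤ exp(L) (g'² - c² g²)`. -/
theorem weighted_poincare_interval {L L1 L2 g g1 : ℝ → ℝ} {a b c : ℝ} (hab : a ≤ b) (hc : 0 < c)
    (hcπ : c * (b - a) < Real.pi) (hL : ∀ t, HasDerivAt L (L1 t) t)
    (hL1 : ∀ t, HasDerivAt L1 (L2 t) t) (hL2 : ∀ t, L2 t ≤ 0)
    (hg : ∀ t, HasDerivAt g (g1 t) t) (hg1 : Continuous g1)
    (hmean : ∫ t in a..b, Real.exp (L t) * g t = 0) :
    c ^ 2 * ∫ t in a..b, Real.exp (L t) * g t ^ 2 ≤ ∫ t in a..b, Real.exp (L t) * g1 t ^ 2 := by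
  have cL : Continuous L := continuous_iff_continuousAt.2 fun t => (hL t).continuousAt
  have cg : Continuous g := continuous_iff_continuousAt.2 fun t => (hg t).continuousAt
  set h : ℝ → ℝ := fun t => ∫ x in a..t, Real.exp (L x) * g x with hh
  have hh' : ∀ t, HasDerivAt h (Real.exp (L t) * g t) t := fun t => by
    have hcont : Continuous fun x => Real.exp (L x) * g x := by fun_prop
    exact intervalIntegral.integral_hasDerivAt_right (hcont.intervalIntegrable _ _)
      (hcont.stronglyMeasurableAtFilter _ _)
      hcont.continuousAt
  have ha : h a = 0 := by simp [hh]
  have hb : h b = 0 := hmean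
  -- the shift `τ` keeps `s` away from the zeros `0` and `π` of the sine
  set τ := (Real.pi - c * (b - a)) / 2 with hτ
  have hτ0 : 0 < τ := by simp only [hτ]; linarith
  set s : ℝ → ℝ := fun t => c * (t - a) + τ with hs
  have hs' : ∀ t, HasDerivAt s c t := fun t => by
    exact ((((hasDerivAt_id t).sub_const a).const_mul c).add_const τ).congr_deriv (by simp)
  have hsin : ∀ t ∈ Icc a b, 0 < Real.sin (s t) := fun t ht => by
    refine Real.sin_pos_of_pos_of_lt_pi ?_ ?_
    · have := mul_nonneg hc.le (sub_nonneg.2 ht.1)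
      simp only [hs]; linarith
    · have := mul_le_mul_of_nonneg_left (sub_le_sub_right ht.2 a) hc.le
      simp only [hs, hτ]; linarith
  set θ : ℝ → ℝ := fun t => L1 t / 2 + c * (Real.cos (s t) / Real.sin (s t)) with hθ
  set Ψ : ℝ → ℝ := fun t => c ^ 2 * (θ t * h t ^ 2 * Real.exp (-L t) - 2 * (g t * h t)) with hΨ
  set D : ℝ → ℝ := fun t => c ^ 2 * (((L2 t / 2 - c ^ 2 / Real.sin (s t) ^ 2) * h t ^ 2
      + θ t * (2 * h t * (Real.exp (L t) * g t))) * Real.exp (-L t)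
      + θ t * h t ^ 2 * (Real.exp (-L t) * (-L1 t))
      - 2 * (g1 t * h t + g t * (Real.exp (L t) * g t))) with hD
  have hΨ' : ∀ t ∈ Icc a b, HasDerivAt Ψ (D t) t := fun t ht => by
    have e1 : HasDerivAt θ (L2 t / 2 - c ^ 2 / Real.sin (s t) ^ 2) t := by
      have hq := (((hs' t).cos).div ((hs' t).sin) (hsin t ht).ne').const_mul c
      refine (((hL1 t).div_const 2).add hq).congr_deriv ?_
      have := Real.sin_sq_add_cos_sq (s t)
      have h0 := (hsin t ht).ne'
      field_simp
      linear_combination (-2 * c ^ 2) * this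
    have e2 : HasDerivAt (fun t => h t ^ 2) (2 * h t * (Real.exp (L t) * g t)) t := by
      exact ((hh' t).pow 2).congr_deriv (by simp)
    exact ((((e1.mul e2).mul (hL t).neg.exp).sub (((hg t).mul (hh' t)).const_mul 2))).const_mul _
  have hle : ∀ t ∈ Icc a b, D t ≤ Real.exp (L t) * g1 t ^ 2 - c ^ 2 * (Real.exp (L t) * g t ^ 2) :=
    fun t ht => by
    have h0 := (hsin t ht).ne'
    set k := Real.cos (s t) / Real.sin (s t) with hk
    have hcsc : c ^ 2 / Real.sin (s t) ^ 2 = c ^ 2 * (1 + k ^ 2) := by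
      rw [hk]
      field_simp
      linear_combination (-1) * Real.sin_sq_add_cos_sq (s t)
    have hexp : Real.exp (-L t) * Real.exp (L t) = 1 := by rw [← Real.exp_add]; simp
    have hθk : θ t = L1 t / 2 + c * k := rfl
    simp only [hD, hcsc]
    set w := Real.exp (-L t) with hw
    set p := Real.exp (L t) with hp
    have hw0 : 0 < w := Real.exp_pos _
    have hp0 : 0 < p := Real.exp_pos _
    have q1 : 0 ≤ p * (g t - θ t * h t * w) ^ 2 := by positivity
    have q2 : 0 ≤ p * (g1 t + c ^ 2 * w * h t) ^ 2 := by positivity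
    have q3 : 0 ≤ (-L2 t) * (h t ^ 2 * w) := mul_nonneg (by linarith [hL2 t]) (by positivity)
    have q4 : 0 ≤ (L1 t) ^ 2 * (h t ^ 2 * w) := by positivity
    have r1 : p * (g t - θ t * h t * w) ^ 2
        = p * g t ^ 2 - 2 * (θ t * h t * g t) + θ t ^ 2 * h t ^ 2 * w := by
      linear_combination (-2 * θ t * h t * g t + θ t ^ 2 * h t ^ 2 * w) * hexp
    have r2 : p * (g1 t + c ^ 2 * w * h t) ^ 2
        = p * g1 t ^ 2 + 2 * c ^ 2 * (g1 t * h t) + c ^ 4 * h t ^ 2 * w := by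
      linear_combination (2 * c ^ 2 * h t * g1 t + c ^ 4 * h t ^ 2 * w) * hexp
    have hc2 : 0 ≤ c ^ 2 := by positivity
    have : ((L2 t / 2 - c ^ 2 * (1 + k ^ 2)) * h t ^ 2 + θ t * (2 * h t * (p * g t))) * w
        = (L2 t / 2 - c ^ 2 * (1 + k ^ 2)) * h t ^ 2 * w + 2 * (θ t * h t * g t) := by
      linear_combination (2 * θ t * h t * g t) * hexp
    rw [this]
    rw [r1] at q1
    rw [r2] at q2
    have s1 := mul_nonneg hc2 q1
    have s3 := mul_nonneg hc2 q3
    have s4 := mul_nonneg hc2 q4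
    rw [hθk] at s1 ⊢
    linear_combination s1 + q2 + s3 / 2 + s4 / 4
  have key := intervalIntegral.sub_le_integral_of_hasDeriv_right_of_le hab
    (g := Ψ) (g' := D)
    (φ := fun t => Real.exp (L t) * g1 t ^ 2 - c ^ 2 * (Real.exp (L t) * g t ^ 2))
    (fun t ht => (hΨ' t ht).continuousAt.continuousWithinAt)
    (fun t ht => (hΨ' t (Ioo_subset_Icc_self ht)).hasDerivWithinAt)
    ((by fun_prop : Continuous _).continuousOn.integrableOn_Icc)
    (fun t ht => hle t (Ioo_subset_Icc_self ht))
  have hΨa : Ψ a = 0 := by simp [hΨ, ha]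
  have hΨb : Ψ b = 0 := by simp [hΨ, hb]
  rw [hΨa, hΨb, intervalIntegral.integral_sub ((by fun_prop : Continuous _).intervalIntegrable _ _)
    ((by fun_prop : Continuous _).intervalIntegrable _ _),
    intervalIntegral.integral_const_mul] at key
  linarith

/-! ### Ridge functions on convex sets -/

/-- `weighted_poincare_interval` for functions of arbitrary mean, in homogeneous form. -/
theorem weighted_variance_interval {L L1 L2 g g1 : ℝ → ℝ} {a b c : ℝ} (hab : a < b) (hc : 0 < c)
    (hcπ : c * (b - a) < Real.pi) (hL : ∀ t, HasDerivAt L (L1 t) t)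
    (hL1 : ∀ t, HasDerivAt L1 (L2 t) t) (hL2 : ∀ t, L2 t ≤ 0)
    (hg : ∀ t, HasDerivAt g (g1 t) t) (hg1 : Continuous g1) :
    c ^ 2 * ((∫ t in a..b, Real.exp (L t)) * (∫ t in a..b, Real.exp (L t) * g t ^ 2)
        - (∫ t in a..b, Real.exp (L t) * g t) ^ 2)
      ≤ (∫ t in a..b, Real.exp (L t)) * ∫ t in a..b, Real.exp (L t) * g1 t ^ 2 := by
  have cL : Continuous L := continuous_iff_continuousAt.2 fun t => (hL t).continuousAt
  have cg : Continuous g := continuous_iff_continuousAt.2 fun t => (hg t).continuousAt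
  set I := ∫ t in a..b, Real.exp (L t) with hI
  set I1 := ∫ t in a..b, Real.exp (L t) * g t with hI1
  set I2 := ∫ t in a..b, Real.exp (L t) * g t ^ 2 with hI2
  have hpos : 0 < I := intervalIntegral.intervalIntegral_pos_of_pos
    ((by fun_prop : Continuous _).intervalIntegrable _ _) (fun t => Real.exp_pos _) hab
  set m := I1 / I with hm
  have ii : ∀ {f : ℝ → ℝ}, Continuous f → IntervalIntegrable f volume a b :=
    fun hf => hf.intervalIntegrable _ _
  have e1 : ∫ t in a..b, Real.exp (L t) * (g t - m) = I1 - m * I := by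
    rw [← intervalIntegral.integral_const_mul, ← intervalIntegral.integral_sub
      (ii (by fun_prop)) (ii (by fun_prop))]
    refine intervalIntegral.integral_congr fun t _ => ?_
    ring
  have e2 : ∫ t in a..b, Real.exp (L t) * (g t - m) ^ 2 = I2 - 2 * m * I1 + m ^ 2 * I := by
    rw [← intervalIntegral.integral_const_mul, ← intervalIntegral.integral_const_mul,
      ← intervalIntegral.integral_sub (ii (by fun_prop)) (ii (by fun_prop)),
      ← intervalIntegral.integral_add (ii (by fun_prop)) (ii (by fun_prop))]
    refine intervalIntegral.integral_congr fun t _ => ?_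
    ring
  have hmI : m * I = I1 := by rw [hm]; field_simp
  have key := weighted_poincare_interval hab.le hc hcπ hL hL1 hL2 (g := fun t => g t - m)
    (fun t => (hg t).sub_const m) hg1 (by rw [e1, hmI, sub_self])
  rw [e2] at key
  have := mul_le_mul_of_nonneg_left key hpos.le
  calc c ^ 2 * (I * I2 - I1 ^ 2) = I * (c ^ 2 * (I2 - 2 * m * I1 + m ^ 2 * I)) := by
        linear_combination (c ^ 2 * (I1 - m * I)) * hmI
    _ ≤ _ := this

/-- A twice continuously differentiable midpoint concave function has nonpositive second
derivative. -/
theorem second_deriv_nonpos_of_midpoint_concave {L : ℝ → ℝ} (hL : ContDiff ℝ 2 L)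
    (hmid : ∀ s t, L s + L t ≤ 2 * L ((s + t) / 2)) (t : ℝ) : deriv (deriv L) t ≤ 0 := by
  by_contra! hpos
  have hcont : Continuous (deriv (deriv L)) := by
    have := hL.continuous_iteratedDeriv 2 le_rfl
    simpa [iteratedDeriv_succ, iteratedDeriv_zero] using this
  obtain ⟨ε, hε, hball⟩ := Metric.eventually_nhds_iff.1
    (hcont.continuousAt.eventually (lt_mem_nhds hpos))
  have hsc : StrictConvexOn ℝ (Icc (t - ε / 2) (t + ε / 2)) L := by
    refine strictConvexOn_of_deriv2_pos' (convex_Icc _ _) hL.continuous.continuousOn fun x hx => ?_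
    refine hball ?_
    rw [Real.dist_eq, abs_lt]
    constructor <;> linarith [hx.1, hx.2]
  have hlo : t - ε / 2 ∈ Icc (t - ε / 2) (t + ε / 2) := by constructor <;> linarith
  have hhi : t + ε / 2 ∈ Icc (t - ε / 2) (t + ε / 2) := by constructor <;> linarith
  have h1 := hsc.2 hlo hhi (by linarith) (by norm_num : (0 : ℝ) < 1 / 2)
    (by norm_num : (0 : ℝ) < 1 / 2) (by norm_num)
  have h2 := hmid (t - ε / 2) (t + ε / 2)
  simp only [smul_eq_mul] at h1
  rw [show (t - ε / 2 + (t + ε / 2)) / 2 = t by ring] at h2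
  rw [show 1 / 2 * (t - ε / 2) + 1 / 2 * (t + ε / 2) = t by ring] at h1
  linarith

section ridge

variable {d : ℕ} {C : Set (E d)} {e : E d}

/-- The marginal of a convex set in the direction `e`, smoothed by a Gaussian, is midpoint
log-concave: this is the Prékopa–Leindler inequality. -/
theorem gaussian_marginal_mul_le (hC : Convex ℝ C) (hCm : MeasurableSet C) (hCv : volume C ≠ ⊤)
    (r s t : ℝ) :
    (∫ x in C, Real.exp (-(r * (s - inner ℝ e x)) ^ 2))
      * (∫ x in C, Real.exp (-(r * (t - inner ℝ e x)) ^ 2))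
      ≤ (∫ x in C, Real.exp (-(r * ((s + t) / 2 - inner ℝ e x)) ^ 2)) ^ 2 := by
  set F : ℝ → E d → ℝ≥0∞ := fun t =>
    C.indicator fun x => ENNReal.ofReal (Real.exp (-(r * (t - inner ℝ e x)) ^ 2)) with hF
  have hFm : ∀ t, Measurable (F t) := fun t =>
    Measurable.indicator (by fun_prop) hCm
  have hint : ∀ t, ∫ x in C, Real.exp (-(r * (t - inner ℝ e x)) ^ 2) = (∫⁻ x, F t x).toReal := by
    intro t
    rw [integral_eq_lintegral_of_nonneg_ae (Eventually.of_forall fun x => (Real.exp_pos _).le)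
      (by fun_prop : Continuous _).aestronglyMeasurable, hF, lintegral_indicator hCm]
  have hfin : ∀ t, ∫⁻ x, F t x ≠ ⊤ := by
    intro t
    rw [hF, lintegral_indicator hCm]
    refine ne_top_of_le_ne_top hCv ?_
    calc ∫⁻ x in C, ENNReal.ofReal (Real.exp (-(r * (t - inner ℝ e x)) ^ 2))
        ≤ ∫⁻ x in C, 1 := lintegral_mono fun x => by
          rw [ENNReal.ofReal_le_one, Real.exp_le_one_iff]
          nlinarith [sq_nonneg (r * (t - inner ℝ e x))]
      _ = volume C := by simp
  rw [hint, hint, hint, ← ENNReal.toReal_mul, ← ENNReal.toReal_pow]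
  refine ENNReal.toReal_mono (ENNReal.pow_ne_top (hfin _)) ?_
  refine prekopaLeindler_euclidean d _ _ _ (hFm s) (hFm t) (hFm _) fun x y => ?_
  by_cases hx : x ∈ C
  swap
  · simp [hF, hx]
  by_cases hy : y ∈ C
  swap
  · simp [hF, hy]
  have hxy : (1 / 2 : ℝ) • (x + y) ∈ C := by
    rw [smul_add]
    exact hC hx hy (by norm_num) (by norm_num) (by norm_num)
  simp only [hF, indicator_of_mem hx, indicator_of_mem hy, indicator_of_mem hxy]
  rw [← ENNReal.ofReal_mul (Real.exp_pos _).le, ← ENNReal.ofReal_pow (Real.exp_pos _).le,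
    ← Real.exp_add, ← Real.exp_nat_mul]
  refine ENNReal.ofReal_le_ofReal (Real.exp_le_exp.2 ?_)
  simp only [inner_smul_right, inner_add_right]
  push_cast
  nlinarith [sq_nonneg (r * (s - inner ℝ e x) - r * (t - inner ℝ e y))]

/-- The smoothed marginal is of the form `exp L` with `L` smooth and concave. Smoothness comes from
writing it as a Gaussian times the moment generating function of a finite measure. -/
theorem exists_log_gaussian_marginal (hC : Convex ℝ C) (hCm : MeasurableSet C)
    (hCb : Bornology.IsBounded C) (hC0 : volume C ≠ 0) (r : ℝ) :
    ∃ L L1 L2 : ℝ → ℝ, (∀ t, HasDerivAt L (L1 t) t) ∧ (∀ t, HasDerivAt L1 (L2 t) t) ∧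
      (∀ t, L2 t ≤ 0) ∧
      ∀ t, Real.exp (L t) = ∫ x in C, Real.exp (-(r * (t - inner ℝ e x)) ^ 2) := by
  have hCv : volume C ≠ ⊤ := hCb.measure_lt_top.ne
  have : IsFiniteMeasure (volume.restrict C) := ⟨by simpa using hCv.lt_top⟩
  obtain ⟨N, hN⟩ := hCb.exists_norm_le
  set X : E d → ℝ := fun x => inner ℝ e x with hX
  have hXm : Measurable X := by fun_prop
  have hXN : ∀ x ∈ C, |X x| ≤ ‖e‖ * N := fun x hx =>
    (abs_real_inner_le_norm e x).trans (mul_le_mul_of_nonneg_left (hN x hx) (norm_nonneg _))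
  set μ := (volume.restrict C).withDensity
    (fun x => ENNReal.ofReal (Real.exp (-(r * X x) ^ 2))) with hμ
  have hden : Measurable fun x => ENNReal.ofReal (Real.exp (-(r * X x) ^ 2)) := by fun_prop
  have hac : μ ≪ volume.restrict C := withDensity_absolutelyContinuous _ _
  have hμfin : IsFiniteMeasure μ := isFiniteMeasure_withDensity_ofReal
    (Integrable.of_bound (by fun_prop : Measurable _).aestronglyMeasurable 1
      (Eventually.of_forall fun x => by
        rw [Real.norm_of_nonneg (Real.exp_pos _).le, Real.exp_le_one_iff]
        nlinarith [sq_nonneg (r * X x)])).2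
  have hint : ∀ t, Integrable (fun x => Real.exp (t * X x)) μ := fun t => by
    refine Integrable.of_bound (by fun_prop : Measurable _).aestronglyMeasurable
      (Real.exp (|t| * (‖e‖ * N))) (hac.ae_le ?_)
    filter_upwards [ae_restrict_mem hCm] with x hx
    rw [Real.norm_of_nonneg (Real.exp_pos _).le, Real.exp_le_exp]
    refine (le_abs_self _).trans ?_
    rw [abs_mul]
    exact mul_le_mul_of_nonneg_left (hXN x hx) (abs_nonneg _)
  have hset : ProbabilityTheory.integrableExpSet X μ = univ := eq_univ_of_forall hint
  have hμ0 : NeZero μ := ⟨by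
    intro h0
    have : (volume.restrict C) univ = 0 := by
      refine (withDensity_absolutelyContinuous' hden.aemeasurable ?_ : volume.restrict C ≪ μ) ?_
      · exact Eventually.of_forall fun x => by simp [Real.exp_pos]
      · change μ univ = 0
        rw [h0, Measure.coe_zero, Pi.zero_apply]
    exact hC0 (by simpa using this)⟩
  set L : ℝ → ℝ := fun t => -(r * t) ^ 2 + ProbabilityTheory.cgf X μ (2 * r ^ 2 * t) with hL
  have hexp : ∀ t, Real.exp (L t) = ∫ x in C, Real.exp (-(r * (t - inner ℝ e x)) ^ 2) := by
    intro t
    rw [hL, Real.exp_add, ProbabilityTheory.exp_cgf (hint _), ProbabilityTheory.mgf, hμ,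
      integral_withDensity_eq_integral_toReal_smul hden (by simp), ← integral_const_mul]
    refine integral_congr_ae (Eventually.of_forall fun x => ?_)
    simp only [smul_eq_mul]
    rw [ENNReal.toReal_ofReal (Real.exp_pos _).le, ← Real.exp_add, ← Real.exp_add]
    congr 1
    simp only [hX]; ring
  have hsm : ContDiff ℝ 2 L := by
    have h1 : ContDiff ℝ 2 (ProbabilityTheory.cgf X μ) := contDiff_iff_contDiffAt.2 fun t =>
      (ProbabilityTheory.analyticAt_cgf (by simp [hset])).contDiffAt
    exact (by fun_prop : ContDiff ℝ 2 fun t : ℝ => -(r * t) ^ 2).add (h1.comp (by fun_prop))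
  have hmid : ∀ s t, L s + L t ≤ 2 * L ((s + t) / 2) := fun s t => by
    rw [← Real.exp_le_exp, Real.exp_add, show 2 * L ((s + t) / 2) = (2 : ℕ) * L ((s + t) / 2) by
      norm_num, Real.exp_nat_mul, hexp, hexp, hexp]
    exact gaussian_marginal_mul_le hC hCm hCv r s t
  have hd1 : ContDiff ℝ 1 (deriv L) := (contDiff_succ_iff_deriv.1 hsm).2.2
  exact ⟨L, deriv L, deriv (deriv L),
    fun t => (hsm.differentiable (by norm_num) t).hasDerivAt,
    fun t => (hd1.differentiable (by norm_num) t).hasDerivAt,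
    second_deriv_nonpos_of_midpoint_concave hsm hmid, hexp⟩

/-- As the Gaussian concentrates, the smoothed marginals converge weakly to the marginal. -/
theorem tendsto_gaussian_marginal (hCm : MeasurableSet C) (hCv : volume C ≠ ⊤) {a b : ℝ}
    (hX : ∀ x ∈ C, inner ℝ e x ∈ Ioo a b) {G : ℝ → ℝ} (hG : Continuous G) :
    Tendsto (fun r : ℝ => r / √Real.pi *
        ∫ t in a..b, (∫ x in C, Real.exp (-(r * (t - inner ℝ e x)) ^ 2)) * G t) atTop
      (nhds (∫ x in C, G (inner ℝ e x))) := by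
  have : IsFiniteMeasure (volume.restrict C) := ⟨by simpa using hCv.lt_top⟩
  rcases C.eq_empty_or_nonempty with rfl | ⟨x0, hx0⟩
  · simp
  have hab : a ≤ b := ((hX x0 hx0).1.trans (hX x0 hx0).2).le
  obtain ⟨N, hN⟩ := isCompact_Icc.exists_bound_of_continuousOn (s := Icc a b) hG.continuousOn
  have hN0 : 0 ≤ N := (norm_nonneg _).trans (hN a (left_mem_Icc.2 hab))
  set φ : ℝ → ℝ := fun z => (√Real.pi)⁻¹ * Real.exp (-z ^ 2) with hφ
  have hφ0 : ∀ z, 0 ≤ φ z := fun z => by positivity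
  have hφ1 : ∫ z, φ z = 1 := by
    rw [hφ, integral_const_mul]
    have := integral_gaussian 1
    simp only [neg_mul, one_mul, div_one] at this
    rw [this, inv_mul_cancel₀ (by positivity)]
  have hφi : Integrable φ := integrable_of_integral_eq_one hφ1
  have hφd : Tendsto (fun z : ℝ => ‖z‖ ^ Module.finrank ℝ ℝ * φ z) (Bornology.cobounded ℝ)
      (nhds 0) := by
    have h1 := (tendsto_rpow_abs_mul_exp_neg_mul_sq_cocompact (a := 1) one_pos 1).const_mul
      (√Real.pi)⁻¹
    rw [mul_zero] at h1
    rw [Metric.cobounded_eq_cocompact]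
    refine h1.congr fun z => ?_
    simp [hφ]
    ring
  have swap : ∀ r : ℝ, r / √Real.pi *
      ∫ t in a..b, (∫ x in C, Real.exp (-(r * (t - inner ℝ e x)) ^ 2)) * G t
      = ∫ x in C, ∫ t in Ioc a b, r * φ (r * (inner ℝ e x - t)) * G t := by
    intro r
    rw [intervalIntegral.integral_of_le hab, integral_integral_swap, ← integral_const_mul]
    · refine integral_congr_ae (Eventually.of_forall fun t => ?_)
      simp only
      rw [← integral_mul_const, ← integral_const_mul]
      refine integral_congr_ae (Eventually.of_forall fun x => ?_)
      simp only [hφ]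
      rw [show (r * (inner ℝ e x - t)) ^ 2 = (r * (t - inner ℝ e x)) ^ 2 by ring]
      ring
    · refine Integrable.of_bound (C := |r| * (√Real.pi)⁻¹ * N) ?_ ?_
      · refine Continuous.aestronglyMeasurable ?_
        simp only [Function.uncurry_def, hφ]
        fun_prop
      · rw [Measure.prod_restrict]
        filter_upwards [ae_restrict_mem (hCm.prod measurableSet_Ioc)] with z hz
        simp only [Function.uncurry_def, norm_mul, Real.norm_eq_abs]
        refine mul_le_mul (mul_le_mul_of_nonneg_left ?_ (abs_nonneg _))
          (hN z.2 (Ioc_subset_Icc_self hz.2)) (abs_nonneg _) (by positivity)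
        rw [abs_of_nonneg (hφ0 _)]
        exact mul_le_of_le_one_right (by positivity)
          (Real.exp_le_one_iff.2 (by nlinarith [sq_nonneg (r * (inner ℝ e z.1 - z.2))]))
  simp only [swap]
  have hGi : Integrable ((Ioc a b).indicator G) :=
    (hG.integrableOn_Icc.mono_set Ioc_subset_Icc_self).integrable_indicator measurableSet_Ioc
  have hconv : ∀ r x, ∫ t in Ioc a b, r * φ (r * (inner ℝ e x - t)) * G t
      = ∫ t, (r ^ Module.finrank ℝ ℝ * φ (r • (inner ℝ e x - t))) • (Ioc a b).indicator G t := by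
    intro r x
    rw [← integral_indicator measurableSet_Ioc]
    refine integral_congr_ae (Eventually.of_forall fun t => ?_)
    by_cases ht : t ∈ Ioc a b <;> simp [ht]
  refine tendsto_integral_filter_of_dominated_convergence (fun _ => N) ?_ ?_
    (integrable_const _) ?_
  · filter_upwards with r
    have : StronglyMeasurable fun x : E d =>
        ∫ t in Ioc a b, r * φ (r * (inner ℝ e x - t)) * G t := by
      refine StronglyMeasurable.integral_prod_right' (f := fun z : E d × ℝ =>
        r * φ (r * (inner ℝ e z.1 - z.2)) * G z.2) ?_
      refine Continuous.stronglyMeasurable ?_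
      simp only [hφ]
      fun_prop
    exact this.aestronglyMeasurable
  · filter_upwards [eventually_gt_atTop 0] with r hr
    filter_upwards with x
    have hsub : Integrable fun t => r * φ (r * (inner ℝ e x - t)) :=
      ((hφi.comp_mul_left' hr.ne').comp_sub_left _).const_mul r
    have hone : ∫ t, r * φ (r * (inner ℝ e x - t)) = 1 := by
      rw [integral_const_mul, integral_sub_left_eq_self (fun z => φ (r * z)),
        Measure.integral_comp_mul_left, hφ1, abs_of_pos (inv_pos.2 hr)]
      simp [hr.ne']
    calc ‖∫ t in Ioc a b, r * φ (r * (inner ℝ e x - t)) * G t‖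
        ≤ ∫ t in Ioc a b, r * φ (r * (inner ℝ e x - t)) * N := by
          refine norm_integral_le_of_norm_le (hsub.mul_const N).integrableOn ?_
          filter_upwards [ae_restrict_mem measurableSet_Ioc] with t ht
          rw [norm_mul, Real.norm_of_nonneg (mul_nonneg hr.le (hφ0 _))]
          exact mul_le_mul_of_nonneg_left (hN t (Ioc_subset_Icc_self ht))
            (mul_nonneg hr.le (hφ0 _))
      _ ≤ ∫ t, r * φ (r * (inner ℝ e x - t)) * N :=
          setIntegral_le_integral (hsub.mul_const N) (Eventually.of_forall fun t =>
            mul_nonneg (mul_nonneg hr.le (hφ0 _)) hN0)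
      _ = N := by rw [integral_mul_const, hone, one_mul]
  · filter_upwards [ae_restrict_mem hCm] with x hx
    simp only [hconv]
    have hxI := hX x hx
    have h1 := tendsto_integral_comp_smul_smul_of_integrable' (μ := volume) hφ0 hφ1 hφd hGi
      (x₀ := inner ℝ e x) (hG.continuousAt.congr (by
        filter_upwards [Ioo_mem_nhds hxI.1 hxI.2] with t ht
        rw [indicator_of_mem (Ioo_subset_Ioc_self ht)]))
    rwa [indicator_of_mem (Ioo_subset_Ioc_self hxI)] at h1

/-- The sharp Poincaré inequality on a convex set for ridge functions `x ↦ g (e ⬝ x)`, in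
homogeneous form. -/
theorem ridge_variance_le (hC : Convex ℝ C) (hCm : MeasurableSet C)
    (hCb : Bornology.IsBounded C) {a b c : ℝ} (hX : ∀ x ∈ C, inner ℝ e x ∈ Ioo a b) (hc : 0 < c)
    (hcπ : c * (b - a) < Real.pi) {g g1 : ℝ → ℝ}
    (hg : ∀ t, HasDerivAt g (g1 t) t) (hg1 : Continuous g1) :
    c ^ 2 * (volume.real C * (∫ x in C, g (inner ℝ e x) ^ 2)
        - (∫ x in C, g (inner ℝ e x)) ^ 2)
      ≤ volume.real C * ∫ x in C, g1 (inner ℝ e x) ^ 2 := by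
  have hCv : volume C ≠ ⊤ := hCb.measure_lt_top.ne
  rcases eq_or_ne (volume C) 0 with hC0 | hC0
  · simp [Measure.real, hC0, setIntegral_measure_zero]
  obtain ⟨x0, hx0⟩ : C.Nonempty := nonempty_of_measure_ne_zero hC0
  have hab : a < b := (hX x0 hx0).1.trans (hX x0 hx0).2
  have cg : Continuous g := continuous_iff_continuousAt.2 fun t => (hg t).continuousAt
  have t0 := tendsto_gaussian_marginal hCm hCv hX (G := fun _ => 1) continuous_const
  have t1 := tendsto_gaussian_marginal hCm hCv hX cg
  have t2 := tendsto_gaussian_marginal hCm hCv hX (G := fun t => g t ^ 2) (by fun_prop)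
  have t3 := tendsto_gaussian_marginal hCm hCv hX (G := fun t => g1 t ^ 2) (by fun_prop)
  have hone : ∫ x in C, (1 : ℝ) = volume.real C := by simp
  rw [hone] at t0
  refine le_of_tendsto_of_tendsto' (((t0.mul t2).sub (t1.pow 2)).const_mul (c ^ 2)) (t0.mul t3)
    fun r => ?_
  obtain ⟨L, L1, L2, hL, hL1, hL2, hexp⟩ := exists_log_gaussian_marginal (e := e) hC hCm hCb hC0 r
  have key := weighted_variance_interval hab hc hcπ hL hL1 hL2 hg hg1
  simp only [← hexp, mul_one]
  have := mul_le_mul_of_nonneg_left key (sq_nonneg (r / √Real.pi))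
  linarith

end ridge

/-! ### Localization by bisection -/

section localization

variable {d : ℕ}

theorem volume_hyperplane {n : E d} (hn : n ≠ 0) (q : E d) :
    volume {x : E d | inner ℝ n (x - q) = 0} = 0 := by
  have h1 : {x : E d | inner ℝ n (x - q) = 0}
      = (fun x => x - q) ⁻¹' ((innerSL ℝ n).ker : Set (E d)) := by
    ext x; simp
  rw [h1, show (fun x : E d => x - q) = fun x => x + -q from funext fun x => sub_eq_add_neg x q,
    measure_preimage_add_right]
  refine Measure.addHaar_submodule _ _ fun htop => hn ?_
  have : n ∈ (innerSL ℝ n).ker := htop ▸ Submodule.mem_top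
  simpa using this

/-- Among the hyperplanes through `q` whose normal lies in a given circle there is one that splits
the integral of a function of mean zero evenly: reversing the normal changes the sign of the
integral over the positive side. -/
theorem exists_bisecting_halfspace {C : Set (E d)} {f : E d → ℝ} (hf : IntegrableOn f C)
    (hf0 : ∫ x in C, f x = 0) {v w : E d}
    (hvw : ∀ θ : ℝ, Real.cos θ • v + Real.sin θ • w ≠ 0) (q : E d) :
    ∃ θ : ℝ, ∫ x in C ∩ {x | 0 < inner ℝ (Real.cos θ • v + Real.sin θ • w) (x - q)}, f x = 0 := by
  set n : ℝ → E d := fun θ => Real.cos θ • v + Real.sin θ • w with hn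
  have hnc : Continuous n := by fun_prop
  set H : ℝ → Set (E d) := fun θ => {x | 0 < inner ℝ (n θ) (x - q)} with hH
  have hHm : ∀ θ, MeasurableSet (H θ) := fun θ =>
    (isOpen_lt continuous_const (by fun_prop)).measurableSet
  have hFH : ∀ θ, ∫ x in C ∩ H θ, f x = ∫ x in C, (H θ).indicator f x := fun θ => by
    rw [integral_indicator (hHm θ), Measure.restrict_restrict (hHm θ), inter_comm]
  have hnull : ∀ θ, ∀ᵐ x ∂(volume.restrict C), inner ℝ (n θ) (x - q) ≠ 0 := fun θ =>
    ae_restrict_of_ae (compl_mem_ae_iff.2 (volume_hyperplane (hvw θ) q))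
  set F : ℝ → ℝ := fun θ => ∫ x in C, (H θ).indicator f x with hF
  have hFc : Continuous F := continuous_iff_continuousAt.2 fun θ₀ => by
    refine continuousAt_of_dominated (bound := fun x => ‖f x‖)
      (Eventually.of_forall fun θ => hf.aestronglyMeasurable.indicator (hHm θ))
      (Eventually.of_forall fun θ => Eventually.of_forall fun x => norm_indicator_le_norm_self f x)
      hf.norm ?_
    filter_upwards [hnull θ₀] with x hx
    have hc : Continuous fun θ => inner ℝ (n θ) (x - q) := by fun_prop
    rcases lt_or_gt_of_ne hx with h | h
    · refine (continuousAt_const (y := (0 : ℝ))).congr ?_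
      filter_upwards [hc.continuousAt.eventually (gt_mem_nhds h)] with θ hθ
      exact (indicator_of_notMem (fun h' : x ∈ H θ => lt_asymm hθ h') f).symm
    · refine (continuousAt_const (y := f x)).congr ?_
      filter_upwards [hc.continuousAt.eventually (lt_mem_nhds h)] with θ hθ
      exact (indicator_of_mem (show x ∈ H θ from hθ) f).symm
  have hsum : F 0 + F Real.pi = 0 := by
    refine Eq.trans ?_ hf0
    rw [hF, ← integral_add (hf.indicator (hHm _)) (hf.indicator (hHm _))]
    refine integral_congr_ae ?_
    filter_upwards [hnull 0] with x hx
    have hneg : inner ℝ (n Real.pi) (x - q) = - inner ℝ (n 0) (x - q) := by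
      rw [← inner_neg_left]; simp [hn]
    rcases lt_or_gt_of_ne hx with h | h
    · have h1 : x ∉ H 0 := fun h' => lt_asymm h h'
      have h2 : x ∈ H Real.pi := by simp only [hH, mem_ofPred_eq, hneg]; linarith
      simp [h1, h2]
    · have h1 : x ∈ H 0 := h
      have h2 : x ∉ H Real.pi := by simp only [hH, mem_ofPred_eq, hneg]; linarith
      simp [h1, h2]
  have hmem : (0 : ℝ) ∈ uIcc (F 0) (F Real.pi) := by
    rw [mem_uIcc]
    rcases le_total (F 0) 0 with h | h
    · left; constructor <;> linarith
    · right; constructor <;> linarith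
  obtain ⟨θ, -, hθ⟩ := intermediate_value_uIcc hFc.continuousOn hmem
  exact ⟨θ, by rw [hFH]; exact hθ⟩

/-- An open convex set on which `f` and `G` are integrable, `f` with integral zero and `G` with
positive integral. -/
structure IsLocalizer (f G : E d → ℝ) (C : Set (E d)) : Prop where
  isOpen : IsOpen C
  convex : Convex ℝ C
  integrable_f : IntegrableOn f C
  integrable_G : IntegrableOn G C
  integral_f : ∫ x in C, f x = 0
  integral_G : 0 < ∫ x in C, G x

theorem IsLocalizer.nonempty {f G : E d → ℝ} {C : Set (E d)} (h : IsLocalizer f G C) :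
    C.Nonempty := by
  by_contra! h0
  have := h.integral_G
  simp [h0] at this

/-- One of the two halves cut off by a bisecting hyperplane inherits the properties of a
localizer. -/
theorem IsLocalizer.exists_half {f G : E d → ℝ} {C : Set (E d)} (h : IsLocalizer f G C)
    {v w : E d} (hvw : ∀ θ : ℝ, Real.cos θ • v + Real.sin θ • w ≠ 0) (q : E d) :
    ∃ C' ⊆ C, IsLocalizer f G C' ∧
      ∃ θ : ℝ, ∀ x ∈ C', 0 < inner ℝ (Real.cos θ • v + Real.sin θ • w) (x - q) := by
  obtain ⟨θ, hθ⟩ := exists_bisecting_halfspace h.integrable_f h.integral_f hvw q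
  set n := Real.cos θ • v + Real.sin θ • w with hn
  have ho : ∀ n : E d, IsOpen {x | 0 < inner ℝ n (x - q)} := fun n =>
    isOpen_lt continuous_const (by fun_prop)
  have hconv : ∀ n : E d, Convex ℝ {x | 0 < inner ℝ n (x - q)} := fun n => by
    have : {x | 0 < inner ℝ n (x - q)} = {x | inner ℝ n q < inner ℝ n x} := by
      ext x; simp [inner_sub_right]
    rw [this]
    exact convex_halfSpace_gt (innerSL ℝ n).isLinear _
  have hsplit : ∀ {k : E d → ℝ}, IntegrableOn k C →
      (∫ x in C ∩ {x | 0 < inner ℝ n (x - q)}, k x)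
        + ∫ x in C ∩ {x | 0 < inner ℝ (-n) (x - q)}, k x = ∫ x in C, k x := by
    intro k hk
    rw [← setIntegral_union _ (h.isOpen.inter (ho _)).measurableSet
      (hk.mono_set inter_subset_left) (hk.mono_set inter_subset_left)]
    · refine setIntegral_congr_set ?_
      have hnull : ∀ᵐ x ∂(volume : Measure (E d)), inner ℝ n (x - q) ≠ 0 :=
        compl_mem_ae_iff.2 (volume_hyperplane (hvw θ) q)
      filter_upwards [hnull] with x hx
      refine propext ?_
      change x ∈ (C ∩ {x | 0 < inner ℝ n (x - q)}) ∪ (C ∩ {x | 0 < inner ℝ (-n) (x - q)}) ↔ x ∈ C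
      simp only [mem_union, mem_inter_iff, mem_ofPred_eq, inner_neg_left]
      rcases lt_or_gt_of_ne hx with h1 | h1
      · constructor
        · tauto
        · intro h2; right; exact ⟨h2, by linarith⟩
      · tauto
    · rw [Set.disjoint_left]
      rintro x ⟨-, h1⟩ ⟨-, h2⟩
      simp only [mem_ofPred_eq, inner_neg_left] at h1 h2
      linarith
  have hG := hsplit h.integrable_G
  have hf := hsplit h.integrable_f
  rw [hθ, h.integral_f, zero_add] at hf
  have hpos := h.integral_G
  rcases lt_or_ge 0 (∫ x in C ∩ {x | 0 < inner ℝ n (x - q)}, G x) with h1 | h1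
  · exact ⟨_, inter_subset_left, ⟨h.isOpen.inter (ho _), h.convex.inter (hconv _),
      h.integrable_f.mono_set inter_subset_left, h.integrable_G.mono_set inter_subset_left, hθ, h1⟩,
      θ, fun x hx => hx.2⟩
  · refine ⟨_, inter_subset_left, ⟨h.isOpen.inter (ho (-n)), h.convex.inter (hconv (-n)),
      h.integrable_f.mono_set inter_subset_left, h.integrable_G.mono_set inter_subset_left, hf,
      by linarith⟩, θ + Real.pi, fun x hx => ?_⟩
    have : Real.cos (θ + Real.pi) • v + Real.sin (θ + Real.pi) • w = -n := by
      rw [Real.cos_add_pi, Real.sin_add_pi, hn]; module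
    rw [this]
    exact hx.2

/-- If every point of a dense set lies on the boundary of a halfplane containing the projection of
`S` to the coordinates `i, j`, then that projection is contained in a line. -/
theorem minor_eq_zero_of_halfspaces {S Q : Set (E d)} (hQ : Dense Q) {i j : Fin d}
    (h : ∀ q ∈ Q, ∃ θ : ℝ, ∀ x ∈ S, 0 ≤ Real.cos θ * (x i - q i) + Real.sin θ * (x j - q j))
    {x y z : E d} (hx : x ∈ S) (hy : y ∈ S) (hz : z ∈ S) :
    (y i - x i) * (z j - x j) = (y j - x j) * (z i - x i) := by
  by_contra hne
  set D := (y i - x i) * (z j - x j) - (y j - x j) * (z i - x i) with hD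
  have hD0 : D ≠ 0 := sub_ne_zero.2 hne
  -- barycentric coordinates with respect to the projected triangle, by Cramer's rule
  set s : E d → ℝ := fun q => ((q i - x i) * (z j - x j) - (q j - x j) * (z i - x i)) / D with hs
  set t : E d → ℝ := fun q => ((y i - x i) * (q j - x j) - (y j - x j) * (q i - x i)) / D with ht
  have hci : ∀ k : Fin d, Continuous fun q : E d => q k := fun k => by fun_prop
  have hsc : Continuous s := by fun_prop
  have htc : Continuous t := by fun_prop
  have hU : IsOpen {q | 0 < s q ∧ 0 < t q ∧ s q + t q < 1} :=
    (isOpen_lt continuous_const hsc).inter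
      ((isOpen_lt continuous_const htc).inter (isOpen_lt (hsc.add htc) continuous_const))
  have hUne : {q | 0 < s q ∧ 0 < t q ∧ s q + t q < 1}.Nonempty := by
    refine ⟨(1 / 3 : ℝ) • (x + y + z), ?_⟩
    have e1 : s ((1 / 3 : ℝ) • (x + y + z)) = 1 / 3 := by
      simp only [hs, PiLp.smul_apply, PiLp.add_apply, smul_eq_mul]
      rw [div_eq_iff hD0, hD]; ring
    have e2 : t ((1 / 3 : ℝ) • (x + y + z)) = 1 / 3 := by
      simp only [ht, PiLp.smul_apply, PiLp.add_apply, smul_eq_mul]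
      rw [div_eq_iff hD0, hD]; ring
    simp only [mem_ofPred_eq, e1, e2]
    norm_num
  obtain ⟨q, ⟨hs0, ht0, hst⟩, hqQ⟩ := hQ.inter_open_nonempty _ hU hUne
  obtain ⟨θ, hθ⟩ := h q hqQ
  have hsD : s q * D = (q i - x i) * (z j - x j) - (q j - x j) * (z i - x i) := by
    rw [hs]; field_simp
  have htD : t q * D = (y i - x i) * (q j - x j) - (y j - x j) * (q i - x i) := by
    rw [ht]; field_simp
  have hqi : q i - x i = s q * (y i - x i) + t q * (z i - x i) := by
    refine mul_right_cancel₀ hD0 ?_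
    rw [add_mul, mul_right_comm, hsD, mul_right_comm, htD, hD]; ring
  have hqj : q j - x j = s q * (y j - x j) + t q * (z j - x j) := by
    refine mul_right_cancel₀ hD0 ?_
    rw [add_mul, mul_right_comm, hsD, mul_right_comm, htD, hD]; ring
  set ℓ : E d → ℝ := fun p => Real.cos θ * (p i - q i) + Real.sin θ * (p j - q j) with hℓ
  have hx0 : 0 ≤ ℓ x := hθ x hx
  have hy0 : 0 ≤ ℓ y := hθ y hy
  have hz0 : 0 ≤ ℓ z := hθ z hz
  have hcomb : (1 - s q - t q) * ℓ x + s q * ℓ y + t q * ℓ z = 0 := by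
    simp only [hℓ]
    linear_combination (-Real.cos θ) * hqi - Real.sin θ * hqj
  have h1 : 0 ≤ (1 - s q - t q) * ℓ x := mul_nonneg (by linarith) hx0
  have h2 : 0 ≤ s q * ℓ y := mul_nonneg hs0.le hy0
  have h3 : 0 ≤ t q * ℓ z := mul_nonneg ht0.le hz0
  have ex : ℓ x = 0 := by
    have : (1 - s q - t q) * ℓ x = 0 := by linarith
    exact (mul_eq_zero.1 this).resolve_left (by linarith)
  have ey : ℓ y = 0 := (mul_eq_zero.1 (by linarith : s q * ℓ y = 0)).resolve_left hs0.ne'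
  have ez : ℓ z = 0 := (mul_eq_zero.1 (by linarith : t q * ℓ z = 0)).resolve_left ht0.ne'
  simp only [hℓ] at ex ey ez
  have ky : Real.cos θ * (y i - x i) + Real.sin θ * (y j - x j) = 0 := by linarith
  have kz : Real.cos θ * (z i - x i) + Real.sin θ * (z j - x j) = 0 := by linarith
  have hc : Real.cos θ * D = 0 := by
    rw [hD]; linear_combination (z j - x j) * ky - (y j - x j) * kz
  have hsn : Real.sin θ * D = 0 := by
    rw [hD]; linear_combination (y i - x i) * kz - (z i - x i) * ky
  have hc0 := (mul_eq_zero.1 hc).resolve_right hD0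
  have hs0' := (mul_eq_zero.1 hsn).resolve_right hD0
  have := Real.sin_sq_add_cos_sq θ
  rw [hc0, hs0'] at this
  norm_num at this

/-- A set all of whose coordinate minors vanish lies on a line (or is a point, with `e = 0`). -/
theorem exists_line_of_minors {S : Set (E d)} (hS : S.Nonempty)
    (h : ∀ x ∈ S, ∀ y ∈ S, ∀ z ∈ S, ∀ i j : Fin d, i ≠ j →
      (y i - x i) * (z j - x j) = (y j - x j) * (z i - x i)) :
    ∃ x₀ e : E d, ‖e‖ ≤ 1 ∧ ∀ z ∈ S, z - x₀ = (inner ℝ e (z - x₀) : ℝ) • e := by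
  obtain ⟨x, hx⟩ := hS
  by_cases hsing : ∀ y ∈ S, y = x
  · exact ⟨x, 0, by simp, fun z hz => by simp [hsing z hz]⟩
  push Not at hsing
  obtain ⟨y, hy, hyx⟩ := hsing
  have hne : ‖y - x‖ ≠ 0 := norm_ne_zero_iff.2 (sub_ne_zero.2 hyx)
  refine ⟨x, ‖y - x‖⁻¹ • (y - x), by rw [norm_smul, norm_inv, norm_norm, inv_mul_cancel₀ hne],
    fun z hz => ?_⟩
  rw [inner_smul_left, smul_smul]
  have hm : ∀ i j : Fin d, (y i - x i) * (z j - x j) = (y j - x j) * (z i - x i) := fun i j => by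
    rcases eq_or_ne i j with rfl | hij
    · rfl
    · exact h x hx y hy z hz i j hij
  have key : ‖y - x‖ ^ 2 • (z - x) = (inner ℝ (y - x) (z - x) : ℝ) • (y - x) := by
    ext j
    rw [EuclideanSpace.real_norm_sq_eq]
    simp only [PiLp.smul_apply, PiLp.sub_apply, smul_eq_mul, PiLp.inner_apply, Finset.sum_mul,
      RCLike.inner_apply, conj_trivial]
    refine Finset.sum_congr rfl fun i _ => ?_
    linear_combination (y i - x i) * hm i j
  have : z - x = (‖y - x‖ ^ 2)⁻¹ • ((inner ℝ (y - x) (z - x) : ℝ) • (y - x)) := by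
    rw [← key, smul_smul, inv_mul_cancel₀ (pow_ne_zero 2 hne), one_smul]
  rw [smul_smul] at this
  refine this.trans ?_
  congr 1
  simp only [conj_trivial]
  field_simp

/-- Localization: repeated bisection through a dense set of points, in all pairs of coordinate
directions, produces localizers that are arbitrarily close to a line, since the intersection of
their closures has collinear points. -/
theorem IsLocalizer.exists_thin {f G : E d → ℝ} {C : Set (E d)} (h : IsLocalizer f G C)
    (hb : Bornology.IsBounded C) {r : ℝ} (hr : 0 < r) :
    ∃ C' ⊆ C, IsLocalizer f G C' ∧ ∃ x₀ e : E d, ‖e‖ ≤ 1 ∧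
      ∀ x ∈ C', ‖x - x₀ - (inner ℝ e (x - x₀) : ℝ) • e‖ < r := by
  obtain ⟨cuts, hcuts⟩ := exists_surjective_nat (Option (ℕ × Fin d × Fin d))
  set sgl : Fin d → E d := fun i => EuclideanSpace.single i (1 : ℝ) with hsgl
  have hinner : ∀ (i j : Fin d) (θ : ℝ) (x : E d),
      inner ℝ (Real.cos θ • sgl i + Real.sin θ • sgl j) x
        = Real.cos θ * x i + Real.sin θ * x j := fun i j θ x => by
    simp [hsgl, inner_add_left, inner_smul_left, EuclideanSpace.inner_single_left]
  have hne : ∀ i j : Fin d, i ≠ j → ∀ θ : ℝ, Real.cos θ • sgl i + Real.sin θ • sgl j ≠ 0 := by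
    intro i j hij θ h0
    have h1 := hinner i j θ (sgl i)
    have h2 := hinner i j θ (sgl j)
    rw [h0, inner_zero_left] at h1 h2
    simp [hsgl, hij] at h1
    simp [hsgl, hij.symm] at h2
    have := Real.sin_sq_add_cos_sq θ
    rw [← h1, ← h2] at this
    norm_num at this
  have step : ∀ (o : Option (ℕ × Fin d × Fin d)) (A : {A // IsLocalizer f G A}),
      ∃ A' : {A // IsLocalizer f G A}, A'.1 ⊆ A.1 ∧
        ∀ k i j, o = some (k, i, j) → i ≠ j → ∃ θ : ℝ, ∀ x ∈ A'.1,
          0 < inner ℝ (Real.cos θ • sgl i + Real.sin θ • sgl j)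
            (x - TopologicalSpace.denseSeq (E d) k) := by
    rintro o ⟨A, hA⟩
    by_cases ho : ∃ k i j, o = some (k, i, j) ∧ i ≠ j
    · obtain ⟨k, i, j, rfl, hij⟩ := ho
      obtain ⟨A', hsub, hA', θ, hθ⟩ :=
        hA.exists_half (hne i j hij) (TopologicalSpace.denseSeq (E d) k)
      refine ⟨⟨A', hA'⟩, hsub, ?_⟩
      rintro k' i' j' heq -
      simp only [Option.some.injEq, Prod.mk.injEq] at heq
      obtain ⟨rfl, rfl, rfl⟩ := heq
      exact ⟨θ, hθ⟩
    · exact ⟨⟨A, hA⟩, subset_rfl, fun k i j h1 h2 => absurd ⟨k, i, j, h1, h2⟩ ho⟩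
  choose next hnext_sub hnext using step
  set A : ℕ → {A // IsLocalizer f G A} := fun n =>
    Nat.rec ⟨C, h⟩ (fun k B => next (cuts k) B) n with hA
  have hA_succ : ∀ n, A (n + 1) = next (cuts n) (A n) := fun n => rfl
  have hanti : Antitone fun n => (A n).1 := antitone_nat_of_succ_le fun n => by
    rw [hA_succ]; exact hnext_sub _ _
  have hAC : ∀ n, (A n).1 ⊆ C := fun n => hanti (Nat.zero_le n)
  have hcomp : ∀ n, IsCompact (closure (A n).1) := fun n =>
    Metric.isCompact_of_isClosed_isBounded isClosed_closure (hb.subset (hAC n)).closure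
  have hdir : Directed (· ⊇ ·) fun n => closure (A n).1 :=
    directed_of_isDirected_le fun n m hnm => closure_mono (hanti hnm)
  set S := ⋂ n, closure (A n).1 with hS
  have hSne : S.Nonempty := IsCompact.nonempty_iInter_of_directed_nonempty_isCompact_isClosed _
    hdir (fun n => (A n).2.nonempty.closure) hcomp fun n => isClosed_closure
  obtain ⟨x₀, e, he, hline⟩ := exists_line_of_minors hSne
    (fun x hx y hy z hz i j hij => by
      refine minor_eq_zero_of_halfspaces (TopologicalSpace.denseRange_denseSeq (E d)) ?_ hx hy hz
      rintro _ ⟨k, rfl⟩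
      obtain ⟨n, hn⟩ := hcuts (some (k, i, j))
      obtain ⟨θ, hθ⟩ := hnext (cuts n) (A n) k i j hn hij
      refine ⟨θ, fun p hp => ?_⟩
      have hp' : p ∈ closure (A (n + 1)).1 := mem_iInter.1 hp (n + 1)
      have hsub : closure (A (n + 1)).1 ⊆ {x | 0 ≤ inner ℝ (Real.cos θ • sgl i + Real.sin θ • sgl j)
          (x - TopologicalSpace.denseSeq (E d) k)} :=
        closure_minimal (fun x hx => (hθ x hx).le)
          (isClosed_le continuous_const (by fun_prop))
      have := hsub hp'
      simpa only [mem_ofPred_eq, hinner, PiLp.sub_apply] using this)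
  have hU : IsOpen {x : E d | ‖x - x₀ - (inner ℝ e (x - x₀) : ℝ) • e‖ < r} :=
    isOpen_lt (by fun_prop) continuous_const
  obtain ⟨n, hn⟩ := exists_subset_nhds_of_isCompact hdir hcomp
    (U := {x : E d | ‖x - x₀ - (inner ℝ e (x - x₀) : ℝ) • e‖ < r}) fun z hz => hU.mem_nhds (by
      have := hline z hz
      change ‖z - x₀ - (inner ℝ e (z - x₀) : ℝ) • e‖ < r
      rw [← this, sub_self, norm_zero]
      exact hr)
  exact ⟨(A n).1, hAC n, (A n).2, x₀, e, he, fun x hx => hn (subset_closure hx)⟩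

end localization

/-! ### The Payne–Weinberger inequality for smooth functions -/

section smooth

variable {d : ℕ} {C : Set (E d)} {f : E d → ℝ}

/-- On a set close to a line the function `f` is close to a ridge function, so that it satisfies
the Poincaré inequality up to a small error. -/
theorem poincare_thin (hC : Convex ℝ C) (hCo : IsOpen C) (hCb : Bornology.IsBounded C) {c D : ℝ}
    (hD : ∀ x ∈ C, ∀ y ∈ C, ‖x - y‖ ≤ D) (hc : 0 < c) (hcD : c * D < Real.pi)
    (hf : ContDiff ℝ 1 f) {N ρ r : ℝ} (hN : ∀ x, |f x| ≤ N) (hN' : ∀ x, ‖fderiv ℝ f x‖ ≤ N)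
    (hρ : 0 ≤ ρ) (hfρ : ∀ x y, ‖x - y‖ < r → |f x - f y| ≤ ρ)
    (hf'ρ : ∀ x y, ‖x - y‖ < r → ‖fderiv ℝ f x - fderiv ℝ f y‖ ≤ ρ)
    (hf0 : ∫ x in C, f x = 0) {x₀ e : E d} (he : ‖e‖ ≤ 1)
    (hthin : ∀ x ∈ C, ‖x - x₀ - (inner ℝ e (x - x₀) : ℝ) • e‖ < r) :
    c ^ 2 * ∫ x in C, f x ^ 2 ≤ (∫ x in C, ‖fderiv ℝ f x‖ ^ 2)
      + volume.real C * ((2 * N * ρ + ρ ^ 2) + c ^ 2 * (2 * N * ρ + 2 * ρ ^ 2)) := by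
  have hCv : volume C ≠ ⊤ := hCb.measure_lt_top.ne
  have : IsFiniteMeasure (volume.restrict C) := ⟨by simpa using hCv.lt_top⟩
  have hCm := hCo.measurableSet
  rcases C.eq_empty_or_nonempty with rfl | hCne
  · simp
  have hN0 : 0 ≤ N := (abs_nonneg _).trans (hN 0)
  have hVpos : 0 < volume.real C :=
    ENNReal.toReal_pos (hCo.measure_pos volume hCne).ne' hCv
  set V := volume.real C with hV
  -- the ridge function
  set γ : ℝ → E d := fun t => x₀ + (t - inner ℝ e x₀) • e with hγ
  have hγ' : ∀ t, HasDerivAt γ e t := fun t => by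
    exact ((((hasDerivAt_id t).sub_const (inner ℝ e x₀)).smul_const e).const_add x₀).congr_deriv
      (one_smul ℝ e)
  set g : ℝ → ℝ := fun t => f (γ t) with hg
  set g1 : ℝ → ℝ := fun t => fderiv ℝ f (γ t) e with hg1
  have hgd : ∀ t, HasDerivAt g (g1 t) t := fun t =>
    ((hf.differentiable (by norm_num)) (γ t)).hasFDerivAt.comp_hasDerivAt t (hγ' t)
  have cγ : Continuous γ := continuous_iff_continuousAt.2 fun t => (hγ' t).continuousAt
  have cg : Continuous g := hf.continuous.comp cγ
  have cf' : Continuous (fderiv ℝ f) := hf.continuous_fderiv (by norm_num)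
  have cg1 : Continuous g1 := (cf'.comp cγ).clm_apply continuous_const
  have hclose : ∀ x ∈ C, ‖x - γ (inner ℝ e x)‖ < r := fun x hx => by
    have := hthin x hx
    rwa [inner_sub_right, sub_sub] at this
  -- the projection of `C` to the direction `e` lies in an interval of length `D + 2 κ`
  set X : E d → ℝ := fun x => inner ℝ e x with hXdef
  have hXsub : ∀ x ∈ C, ∀ y ∈ C, X x - X y ≤ D := fun x hx y hy => by
    rw [hXdef, ← inner_sub_right]
    calc inner ℝ e (x - y) ≤ ‖e‖ * ‖x - y‖ := real_inner_le_norm _ _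
      _ ≤ 1 * ‖x - y‖ := mul_le_mul_of_nonneg_right he (norm_nonneg _)
      _ ≤ D := by rw [one_mul]; exact hD x hx y hy
  obtain ⟨x1, hx1⟩ := hCne
  have hbdd : BddBelow (X '' C) := ⟨X x1 - D, by
    rintro _ ⟨y, hy, rfl⟩; linarith [hXsub x1 hx1 y hy]⟩
  set a0 := sInf (X '' C) with ha0
  obtain ⟨κ, hκ, hκπ⟩ : ∃ κ > 0, c * (D + 2 * κ) < Real.pi := by
    refine ⟨(Real.pi - c * D) / (4 * c), div_pos (by linarith) (by positivity), ?_⟩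
    have : c * (D + 2 * ((Real.pi - c * D) / (4 * c))) = (c * D + Real.pi) / 2 := by
      field_simp; ring
    rw [this]; linarith
  have hXI : ∀ x ∈ C, inner ℝ e x ∈ Ioo (a0 - κ) (a0 + D + κ) := fun x hx => by
    have h1 : a0 ≤ X x := csInf_le hbdd (mem_image_of_mem X hx)
    have h2 : X x - D ≤ a0 := le_csInf ⟨_, mem_image_of_mem X hx1⟩ (by
      rintro _ ⟨y, hy, rfl⟩; linarith [hXsub x hx y hy])
    change X x ∈ _
    constructor <;> linarith
  have key := ridge_variance_le hC hCm hCb hXI hc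
    (by rw [show a0 + D + κ - (a0 - κ) = D + 2 * κ by ring]; exact hκπ) hgd cg1
  have hgN : ∀ t, |g t| ≤ N := fun t => hN _
  have ib : ∀ {k : E d → ℝ} (B : ℝ), Continuous k → (∀ x, |k x| ≤ B) →
      Integrable k (volume.restrict C) := fun B hk hB =>
    Integrable.of_bound hk.aestronglyMeasurable B (Eventually.of_forall hB)
  have i_f : Integrable f (volume.restrict C) := ib N hf.continuous hN
  have i_f2 : Integrable (fun x => f x ^ 2) (volume.restrict C) :=
    ib (N ^ 2) (by have := hf.continuous; fun_prop) fun x => by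
      rw [abs_pow]; exact pow_le_pow_left₀ (abs_nonneg _) (hN x) 2
  have i_f' : Integrable (fun x => ‖fderiv ℝ f x‖ ^ 2) (volume.restrict C) :=
    ib (N ^ 2) (by fun_prop) fun x => by
      rw [abs_of_nonneg (by positivity)]; exact pow_le_pow_left₀ (norm_nonneg _) (hN' x) 2
  have i_g : Integrable (fun x => g (X x)) (volume.restrict C) := ib N (by fun_prop) fun x => hgN _
  have i_g2 : Integrable (fun x => g (X x) ^ 2) (volume.restrict C) :=
    ib (N ^ 2) (by fun_prop) fun x => by
      rw [abs_pow]; exact pow_le_pow_left₀ (abs_nonneg _) (hgN _) 2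
  have hg1N : ∀ t, |g1 t| ≤ ‖fderiv ℝ f (γ t)‖ := fun t =>
    ((fderiv ℝ f (γ t)).le_opNorm e).trans (mul_le_of_le_one_right (norm_nonneg _) he)
  have i_g1 : Integrable (fun x => g1 (X x) ^ 2) (volume.restrict C) :=
    ib (N ^ 2) (by fun_prop) fun x => by
      rw [abs_pow]; exact pow_le_pow_left₀ (abs_nonneg _) ((hg1N _).trans (hN' _)) 2
  have hfg : ∀ x ∈ C, |f x - g (X x)| ≤ ρ := fun x hx => hfρ _ _ (hclose x hx)
  -- the mean of the ridge function is small, since `f` has mean zero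
  have hA : |∫ x in C, g (X x)| ≤ ρ * V := by
    have e1 : ∫ x in C, g (X x) = ∫ x in C, (g (X x) - f x) := by
      rw [integral_sub i_g i_f, hf0, sub_zero]
    rw [e1, ← Real.norm_eq_abs]
    refine norm_setIntegral_le_of_norm_le_const hCv.lt_top fun x hx => ?_
    rw [Real.norm_eq_abs, abs_sub_comm]
    exact hfg x hx
  have h1 : ∫ x in C, f x ^ 2 ≤ ∫ x in C, (g (X x) ^ 2 + (2 * N * ρ + ρ ^ 2)) := by
    refine setIntegral_mono_on i_f2 (i_g2.add (integrable_const _)) hCm fun x hx => ?_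
    have b1 := hfg x hx
    have b2 := hgN (X x)
    have e : f x ^ 2 = g (X x) ^ 2 + 2 * (g (X x) * (f x - g (X x))) + (f x - g (X x)) ^ 2 := by
      ring
    have b3 : g (X x) * (f x - g (X x)) ≤ N * ρ :=
      (le_abs_self _).trans (by rw [abs_mul]; exact mul_le_mul b2 b1 (abs_nonneg _) hN0)
    have b4 : (f x - g (X x)) ^ 2 ≤ ρ ^ 2 := sq_le_sq' (by linarith [abs_le.1 b1]) (abs_le.1 b1).2
    linarith
  have h2 : ∫ x in C, g1 (X x) ^ 2 ≤ ∫ x in C, (‖fderiv ℝ f x‖ ^ 2 + (2 * N * ρ + ρ ^ 2)) := by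
    refine setIntegral_mono_on i_g1 (i_f'.add (integrable_const _)) hCm fun x hx => ?_
    have b1 : ‖fderiv ℝ f (γ (X x))‖ ≤ ‖fderiv ℝ f x‖ + ρ := by
      have := hf'ρ _ _ (hclose x hx)
      have := norm_sub_norm_le (fderiv ℝ f (γ (X x))) (fderiv ℝ f x)
      rw [norm_sub_rev] at this
      linarith
    have b2 : g1 (X x) ^ 2 ≤ (‖fderiv ℝ f x‖ + ρ) ^ 2 := by
      rw [← sq_abs]
      exact pow_le_pow_left₀ (abs_nonneg _) ((hg1N _).trans b1) 2
    have b3 : ‖fderiv ℝ f x‖ * ρ ≤ N * ρ := mul_le_mul_of_nonneg_right (hN' x) hρ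
    calc g1 (X x) ^ 2 ≤ (‖fderiv ℝ f x‖ + ρ) ^ 2 := b2
      _ = ‖fderiv ℝ f x‖ ^ 2 + 2 * (‖fderiv ℝ f x‖ * ρ) + ρ ^ 2 := by ring
      _ ≤ _ := by linarith
  have hconst : ∀ z : ℝ, ∫ _ in C, z = V * z := fun z => by simp [hV]
  rw [integral_add i_g2 (integrable_const _), hconst] at h1
  rw [integral_add i_f' (integrable_const _), hconst] at h2
  have hA2 : (∫ x in C, g (X x)) ^ 2 ≤ ρ ^ 2 * V ^ 2 := by
    rw [← mul_pow, ← sq_abs]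
    exact pow_le_pow_left₀ (abs_nonneg _) hA 2
  have h3 : c ^ 2 * ∫ x in C, g (X x) ^ 2 ≤ (∫ x in C, g1 (X x) ^ 2) + c ^ 2 * ρ ^ 2 * V := by
    refine le_of_mul_le_mul_left ?_ hVpos
    have := mul_le_mul_of_nonneg_left hA2 (sq_nonneg c)
    linarith
  have h4 := mul_le_mul_of_nonneg_left h1 (sq_nonneg c)
  linarith

/-- The Payne–Weinberger inequality for functions with bounded and uniformly continuous
derivative. -/
theorem poincare_of_contDiff (hC : Convex ℝ C) (hCo : IsOpen C) (hCb : Bornology.IsBounded C)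
    (hf : ContDiff ℝ 1 f) {N : ℝ} (hN : ∀ x, |f x| ≤ N) (hN' : ∀ x, ‖fderiv ℝ f x‖ ≤ N)
    (hfu : UniformContinuous f) (hf'u : UniformContinuous (fderiv ℝ f))
    (hf0 : ∫ x in C, f x = 0) :
    Real.pi ^ 2 * ∫ x in C, f x ^ 2 ≤ Metric.diam C ^ 2 * ∫ x in C, ‖fderiv ℝ f x‖ ^ 2 := by
  have hCv : volume C ≠ ⊤ := hCb.measure_lt_top.ne
  have : IsFiniteMeasure (volume.restrict C) := ⟨by simpa using hCv.lt_top⟩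
  have hN0 : 0 ≤ N := (abs_nonneg _).trans (hN 0)
  have cf' : Continuous (fderiv ℝ f) := hf.continuous_fderiv (by norm_num)
  have ib : ∀ {k : E d → ℝ} (B : ℝ), Continuous k → (∀ x, |k x| ≤ B) →
      Integrable k (volume.restrict C) := fun B hk hB =>
    Integrable.of_bound hk.aestronglyMeasurable B (Eventually.of_forall hB)
  have i_f : Integrable f (volume.restrict C) := ib N hf.continuous hN
  have i_f2 : Integrable (fun x => f x ^ 2) (volume.restrict C) :=
    ib (N ^ 2) (by have := hf.continuous; fun_prop) fun x => by
      rw [abs_pow]; exact pow_le_pow_left₀ (abs_nonneg _) (hN x) 2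
  have i_f' : Integrable (fun x => ‖fderiv ℝ f x‖ ^ 2) (volume.restrict C) :=
    ib (N ^ 2) (by fun_prop) fun x => by
      rw [abs_of_nonneg (by positivity)]; exact pow_le_pow_left₀ (norm_nonneg _) (hN' x) 2
  have step : ∀ c > 0, c * Metric.diam C < Real.pi →
      c ^ 2 * ∫ x in C, f x ^ 2 ≤ ∫ x in C, ‖fderiv ℝ f x‖ ^ 2 := by
    intro c hc hcD
    have hstep : ∀ ε > 0, c ^ 2 * ∫ x in C, f x ^ 2
        ≤ (∫ x in C, ‖fderiv ℝ f x‖ ^ 2) + ε * volume.real C := by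
      intro ε hε
      by_contra! hcon
      -- a violation of the inequality would be inherited by an arbitrarily thin convex set
      set G : E d → ℝ := fun x => c ^ 2 * f x ^ 2 - ‖fderiv ℝ f x‖ ^ 2 - ε with hG
      have iG : Integrable G (volume.restrict C) :=
        ((i_f2.const_mul _).sub i_f').sub (integrable_const _)
      have intG : ∀ A ⊆ C, ∫ x in A, G x = c ^ 2 * (∫ x in A, f x ^ 2)
          - (∫ x in A, ‖fderiv ℝ f x‖ ^ 2) - ε * volume.real A := by
        intro A hA
        have hr : ∀ {k : E d → ℝ}, Integrable k (volume.restrict C) →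
            Integrable k (volume.restrict A) := fun hk => hk.mono_measure
          (Measure.restrict_mono_set volume hA)
        have hi : Integrable (fun x => c ^ 2 * f x ^ 2 - ‖fderiv ℝ f x‖ ^ 2) (volume.restrict A) :=
          (hr (i_f2.const_mul _)).sub (hr i_f')
        rw [hG, integral_sub hi (hr (integrable_const _)), integral_sub (hr (i_f2.const_mul _)) (hr i_f'), integral_const_mul]
        simp [mul_comm]
      have hloc : IsLocalizer f G C :=
        ⟨hCo, hC, i_f, iG, hf0, by rw [intG C subset_rfl]; linarith⟩
      -- `ρ` is so small that the error term of `poincare_thin` is at most `ε` per unit volume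
      set Z := (2 * N + 1) + c ^ 2 * (2 * N + 2) with hZ
      have hZ0 : 0 < Z := by positivity
      set ρ := min 1 (ε / Z) with hρ
      have hρ0 : 0 < ρ := lt_min one_pos (by positivity)
      have hρ1 : ρ ≤ 1 := min_le_left _ _
      have hρZ : Z * ρ ≤ ε := by
        have := mul_le_mul_of_nonneg_left (min_le_right 1 (ε / Z)) hZ0.le
        rwa [mul_div_cancel₀ _ hZ0.ne'] at this
      obtain ⟨r1, hr1, hfr⟩ := Metric.uniformContinuous_iff.1 hfu ρ hρ0
      obtain ⟨r2, hr2, hfr'⟩ := Metric.uniformContinuous_iff.1 hf'u ρ hρ0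
      obtain ⟨A, hAC, hA, x₀, e, he, hthin⟩ := hloc.exists_thin hCb (lt_min hr1 hr2)
      have hAb := hCb.subset hAC
      have h1 := poincare_thin hA.convex hA.isOpen hAb (D := Metric.diam C)
        (fun x hx y hy => by
          rw [← dist_eq_norm]; exact Metric.dist_le_diam_of_mem hCb (hAC hx) (hAC hy))
        hc hcD hf hN hN' hρ0.le (r := min r1 r2)
        (fun x y hxy => by
          have := hfr (a := x) (b := y) (by
            rw [dist_eq_norm]; exact hxy.trans_le (min_le_left _ _))
          rw [Real.dist_eq] at this; exact this.le)
        (fun x y hxy => by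
          have := hfr' (a := x) (b := y) (by
            rw [dist_eq_norm]; exact hxy.trans_le (min_le_right _ _))
          rw [dist_eq_norm] at this; exact this.le)
        hA.integral_f he hthin
      have h2 := hA.integral_G
      rw [intG A hAC] at h2
      have h3 : (2 * N * ρ + ρ ^ 2) + c ^ 2 * (2 * N * ρ + 2 * ρ ^ 2) ≤ ε := by
        have q : ρ ^ 2 ≤ ρ := by nlinarith
        have q' := mul_le_mul_of_nonneg_left q (sq_nonneg c)
        calc _ ≤ (2 * N * ρ + ρ) + c ^ 2 * (2 * N * ρ + 2 * ρ) := by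
              nlinarith
          _ = Z * ρ := by rw [hZ]; ring
          _ ≤ ε := hρZ
      have h4 := mul_le_mul_of_nonneg_left h3 (measureReal_nonneg (μ := volume) (s := A))
      linarith
    have hlim : Tendsto (fun ε : ℝ => (∫ x in C, ‖fderiv ℝ f x‖ ^ 2) + ε * volume.real C)
        (nhdsWithin 0 (Ioi 0)) (nhds ((∫ x in C, ‖fderiv ℝ f x‖ ^ 2) + 0 * volume.real C)) :=
      ((by fun_prop : Continuous fun ε : ℝ =>
        (∫ x in C, ‖fderiv ℝ f x‖ ^ 2) + ε * volume.real C).tendsto 0).mono_left nhdsWithin_le_nhds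
    rw [zero_mul, add_zero] at hlim
    exact ge_of_tendsto hlim (by filter_upwards [self_mem_nhdsWithin] with ε hε using hstep ε hε)
  set D := Metric.diam C with hD
  have hD0 : 0 ≤ D := Metric.diam_nonneg
  have hlim : Tendsto (fun D' : ℝ => D' ^ 2 * ∫ x in C, ‖fderiv ℝ f x‖ ^ 2)
      (nhdsWithin D (Ioi D)) (nhds (D ^ 2 * ∫ x in C, ‖fderiv ℝ f x‖ ^ 2)) :=
    ((by fun_prop : Continuous fun D' : ℝ =>
      D' ^ 2 * ∫ x in C, ‖fderiv ℝ f x‖ ^ 2).tendsto D).mono_left nhdsWithin_le_nhds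
  refine ge_of_tendsto hlim ?_
  filter_upwards [self_mem_nhdsWithin] with D' hD'
  have hD'0 : 0 < D' := hD0.trans_lt hD'
  have h1 := step (Real.pi / D') (by positivity) (by
    rw [div_mul_eq_mul_div, div_lt_iff₀ hD'0]
    exact mul_lt_mul_of_pos_left hD' Real.pi_pos)
  rw [div_pow, div_mul_eq_mul_div, div_le_iff₀ (by positivity)] at h1
  linarith

/-- `poincare_of_contDiff` for functions of arbitrary mean, in homogeneous form. -/
theorem variance_le_of_contDiff (hC : Convex ℝ C) (hCo : IsOpen C) (hCb : Bornology.IsBounded C)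
    (hf : ContDiff ℝ 1 f) (hfs : HasCompactSupport f) :
    Real.pi ^ 2 * (volume.real C * (∫ x in C, f x ^ 2) - (∫ x in C, f x) ^ 2)
      ≤ Metric.diam C ^ 2 * (volume.real C * ∫ x in C, ‖fderiv ℝ f x‖ ^ 2) := by
  have hCv : volume C ≠ ⊤ := hCb.measure_lt_top.ne
  have : IsFiniteMeasure (volume.restrict C) := ⟨by simpa using hCv.lt_top⟩
  rcases C.eq_empty_or_nonempty with rfl | hCne
  · simp
  have hVpos : 0 < volume.real C :=
    ENNReal.toReal_pos (hCo.measure_pos volume hCne).ne' hCv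
  set V := volume.real C with hV
  have cf : Continuous f := hf.continuous
  have cf' : Continuous (fderiv ℝ f) := hf.continuous_fderiv (by norm_num)
  obtain ⟨N1, hN1⟩ := hfs.exists_bound_of_continuous cf
  obtain ⟨N2, hN2⟩ := (hfs.fderiv ℝ).exists_bound_of_continuous cf'
  set m := (∫ x in C, f x) / V with hm
  have i_f : Integrable f (volume.restrict C) := (cf.integrable_of_hasCompactSupport hfs).restrict
  have i_f2 : Integrable (fun x => f x ^ 2) (volume.restrict C) :=
    Integrable.of_bound (by fun_prop : Continuous _).aestronglyMeasurable (N1 ^ 2)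
      (Eventually.of_forall fun x => by
        rw [norm_pow]; exact pow_le_pow_left₀ (norm_nonneg _) (hN1 x) 2)
  have hfd : fderiv ℝ (fun x => f x - m) = fderiv ℝ f := by
    ext1 x; rw [fderiv_sub_const]
  have hconst : ∀ z : ℝ, ∫ _ in C, z = V * z := fun z => by simp [hV]
  have hmV : V * m = ∫ x in C, f x := by rw [hm]; field_simp
  have key := poincare_of_contDiff hC hCo hCb (f := fun x => f x - m) (hf.sub contDiff_const)
    (N := max (N1 + |m|) N2)
    (fun x => le_max_of_le_left ((abs_sub _ _).trans (by have := hN1 x; gcongr; exact this)))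
    (fun x => le_max_of_le_right (by rw [hfd]; exact hN2 x))
    ((hfs.uniformContinuous_of_continuous cf).sub uniformContinuous_const)
    (by rw [hfd]; exact (hfs.fderiv ℝ).uniformContinuous_of_continuous cf')
    (by rw [integral_sub i_f (integrable_const _), hconst, hmV, sub_self])
  have e2 : ∫ x in C, (f x - m) ^ 2 = (∫ x in C, f x ^ 2) - 2 * m * (∫ x in C, f x) + V * m ^ 2 := by
    have hi : Integrable (fun x => f x ^ 2 - 2 * m * f x) (volume.restrict C) :=
      i_f2.sub (i_f.const_mul _)
    rw [← hconst, ← integral_const_mul, ← integral_sub i_f2 (i_f.const_mul _),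
      ← integral_add hi (integrable_const _)]
    refine integral_congr_ae (Eventually.of_forall fun x => ?_)
    simp only; ring
  rw [hfd, e2] at key
  have := mul_le_mul_of_nonneg_left key hVpos.le
  calc _ = V * (Real.pi ^ 2 * ((∫ x in C, f x ^ 2) - 2 * m * (∫ x in C, f x) + V * m ^ 2)) := by
        rw [← hmV]; ring
    _ ≤ _ := this
    _ = _ := by ring

end smooth

/-! ### Mollification and the Payne–Weinberger inequality in H¹ -/

/-- The double integral of `(u(x) - u(y))²` expresses the variance without reference to the mean,
which makes it accessible to Fatou's lemma. -/
theorem lintegral_lintegral_sub_sq {X : Type*} [MeasurableSpace X] {μ : Measure X}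
    [IsFiniteMeasure μ] {u : X → ℝ} (hu : MemLp u 2 μ) :
    ∫⁻ x, ∫⁻ y, ENNReal.ofReal ((u x - u y) ^ 2) ∂μ ∂μ
      = ENNReal.ofReal (2 * (μ.real univ * (∫ x, u x ^ 2 ∂μ) - (∫ x, u x ∂μ) ^ 2)) := by
  have i1 : Integrable u μ := hu.integrable (by norm_num)
  have i2 : Integrable (fun x => u x ^ 2) μ := hu.integrable_sq
  have hi : ∀ x, Integrable (fun y => (u x - u y) ^ 2) μ := fun x => by
    have : (fun y => (u x - u y) ^ 2) = fun y => u x ^ 2 - 2 * u x * u y + u y ^ 2 := by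
      ext y; ring
    rw [this]
    exact ((integrable_const _).sub (i1.const_mul _)).add i2
  have inner : ∀ x, ∫ y, (u x - u y) ^ 2 ∂μ
      = μ.real univ * u x ^ 2 - 2 * (∫ y, u y ∂μ) * u x + ∫ y, u y ^ 2 ∂μ := fun x => by
    have e : (fun y => (u x - u y) ^ 2) = fun y => (u x ^ 2 - 2 * u x * u y) + u y ^ 2 := by
      ext y; ring
    have h1 : Integrable (fun y => u x ^ 2 - 2 * u x * u y) μ :=
      (integrable_const _).sub (i1.const_mul _)
    rw [e, integral_add h1 i2, integral_sub (integrable_const _) (i1.const_mul _),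
      integral_const_mul]
    simp only [integral_const, smul_eq_mul]
    ring
  have h2 : Integrable (fun x => μ.real univ * u x ^ 2 - 2 * (∫ y, u y ∂μ) * u x) μ :=
    (i2.const_mul _).sub (i1.const_mul _)
  have outer : ∫ x, (∫ y, (u x - u y) ^ 2 ∂μ) ∂μ
      = 2 * (μ.real univ * (∫ x, u x ^ 2 ∂μ) - (∫ x, u x ∂μ) ^ 2) := by
    simp only [inner]
    rw [integral_add h2 (integrable_const _), integral_sub (i2.const_mul _) (i1.const_mul _),
      integral_const_mul, integral_const_mul]
    simp only [integral_const, smul_eq_mul]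
    ring
  have ho : Integrable (fun x => ∫ y, (u x - u y) ^ 2 ∂μ) μ := by
    simp only [inner]; exact h2.add (integrable_const _)
  rw [← outer, ofReal_integral_eq_lintegral_ofReal ho
    (Eventually.of_forall fun x => integral_nonneg fun y => sq_nonneg _)]
  refine lintegral_congr fun x => ?_
  rw [ofReal_integral_eq_lintegral_ofReal (hi x) (Eventually.of_forall fun y => sq_nonneg _)]

/-- Fatou's lemma for iterated integrals. -/
theorem lintegral_lintegral_le_of_tendsto {X : Type*} [MeasurableSpace X] {μ : Measure X}
    [SFinite μ] {F : ℕ → X → X → ℝ≥0∞} (hF : ∀ n, Measurable (Function.uncurry (F n)))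
    {G : X → X → ℝ≥0∞} (hG : ∀ᵐ x ∂μ, ∀ᵐ y ∂μ, Tendsto (fun n => F n x y) atTop (nhds (G x y)))
    {Z : ℝ≥0∞} (hZ : ∀ n, ∫⁻ x, ∫⁻ y, F n x y ∂μ ∂μ ≤ Z) :
    ∫⁻ x, ∫⁻ y, G x y ∂μ ∂μ ≤ Z := by
  calc ∫⁻ x, ∫⁻ y, G x y ∂μ ∂μ
      ≤ ∫⁻ x, liminf (fun n => ∫⁻ y, F n x y ∂μ) atTop ∂μ := by
        refine lintegral_mono_ae ?_
        filter_upwards [hG] with x hx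
        calc ∫⁻ y, G x y ∂μ = ∫⁻ y, liminf (fun n => F n x y) atTop ∂μ := by
              refine lintegral_congr_ae ?_
              filter_upwards [hx] with y hy
              exact hy.liminf_eq.symm
          _ ≤ _ := lintegral_liminf_le fun n => (hF n).comp measurable_prodMk_left
    _ ≤ liminf (fun n => ∫⁻ x, ∫⁻ y, F n x y ∂μ ∂μ) atTop :=
        lintegral_liminf_le fun n => (hF n).lintegral_prod_right'
    _ ≤ Z := liminf_le_of_le (by isBoundedDefault) fun b hb =>
        hb.exists.elim fun n hn => hn.trans (hZ n)

section mollify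

open scoped Convolution

variable {d : ℕ} {Ω : Set (E d)} {φ : ContDiffBump (0 : E d)}

/-- The mollification of the extension by zero of `v`. -/
noncomputable def mollify (φ : ContDiffBump (0 : E d)) (v : L2 Ω) : E d → ℝ :=
  φ.normed volume ⋆[ContinuousLinearMap.lsmul ℝ ℝ, volume] Ω.indicator v

theorem integrable_indicator_L2 (hΩo : IsOpen Ω) (hΩb : Bornology.IsBounded Ω) (v : L2 Ω) :
    Integrable (Ω.indicator v) := by
  have : IsFiniteMeasure (volume.restrict Ω) := ⟨by simpa using hΩb.measure_lt_top⟩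
  exact (integrable_indicator_iff hΩo.measurableSet).2 ((Lp.memLp v).integrable (by norm_num))

theorem contDiff_mollify (hΩo : IsOpen Ω) (hΩb : Bornology.IsBounded Ω) (v : L2 Ω) :
    ContDiff ℝ 1 (mollify φ v) :=
  φ.hasCompactSupport_normed.contDiff_convolution_left _ φ.contDiff_normed
    (integrable_indicator_L2 hΩo hΩb v).locallyIntegrable

theorem hasCompactSupport_mollify (hΩb : Bornology.IsBounded Ω) (v : L2 Ω) :
    HasCompactSupport (mollify φ v) :=
  φ.hasCompactSupport_normed.convolution _
    (HasCompactSupport.of_support_subset_isCompact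
      (Metric.isCompact_of_isClosed_isBounded isClosed_closure hΩb.closure)
      (support_indicator_subset.trans subset_closure))

theorem support_normed_sub (x : E d) :
    Function.support (fun y => φ.normed volume (x - y)) ⊆ Metric.closedBall x φ.rOut := by
  intro y hy
  have h1 : x - y ∈ Function.support (φ.normed volume) := hy
  rw [φ.support_normed_eq, mem_ball_zero_iff] at h1
  rw [Metric.mem_closedBall, dist_comm, dist_eq_norm]
  exact h1.le

theorem isTestFunction_normed_sub {x : E d} (hx : Metric.closedBall x φ.rOut ⊆ Ω) :
    IsTestFunction Ω (fun y => φ.normed volume (x - y)) where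
  contDiff := φ.contDiff_normed.comp (contDiff_const.sub contDiff_id)
  hasCompactSupport := HasCompactSupport.of_support_subset_isCompact
    (isCompact_closedBall x φ.rOut) (support_normed_sub x)
  tsupport_subset := (closure_minimal (support_normed_sub x) Metric.isClosed_closedBall).trans hx

/-- Differentiation commutes with mollification, away from the boundary. -/
theorem fderiv_mollify_single (hΩo : IsOpen Ω) (hΩb : Bornology.IsBounded Ω) {v : L2 Ω}
    {g : L2Vec Ω} (hw : IsWeakGradient Ω v g) {x : E d} (hx : Metric.closedBall x φ.rOut ⊆ Ω)
    (j : Fin d) :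
    fderiv ℝ (mollify φ v) x (EuclideanSpace.single j 1)
      = ∫ y in Ω, g y j * φ.normed volume (x - y) := by
  have hloc := (integrable_indicator_L2 hΩo hΩb v).locallyIntegrable
  have hρ : ContDiff ℝ 1 (φ.normed (volume : Measure (E d))) := φ.contDiff_normed
  have hd := φ.hasCompactSupport_normed.hasFDerivAt_convolution_left (μ := volume)
    (ContinuousLinearMap.lsmul ℝ ℝ) hρ hloc x
  have hex := (φ.hasCompactSupport_normed (μ := volume).fderiv ℝ).convolutionExists_left
    ((ContinuousLinearMap.lsmul ℝ ℝ).precompL (E d)) (hρ.continuous_fderiv one_ne_zero) hloc x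
  rw [mollify, hd.fderiv, convolution_def, ContinuousLinearMap.integral_apply hex]
  rw [← integral_sub_left_eq_self _ volume x]
  have htest := isTestFunction_normed_sub hx
  have hpd : ∀ y, partialDeriv j (fun y => φ.normed volume (x - y)) y
      = - fderiv ℝ (φ.normed volume) (x - y) (EuclideanSpace.single j 1) := fun y => by
    have h1 := ((hρ.differentiable one_ne_zero) (x - y)).hasFDerivAt.comp y
      ((hasFDerivAt_id y).const_sub x)
    have h2 : HasFDerivAt (fun y => φ.normed volume (x - y)) _ y := h1
    rw [partialDeriv, h2.fderiv]
    simp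
  have := hw _ htest j
  rw [eq_neg_iff_add_eq_zero, add_comm, ← eq_neg_iff_add_eq_zero] at this
  rw [this, ← integral_neg, ← integral_indicator hΩo.measurableSet]
  refine integral_congr_ae (Eventually.of_forall fun y => ?_)
  by_cases hy : y ∈ Ω
  · simp [hy, hpd, mul_comm]
  · simp [hy]

theorem integrable_norm_sq_grad (g : L2Vec Ω) :
    Integrable (fun y => ‖g y‖ ^ 2) (volume.restrict Ω) :=
  (Lp.memLp g).integrable_norm_pow (by norm_num)

/-- The gradient of the mollification is the mollification of the gradient, whence Jensen's
inequality bounds its square. -/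
theorem norm_fderiv_mollify_sq_le (hΩo : IsOpen Ω) (hΩb : Bornology.IsBounded Ω) {v : L2 Ω}
    {g : L2Vec Ω} (hw : IsWeakGradient Ω v g) {x : E d} (hx : Metric.closedBall x φ.rOut ⊆ Ω) :
    ‖fderiv ℝ (mollify φ v) x‖ ^ 2 ≤ ∫ y in Ω, ‖g y‖ ^ 2 * φ.normed volume (x - y) := by
  have : IsFiniteMeasure (volume.restrict Ω) := ⟨by simpa using hΩb.measure_lt_top⟩
  set ψ : E d → ℝ := fun y => φ.normed volume (x - y) with hψ
  have htest : IsTestFunction Ω ψ := isTestFunction_normed_sub hx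
  have hψ0 : ∀ y, 0 ≤ ψ y := fun y => φ.nonneg_normed _
  obtain ⟨N, hN⟩ := htest.hasCompactSupport.exists_bound_of_continuous htest.contDiff.continuous
  have hψm : AEStronglyMeasurable ψ (volume.restrict Ω) :=
    htest.contDiff.continuous.aestronglyMeasurable
  have i0 : Integrable ψ (volume.restrict Ω) :=
    Integrable.of_bound hψm N (Eventually.of_forall hN)
  have i1 : Integrable (fun y => ‖g y‖ * ψ y) (volume.restrict Ω) :=
    ((Lp.memLp g).integrable (by norm_num)).norm.mul_bdd hψm (Eventually.of_forall hN)
  have i2 : Integrable (fun y => ‖g y‖ ^ 2 * ψ y) (volume.restrict Ω) :=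
    (integrable_norm_sq_grad g).mul_bdd hψm (Eventually.of_forall hN)
  have hone : ∫ y in Ω, ψ y = 1 := by
    rw [setIntegral_eq_integral_of_forall_compl_eq_zero, hψ,
      integral_sub_left_eq_self (φ.normed volume) volume x, φ.integral_normed]
    intro y hy
    by_contra h0
    exact hy (hx (support_normed_sub x h0))
  set A := ∫ y in Ω, ‖g y‖ * ψ y with hA
  have hA0 : 0 ≤ A := integral_nonneg fun y => mul_nonneg (norm_nonneg _) (hψ0 y)
  have hle : ‖fderiv ℝ (mollify φ v) x‖ ≤ A := by
    refine ContinuousLinearMap.opNorm_le_bound _ hA0 fun ξ => ?_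
    have hξ : ξ = ∑ j, ξ j • EuclideanSpace.single j (1 : ℝ) := by
      ext k; simp [Finset.sum_apply, Pi.single_apply]
    have e1 : fderiv ℝ (mollify φ v) x ξ = ∫ y in Ω, ∑ j, ξ j * (g y j * ψ y) := by
      rw [integral_finsetSum _ fun j _ => (integrable_coord_mul g htest j).const_mul _]
      conv_lhs => rw [hξ, map_sum]
      refine Finset.sum_congr rfl fun j _ => ?_
      rw [map_smul, fderiv_mollify_single hΩo hΩb hw hx j, integral_const_mul, smul_eq_mul]
    rw [e1, mul_comm A, hA, ← integral_const_mul]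
    refine norm_integral_le_of_norm_le (i1.const_mul _) (Eventually.of_forall fun y => ?_)
    have e2 : ∑ j, ξ j * (g y j * ψ y) = inner ℝ ξ (g y) * ψ y := by
      rw [PiLp.inner_apply, Finset.sum_mul]
      refine Finset.sum_congr rfl fun j _ => ?_
      simp only [RCLike.inner_apply, conj_trivial]
      ring
    rw [e2, norm_mul, Real.norm_of_nonneg (hψ0 y), ← mul_assoc]
    exact mul_le_mul_of_nonneg_right (norm_inner_le_norm ξ (g y)) (hψ0 y)
  refine (pow_le_pow_left₀ (norm_nonneg _) hle 2).trans ?_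
  -- Jensen's inequality: the variance of `‖g‖` with respect to `ψ` is nonnegative
  have hpos : 0 ≤ ∫ y in Ω, (‖g y‖ - A) ^ 2 * ψ y :=
    integral_nonneg fun y => mul_nonneg (sq_nonneg _) (hψ0 y)
  have e3 : ∫ y in Ω, (‖g y‖ - A) ^ 2 * ψ y
      = (∫ y in Ω, ‖g y‖ ^ 2 * ψ y) - 2 * A * A + A ^ 2 * 1 := by
    have h1 : Integrable (fun y => ‖g y‖ ^ 2 * ψ y - 2 * A * (‖g y‖ * ψ y)) (volume.restrict Ω) :=
      i2.sub (i1.const_mul _)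
    have e : (fun y => (‖g y‖ - A) ^ 2 * ψ y)
        = fun y => (‖g y‖ ^ 2 * ψ y - 2 * A * (‖g y‖ * ψ y)) + A ^ 2 * ψ y := by
      ext y; ring
    rw [e, integral_add h1 (i0.const_mul _), integral_sub i2 (i1.const_mul _),
      integral_const_mul, integral_const_mul, hone]
  rw [e3] at hpos
  linarith

/-- Mollification does not increase the Dirichlet energy, if the latter is measured on a slightly
larger set. -/
theorem setIntegral_norm_fderiv_mollify_le (hΩo : IsOpen Ω) (hΩb : Bornology.IsBounded Ω)
    {v : L2 Ω} {g : L2Vec Ω} (hw : IsWeakGradient Ω v g) {A C : Set (E d)}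
    (hCΩ : C ⊆ Ω) (hA : MeasurableSet A) (hAC : ∀ x ∈ A, Metric.closedBall x φ.rOut ⊆ C) :
    ∫ x in A, ‖fderiv ℝ (mollify φ v) x‖ ^ 2 ≤ ∫ y in C, ‖g y‖ ^ 2 := by
  have hcont : Continuous (fderiv ℝ (mollify φ v)) :=
    (contDiff_mollify hΩo hΩb v).continuous_fderiv one_ne_zero
  have hρc : Continuous (φ.normed (volume : Measure (E d))) :=
    (φ.contDiff_normed (n := 0)).continuous
  have hgm : Measurable fun y => ‖g y‖ := (Lp.stronglyMeasurable g).norm.measurable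
  have hgC : Integrable (fun y => ‖g y‖ ^ 2) (volume.restrict C) :=
    (integrable_norm_sq_grad g).mono_measure (Measure.restrict_mono_set volume hCΩ)
  rw [integral_eq_lintegral_of_nonneg_ae (Eventually.of_forall fun x => sq_nonneg _)
      (by fun_prop : Continuous _).aestronglyMeasurable,
    integral_eq_lintegral_of_nonneg_ae (Eventually.of_forall fun x => sq_nonneg _)
      hgC.aestronglyMeasurable]
  refine ENNReal.toReal_mono hgC.lintegral_lt_top.ne ?_
  have hpt : ∀ x ∈ A, ENNReal.ofReal (‖fderiv ℝ (mollify φ v) x‖ ^ 2)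
      ≤ ∫⁻ y in C, ENNReal.ofReal (‖g y‖ ^ 2) * ENNReal.ofReal (φ.normed volume (x - y)) := by
    intro x hx
    have hxΩ := (hAC x hx).trans hCΩ
    have h1 := norm_fderiv_mollify_sq_le hΩo hΩb hw hxΩ
    obtain ⟨N, hN⟩ := (isTestFunction_normed_sub hxΩ).hasCompactSupport.exists_bound_of_continuous
      (isTestFunction_normed_sub hxΩ).contDiff.continuous
    have hi : Integrable (fun y => ‖g y‖ ^ 2 * φ.normed volume (x - y)) (volume.restrict C) :=
      hgC.mul_bdd (isTestFunction_normed_sub hxΩ).contDiff.continuous.aestronglyMeasurable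
        (Eventually.of_forall hN)
    rw [setIntegral_eq_of_subset_of_forall_sdiff_eq_zero hΩo.measurableSet hCΩ] at h1
    · refine (ENNReal.ofReal_le_ofReal h1).trans (le_of_eq ?_)
      rw [ofReal_integral_eq_lintegral_ofReal hi (Eventually.of_forall fun y =>
        mul_nonneg (sq_nonneg _) (φ.nonneg_normed _))]
      exact lintegral_congr fun y => ENNReal.ofReal_mul (sq_nonneg _)
    · rintro y ⟨-, hyC⟩
      have : φ.normed volume (x - y) = 0 := by
        by_contra h0
        exact hyC (hAC x hx (support_normed_sub x h0))
      rw [this, mul_zero]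
  have hρ1 : ∀ y, ∫⁻ x in A, ENNReal.ofReal (φ.normed volume (x - y)) ≤ 1 := fun y =>
    calc ∫⁻ x in A, ENNReal.ofReal (φ.normed volume (x - y))
        ≤ ∫⁻ x, ENNReal.ofReal (φ.normed volume (x - y)) := setLIntegral_le_lintegral _ _
      _ = ∫⁻ x, ENNReal.ofReal (φ.normed volume x) :=
          lintegral_sub_right_eq_self (fun x => ENNReal.ofReal (φ.normed volume x)) y
      _ = 1 := by
          rw [← ofReal_integral_eq_lintegral_ofReal φ.integrable_normed
            (Eventually.of_forall fun x => φ.nonneg_normed x), φ.integral_normed,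
            ENNReal.ofReal_one]
  calc ∫⁻ x in A, ENNReal.ofReal (‖fderiv ℝ (mollify φ v) x‖ ^ 2)
      ≤ ∫⁻ x in A, ∫⁻ y in C, ENNReal.ofReal (‖g y‖ ^ 2)
          * ENNReal.ofReal (φ.normed volume (x - y)) := setLIntegral_mono' hA hpt
    _ = ∫⁻ y in C, ∫⁻ x in A, ENNReal.ofReal (‖g y‖ ^ 2)
          * ENNReal.ofReal (φ.normed volume (x - y)) := by
        refine lintegral_lintegral_swap (Measurable.aemeasurable ?_)
        simp only [Function.uncurry_def]
        exact ((hgm.comp measurable_snd).pow_const 2).ennreal_ofReal.mul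
          (by fun_prop : Continuous fun z : E d × E d =>
            φ.normed volume (z.1 - z.2)).measurable.ennreal_ofReal
    _ ≤ ∫⁻ y in C, ENNReal.ofReal (‖g y‖ ^ 2) := by
        refine lintegral_mono fun y => ?_
        rw [lintegral_const_mul _ (by fun_prop : Continuous fun x : E d =>
            φ.normed volume (x - y)).measurable.ennreal_ofReal]
        exact mul_le_of_le_one_right' (hρ1 y)

/-- The **Payne–Weinberger inequality**, in homogeneous form: on a bounded convex open set `C` the
Poincaré constant of `H¹` functions is at most `diam C / π`. -/
theorem payne_weinberger (hΩo : IsOpen Ω) (hΩb : Bornology.IsBounded Ω) {v : L2 Ω}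
    {g : L2Vec Ω} (hw : IsWeakGradient Ω v g) {C : Set (E d)} (hC : Convex ℝ C) (hCo : IsOpen C)
    (hCΩ : C ⊆ Ω) :
    Real.pi ^ 2 * (volume.real C * (∫ x in C, v x ^ 2) - (∫ x in C, v x) ^ 2)
      ≤ Metric.diam C ^ 2 * (volume.real C * ∫ x in C, ‖g x‖ ^ 2) := by
  have hCb : Bornology.IsBounded C := hΩb.subset hCΩ
  have hCv : volume C ≠ ⊤ := hCb.measure_lt_top.ne
  have : IsFiniteMeasure (volume.restrict C) := ⟨by simpa using hCv.lt_top⟩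
  rcases C.eq_empty_or_nonempty with rfl | ⟨p, hp⟩
  · simp
  obtain ⟨ε, hε, hball⟩ := Metric.nhds_basis_closedBall.mem_iff.1 (hCo.mem_nhds hp)
  -- contractions of `C` towards `p`, and mollifiers adapted to their distance from the boundary
  set a : ℕ → ℝ := fun n => 1 / ((n : ℝ) + 2) with ha
  have ha0 : ∀ n, 0 < a n := fun n => by positivity
  have ha1 : ∀ n, a n < 1 := fun n => by
    rw [ha, div_lt_one (by positivity)]
    have : (0 : ℝ) ≤ n := n.cast_nonneg
    linarith
  have hat : Tendsto a atTop (nhds 0) := by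
    have := (tendsto_one_div_add_atTop_nhds_zero_nat (𝕜 := ℝ)).comp (tendsto_add_atTop_nat 1)
    refine this.congr fun n => ?_
    simp only [Function.comp, ha]
    push_cast
    ring_nf
  set A : ℕ → Set (E d) := fun n => {x | p + (1 - a n)⁻¹ • (x - p) ∈ C} with hA
  have hAo : ∀ n, IsOpen (A n) := fun n => hCo.preimage (by fun_prop)
  have hAconv : ∀ n, Convex ℝ (A n) := fun n x hx y hy s t hs ht hst => by
    have := hC hx hy hs ht hst
    change p + (1 - a n)⁻¹ • (s • x + t • y - p) ∈ C
    convert this using 1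
    have ht' : t = 1 - s := by linarith
    rw [ht']; module
  set φ : ℕ → ContDiffBump (0 : E d) := fun n =>
    ⟨a n * ε / 2, a n * ε, by have := ha0 n; positivity, by
      have := ha0 n; have : 0 < a n * ε := by positivity
      linarith⟩ with hφ
  have hAC : ∀ n, ∀ x ∈ A n, Metric.closedBall x (φ n).rOut ⊆ C := by
    intro n x hx y hy
    have hn := ha0 n
    have h1 : 0 < 1 - a n := by linarith [ha1 n]
    -- `y` is a convex combination of a point of the ball around `p` and a point of `C`
    have hz : p + (a n)⁻¹ • (y - x) ∈ C := by
      refine hball ?_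
      rw [mem_closedBall_iff_norm, add_sub_cancel_left, norm_smul, norm_inv,
        Real.norm_of_nonneg hn.le, inv_mul_le_iff₀ hn, ← dist_eq_norm]
      exact hy
    have := hC hz hx hn.le h1.le (by ring)
    convert this using 1
    rw [smul_add, smul_add, smul_smul, smul_smul, mul_inv_cancel₀ hn.ne', mul_inv_cancel₀ h1.ne']
    module
  have hAsub : ∀ n, A n ⊆ C := fun n x hx =>
    hAC n x hx (Metric.mem_closedBall_self (φ n).rOut_pos.le)
  set Z : ℝ := 2 / Real.pi ^ 2 * (Metric.diam C ^ 2 * (volume.real C * ∫ x in C, ‖g x‖ ^ 2)) with hZ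
  have hu : ∀ n, MemLp (mollify (φ n) v) 2 volume := fun n =>
    (contDiff_mollify hΩo hΩb v).continuous.memLp_of_hasCompactSupport
      (hasCompactSupport_mollify hΩb v)
  have hbound : ∀ n, ∫⁻ x in A n, ∫⁻ y in A n,
      ENNReal.ofReal ((mollify (φ n) v x - mollify (φ n) v y) ^ 2) ≤ ENNReal.ofReal Z := by
    intro n
    have hAv : volume (A n) ≠ ⊤ := (hCb.subset (hAsub n)).measure_lt_top.ne
    have : IsFiniteMeasure (volume.restrict (A n)) := ⟨by simpa using hAv.lt_top⟩
    rw [lintegral_lintegral_sub_sq ((hu n).restrict _)]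
    refine ENNReal.ofReal_le_ofReal ?_
    have h1 := variance_le_of_contDiff (hAconv n) (hAo n) (hCb.subset (hAsub n))
      (contDiff_mollify (φ := φ n) hΩo hΩb v) (hasCompactSupport_mollify hΩb v)
    have h2 := setIntegral_norm_fderiv_mollify_le hΩo hΩb hw hCΩ
      (hAo n).measurableSet (hAC n)
    have h3 : Metric.diam (A n) ≤ Metric.diam C := Metric.diam_mono (hAsub n) hCb
    have h4 : volume.real (A n) ≤ volume.real C := measureReal_mono (hAsub n) hCv
    rw [measureReal_restrict_apply_univ, hZ, div_mul_eq_mul_div, le_div_iff₀ (by positivity)]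
    have h5 : Metric.diam (A n) ^ 2 * (volume.real (A n)
          * ∫ x in A n, ‖fderiv ℝ (mollify (φ n) v) x‖ ^ 2)
        ≤ Metric.diam C ^ 2 * (volume.real C * ∫ x in C, ‖g x‖ ^ 2) := by
      have : 0 ≤ ∫ x in A n, ‖fderiv ℝ (mollify (φ n) v) x‖ ^ 2 :=
        integral_nonneg fun x => sq_nonneg _
      gcongr
    linarith
  have hlim : ∀ᵐ x ∂(volume.restrict C),
      Tendsto (fun n => mollify (φ n) v x) atTop (nhds (v x)) := by
    have h1 := ContDiffBump.ae_convolution_tendsto_right_of_locallyIntegrable (μ := volume)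
      (φ := φ) (l := atTop) (K := 2) (by simpa [hφ] using hat.mul_const ε)
      (Eventually.of_forall fun n => by simp only [hφ]; linarith)
      (integrable_indicator_L2 hΩo hΩb v).locallyIntegrable
    filter_upwards [ae_restrict_of_ae h1, ae_restrict_mem hCo.measurableSet] with x hx hxC
    rwa [indicator_of_mem (hCΩ hxC)] at hx
  have hmemA : ∀ x ∈ C, ∀ᶠ n in atTop, x ∈ A n := by
    intro x hx
    have h1 : Tendsto (fun n => p + (1 - a n)⁻¹ • (x - p)) atTop
        (nhds (p + (1 - 0 : ℝ)⁻¹ • (x - p))) :=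
      (((tendsto_const_nhds.sub hat).inv₀ (by norm_num)).smul_const _).const_add p
    refine h1.eventually (hCo.mem_nhds ?_)
    simpa using hx
  have key : ∫⁻ x in C, ∫⁻ y in C, ENNReal.ofReal ((v x - v y) ^ 2) ≤ ENNReal.ofReal Z := by
    refine lintegral_lintegral_le_of_tendsto (F := fun n x y => (A n ×ˢ A n).indicator (fun z =>
      ENNReal.ofReal ((mollify (φ n) v z.1 - mollify (φ n) v z.2) ^ 2)) (x, y)) ?_ ?_ ?_
    · intro n
      have hc := (contDiff_mollify (φ := φ n) hΩo hΩb v).continuous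
      exact Measurable.indicator (by fun_prop)
        ((hAo n).measurableSet.prod (hAo n).measurableSet)
    · filter_upwards [hlim, ae_restrict_mem hCo.measurableSet] with x hx hxC
      filter_upwards [hlim, ae_restrict_mem hCo.measurableSet] with y hy hyC
      refine (ENNReal.tendsto_ofReal ((hx.sub hy).pow 2)).congr' ?_
      filter_upwards [hmemA x hxC, hmemA y hyC] with n h1 h2
      exact (indicator_of_mem (mk_mem_prod h1 h2) (fun z : E d × E d =>
        ENNReal.ofReal ((mollify (φ n) v z.1 - mollify (φ n) v z.2) ^ 2))).symm
    · intro n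
      refine le_trans (le_of_eq ?_) (hbound n)
      have hr : ∀ F : E d → ℝ≥0∞, ∫⁻ x in C, (A n).indicator F x = ∫⁻ x in A n, F x := fun F => by
        rw [lintegral_indicator (hAo n).measurableSet,
          Measure.restrict_restrict (hAo n).measurableSet, inter_eq_left.2 (hAsub n)]
      rw [← hr]
      refine lintegral_congr fun x => ?_
      by_cases hx : x ∈ A n
      · rw [indicator_of_mem hx, ← hr]
        refine lintegral_congr fun y => ?_
        by_cases hy : y ∈ A n <;> simp [hx, hy]
      · simp [hx]
  have hvC : MemLp v 2 (volume.restrict C) :=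
    (Lp.memLp v).mono_measure (Measure.restrict_mono_set volume hCΩ)
  have hZ0 : 0 ≤ Z := by
    have : 0 ≤ ∫ x in C, ‖g x‖ ^ 2 := integral_nonneg fun x => sq_nonneg _
    positivity
  rw [lintegral_lintegral_sub_sq hvC, ENNReal.ofReal_le_ofReal_iff hZ0,
    measureReal_restrict_apply_univ, hZ, div_mul_eq_mul_div, le_div_iff₀ (by positivity)] at key
  linarith

end mollify

/-! ### The L² norm and the augmented form -/

section localEstimate

variable {d : ℕ} {Ω : Set (E d)}

/-- Expansion of the mean square deviation from a constant. -/
theorem setIntegral_sub_const_sq {B : Set (E d)} (hB : volume B ≠ ⊤) {v : E d → ℝ}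
    (hv : MemLp v 2 (volume.restrict B)) (m : ℝ) :
    ∫ x in B, (v x - m) ^ 2
      = (∫ x in B, v x ^ 2) - 2 * m * (∫ x in B, v x) + volume.real B * m ^ 2 := by
  have : IsFiniteMeasure (volume.restrict B) := ⟨by simpa using hB.lt_top⟩
  have i1 : Integrable v (volume.restrict B) := hv.integrable (by norm_num)
  have h1 : Integrable (fun x => v x ^ 2 - 2 * m * v x) (volume.restrict B) :=
    hv.integrable_sq.sub (i1.const_mul _)
  have e : (fun x => (v x - m) ^ 2) = fun x => (v x ^ 2 - 2 * m * v x) + m ^ 2 := by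
    ext x; ring
  rw [e, integral_add h1 (integrable_const _), integral_sub hv.integrable_sq (i1.const_mul _),
    integral_const_mul]
  simp

theorem setIntegral_eq_volume_mul_average {B : Set (E d)} (hB0 : volume.real B ≠ 0) (v : E d → ℝ) :
    ∫ x in B, v x = volume.real B * ⨍ x in B, v x := by
  rw [setAverage_eq, smul_eq_mul, mul_inv_cancel_left₀ hB0]

theorem volume_mul_average_sub_sq_le {B : Set (E d)} (hB : volume B ≠ ⊤) (hB0 : volume.real B ≠ 0)
    {v : E d → ℝ} (hv : MemLp v 2 (volume.restrict B)) (m : ℝ) :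
    volume.real B * ((⨍ x in B, v x) - m) ^ 2 ≤ ∫ x in B, (v x - m) ^ 2 := by
  have h1 := setIntegral_sub_const_sq hB hv (⨍ x in B, v x)
  have h2 : 0 ≤ ∫ x in B, (v x - ⨍ x in B, v x) ^ 2 := integral_nonneg fun x => sq_nonneg _
  rw [h1, setIntegral_eq_volume_mul_average hB0 v] at h2
  rw [setIntegral_sub_const_sq hB hv, setIntegral_eq_volume_mul_average hB0 v]
  linarith

/-- The Payne–Weinberger inequality as a bound for the mean square in terms of the mean. -/
theorem setIntegral_sq_le_average (hΩo : IsOpen Ω) (hΩb : Bornology.IsBounded Ω) {v : L2 Ω}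
    {g : L2Vec Ω} (hw : IsWeakGradient Ω v g) {C : Set (E d)} (hC : Convex ℝ C) (hCo : IsOpen C)
    (hCΩ : C ⊆ Ω) (hCn : C.Nonempty) {R : ℝ} (hR : Metric.diam C ≤ R) :
    ∫ x in C, v x ^ 2 ≤ R ^ 2 / Real.pi ^ 2 * (∫ x in C, ‖g x‖ ^ 2)
      + volume.real C * (⨍ x in C, v x) ^ 2 := by
  have hCv : volume C ≠ ⊤ := (hΩb.subset hCΩ).measure_lt_top.ne
  have hV : 0 < volume.real C := ENNReal.toReal_pos (hCo.measure_pos volume hCn).ne' hCv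
  have key := payne_weinberger hΩo hΩb hw hC hCo hCΩ
  have hG : 0 ≤ ∫ x in C, ‖g x‖ ^ 2 := integral_nonneg fun x => sq_nonneg _
  have hR2 : Metric.diam C ^ 2 ≤ R ^ 2 := pow_le_pow_left₀ Metric.diam_nonneg hR 2
  have h1 := key.trans (mul_le_mul_of_nonneg_right hR2 (mul_nonneg hV.le hG))
  rw [setIntegral_eq_volume_mul_average hV.ne' v] at h1
  have h2 : volume.real C * (Real.pi ^ 2 * ((∫ x in C, v x ^ 2)
      - volume.real C * (⨍ x in C, v x) ^ 2)) ≤ volume.real C * (R ^ 2 * ∫ x in C, ‖g x‖ ^ 2) := by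
    linarith
  have h3 := le_of_mul_le_mul_left h2 hV
  rw [div_mul_eq_mul_div, ← sub_le_iff_le_add, le_div_iff₀ (by positivity)]
  linarith

/-- The mean over `C` may be replaced by the mean over a subset `B`, at the price of a factor
`3 |C| / |B|`. -/
theorem setIntegral_sq_le_average_subset (hΩo : IsOpen Ω) (hΩb : Bornology.IsBounded Ω) {v : L2 Ω}
    {g : L2Vec Ω} (hw : IsWeakGradient Ω v g) {B C : Set (E d)} (hC : Convex ℝ C) (hCo : IsOpen C)
    (hCΩ : C ⊆ Ω) (hBo : IsOpen B) (hBn : B.Nonempty) (hBC : B ⊆ C) {R : ℝ}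
    (hR : Metric.diam C ≤ R) :
    ∫ x in C, v x ^ 2 ≤ 3 * (volume.real C / volume.real B)
      * (R ^ 2 / Real.pi ^ 2 * (∫ x in C, ‖g x‖ ^ 2)
        + volume.real B * (⨍ x in B, v x) ^ 2) := by
  have hCv : volume C ≠ ⊤ := (hΩb.subset hCΩ).measure_lt_top.ne
  have hBv : volume B ≠ ⊤ := ne_top_of_le_ne_top hCv (measure_mono hBC)
  have hV : 0 < volume.real C :=
    ENNReal.toReal_pos (hCo.measure_pos volume (hBn.mono hBC)).ne' hCv
  have hb : 0 < volume.real B := ENNReal.toReal_pos (hBo.measure_pos volume hBn).ne' hBv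
  have hbV : volume.real B ≤ volume.real C := measureReal_mono hBC hCv
  have hvC : MemLp v 2 (volume.restrict C) :=
    (Lp.memLp v).mono_measure (Measure.restrict_mono_set volume hCΩ)
  have hvB : MemLp v 2 (volume.restrict B) :=
    hvC.mono_measure (Measure.restrict_mono_set volume hBC)
  have : IsFiniteMeasure (volume.restrict C) := ⟨by simpa using hCv.lt_top⟩
  have key := setIntegral_sq_le_average hΩo hΩb hw hC hCo hCΩ (hBn.mono hBC) hR
  set P := R ^ 2 / Real.pi ^ 2 * ∫ x in C, ‖g x‖ ^ 2 with hP
  set m := ⨍ x in C, v x with hm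
  set β := ⨍ x in B, v x with hβ
  set V := volume.real C with hVdef
  set b := volume.real B with hbdef
  set S := ∫ x in C, v x ^ 2 with hS
  have h1 : b * (β - m) ^ 2 ≤ S - V * m ^ 2 := by
    have e1 := volume_mul_average_sub_sq_le hBv hb.ne' hvB m
    have hi : IntegrableOn (fun x => (v x - m) ^ 2) C :=
      (hvC.sub (memLp_const m)).integrable_sq
    have e2 : ∫ x in B, (v x - m) ^ 2 ≤ ∫ x in C, (v x - m) ^ 2 :=
      setIntegral_mono_set hi (Eventually.of_forall fun x => sq_nonneg _) hBC.eventuallyLE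
    have e3 := setIntegral_sub_const_sq hCv hvC m
    rw [setIntegral_eq_volume_mul_average hV.ne' v] at e3
    linarith
  set W := S - V * m ^ 2 with hW
  have hWP : W ≤ P := by linarith
  have hρ : 1 ≤ V / b := (one_le_div hb).2 hbV
  set ρ := V / b with hρdef
  have hρb : ρ * b = V := by rw [hρdef]; field_simp
  have hW0 : 0 ≤ W := (mul_nonneg hb.le (sq_nonneg _)).trans h1
  have h2 : m ^ 2 ≤ 2 * β ^ 2 + 2 * (β - m) ^ 2 := by nlinarith [sq_nonneg (2 * β - m)]
  have h3 : V * m ^ 2 ≤ 2 * ρ * (b * β ^ 2) + 2 * ρ * W := by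
    have e1 := mul_le_mul_of_nonneg_left h2 hV.le
    have e2 := mul_le_mul_of_nonneg_left h1 (by linarith : 0 ≤ 2 * ρ)
    rw [← hρb] at e1 ⊢
    linarith
  have hbβ : 0 ≤ ρ * (b * β ^ 2) := by positivity
  have h4 : W ≤ ρ * W := le_mul_of_one_le_left hW0 hρ
  have h5 : ρ * W ≤ ρ * P := mul_le_mul_of_nonneg_left hWP (by linarith)
  have : S = W + V * m ^ 2 := by rw [hW]; ring
  rw [this]
  linarith

end localEstimate

section globalEstimate

variable {d m : ℕ} {Ω : Set (E d)} {B K : Fin m → Set (E d)}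

theorem IsDataCover.B_subset_interior (h : IsDataCover Ω B K) (i : Fin m) :
    B i ⊆ interior (K i) := interior_maximal (h.B_subset_K i) (h.isOpen_B i)

theorem IsDataCover.volume_B_ne_top (h : IsDataCover Ω B K) (hΩb : Bornology.IsBounded Ω)
    (i : Fin m) : volume (B i) ≠ ⊤ := (hΩb.subset (h.B_subset i)).measure_lt_top.ne

theorem IsDataCover.volume_B_pos (h : IsDataCover Ω B K) (hΩb : Bornology.IsBounded Ω)
    (i : Fin m) : 0 < volume.real (B i) :=
  ENNReal.toReal_pos ((h.isOpen_B i).measure_pos volume (h.nonempty_B i)).ne'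
    (h.volume_B_ne_top hΩb i)

theorem IsDataCover.isBounded_K (h : IsDataCover Ω B K) (hΩb : Bornology.IsBounded Ω)
    (i : Fin m) : Bornology.IsBounded (K i) := by
  refine (hΩb.subset (h.interior_K_subset i)).closure.subset ?_
  rw [(h.convex_K i).closure_interior_eq_closure_of_nonempty_interior
    ((h.nonempty_B i).mono (h.B_subset_interior i))]
  exact subset_closure

theorem IsDataCover.diam_interior_le (h : IsDataCover Ω B K) (hΩb : Bornology.IsBounded Ω)
    (i : Fin m) : Metric.diam (interior (K i)) ≤ maxDiam K :=
  (Metric.diam_mono interior_subset (h.isBounded_K hΩb i)).trans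
    (le_ciSup (Finite.bddAbove_range fun i => Metric.diam (K i)) i)

theorem IsDataCover.volume_interior (h : IsDataCover Ω B K) (i : Fin m) :
    volume (interior (K i)) = volume (K i) :=
  measure_interior_of_null_frontier (Convex.addHaar_frontier volume (h.convex_K i))

theorem IsDataCover.exists_mem_interior (h : IsDataCover Ω B K) :
    ∀ᵐ x ∂volume, x ∈ Ω → ∃ i, x ∈ interior (K i) := by
  have : ∀ᵐ x ∂(volume : Measure (E d)), ∀ i, x ∉ frontier (K i) := ae_all_iff.2 fun i =>
    compl_mem_ae_iff.2 (by
      simpa using Convex.addHaar_frontier volume (h.convex_K i))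
  filter_upwards [this] with x hx hxΩ
  obtain ⟨i, hi⟩ := mem_iUnion.1 (h.cover hxΩ)
  refine ⟨i, ?_⟩
  by_contra h0
  exact hx i ⟨hi, h0⟩

theorem card_le_maxOverlap {x : E d} (hx : x ∈ Ω) :
    {i : Fin m | x ∈ K i}.ncard ≤ maxOverlap Ω K :=
  le_csSup ⟨m, by
    rintro _ ⟨y, -, rfl⟩
    simpa using Set.ncard_le_card {i : Fin m | y ∈ K i}⟩ (mem_image_of_mem _ hx)

theorem sum_indicator_eq {x : E d} {C : Fin m → Set (E d)} (F : E d → ℝ) :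
    ∑ i, (C i).indicator F x = ({i | x ∈ C i}.ncard : ℝ) * F x := by
  classical
  simp only [indicator_apply]
  rw [← Finset.sum_filter, Finset.sum_const, nsmul_eq_mul, Set.ncard_eq_toFinset_card']
  congr 3
  ext i
  simp

theorem IsDataCover.sum_setIntegral_eq (h : IsDataCover Ω B K) {F : E d → ℝ}
    (hF : IntegrableOn F Ω) :
    ∑ i, ∫ x in interior (K i), F x
      = ∫ x in Ω, ({i | x ∈ interior (K i)}.ncard : ℝ) * F x := by
  simp only [← sum_indicator_eq]
  rw [integral_finsetSum _ fun i _ => hF.indicator isOpen_interior.measurableSet]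
  refine Finset.sum_congr rfl fun i _ => ?_
  rw [integral_indicator isOpen_interior.measurableSet,
    Measure.restrict_restrict isOpen_interior.measurableSet,
    inter_eq_left.2 (h.interior_K_subset i)]

theorem integrable_ncard_mul {F : E d → ℝ}
    (hF : IntegrableOn F Ω) :
    IntegrableOn (fun x => ({i | x ∈ interior (K i)}.ncard : ℝ) * F x) Ω := by
  simp only [← sum_indicator_eq]
  exact integrable_finsetSum _ fun i _ => hF.indicator isOpen_interior.measurableSet

theorem IsDataCover.setIntegral_le_sum (h : IsDataCover Ω B K) (hΩo : IsOpen Ω) {F : E d → ℝ}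
    (hF : IntegrableOn F Ω) (hF0 : ∀ x, 0 ≤ F x) :
    ∫ x in Ω, F x ≤ ∑ i, ∫ x in interior (K i), F x := by
  rw [h.sum_setIntegral_eq hF]
  refine integral_mono_ae hF (integrable_ncard_mul hF) ?_
  filter_upwards [ae_restrict_of_ae h.exists_mem_interior, ae_restrict_mem hΩo.measurableSet]
    with x hx hxΩ
  obtain ⟨i, hi⟩ := hx hxΩ
  refine le_mul_of_one_le_left (hF0 x) ?_
  exact_mod_cast (Set.ncard_pos (toFinite _)).2 ⟨i, hi⟩

theorem IsDataCover.sum_setIntegral_le (h : IsDataCover Ω B K) (hΩo : IsOpen Ω) {F : E d → ℝ}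
    (hF : IntegrableOn F Ω) (hF0 : ∀ x, 0 ≤ F x) :
    ∑ i, ∫ x in interior (K i), F x ≤ maxOverlap Ω K * ∫ x in Ω, F x := by
  rw [h.sum_setIntegral_eq hF, ← integral_const_mul]
  refine integral_mono_ae (integrable_ncard_mul hF) (hF.const_mul _) ?_
  filter_upwards [ae_restrict_mem hΩo.measurableSet] with x hxΩ
  refine mul_le_mul_of_nonneg_right ?_ (hF0 x)
  exact_mod_cast (Set.ncard_le_ncard (t := {i | x ∈ K i})
    (fun i (hi : x ∈ interior (K i)) => interior_subset (s := K i) hi) (toFinite _)).trans (card_le_maxOverlap hxΩ)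

theorem mismatch_nonneg : 0 ≤ mismatch B K := by
  unfold mismatch
  split_ifs
  · exact zero_le_one
  · exact mul_nonneg (by norm_num)
      (Real.iSup_nonneg fun i => div_nonneg measureReal_nonneg measureReal_nonneg)

theorem IsDataCover.setIntegral_sq_le (h : IsDataCover Ω B K) (hΩo : IsOpen Ω)
    (hΩb : Bornology.IsBounded Ω) {v : L2 Ω} {g : L2Vec Ω} (hw : IsWeakGradient Ω v g)
    (i : Fin m) :
    ∫ x in interior (K i), v x ^ 2 ≤ mismatch B K
      * (maxDiam K ^ 2 / Real.pi ^ 2 * (∫ x in interior (K i), ‖g x‖ ^ 2)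
        + volume.real (B i) * (⨍ x in B i, v x) ^ 2) := by
  unfold mismatch
  split_ifs with hBK
  · have hi : interior (K i) = B i := by rw [← hBK i, (h.isOpen_B i).interior_eq]
    have := setIntegral_sq_le_average hΩo hΩb hw (h.convex_K i).interior isOpen_interior
      (h.interior_K_subset i) ((h.nonempty_B i).mono (h.B_subset_interior i))
      (h.diam_interior_le hΩb i)
    rw [one_mul]
    rwa [hi] at this ⊢
  · refine (setIntegral_sq_le_average_subset hΩo hΩb hw (h.convex_K i).interior isOpen_interior
      (h.interior_K_subset i) (h.isOpen_B i) (h.nonempty_B i) (h.B_subset_interior i)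
      (h.diam_interior_le hΩb i)).trans ?_
    have hG : 0 ≤ ∫ x in interior (K i), ‖g x‖ ^ 2 := integral_nonneg fun x => sq_nonneg _
    have hb : 0 ≤ volume.real (B i) := measureReal_nonneg
    refine mul_le_mul_of_nonneg_right (mul_le_mul_of_nonneg_left ?_ (by norm_num)) (by positivity)
    have : volume.real (interior (K i)) = volume.real (K i) := by
      simp only [Measure.real, h.volume_interior i]
    rw [this]
    exact le_ciSup (Finite.bddAbove_range fun i => volume.real (K i) / volume.real (B i)) i

theorem norm_sq_eq_setIntegral (v : L2 Ω) : ‖v‖ ^ 2 = ∫ x in Ω, v x ^ 2 := by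
  rw [← real_inner_self_eq_norm_sq, MeasureTheory.L2.inner_def]
  refine integral_congr_ae (Eventually.of_forall fun x => ?_)
  simp [pow_two]

theorem norm_sq_eq_setIntegral_vec (g : L2Vec Ω) : ‖g‖ ^ 2 = ∫ x in Ω, ‖g x‖ ^ 2 := by
  rw [← real_inner_self_eq_norm_sq, MeasureTheory.L2.inner_def]
  refine integral_congr_ae (Eventually.of_forall fun x => ?_)
  simp

theorem bForm_self (v : H1 Ω) :
    bForm B v v = ∑ i, volume.real (B i) * (⨍ x in B i, toL2 v x) ^ 2 :=
  Finset.sum_congr rfl fun i _ => by ring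

theorem bForm_self_nonneg (v : H1 Ω) : 0 ≤ bForm B v v := by
  rw [bForm_self]
  exact Finset.sum_nonneg fun i _ => mul_nonneg measureReal_nonneg (sq_nonneg _)

/-- The local inequalities add up, with the overlap of the `K_i` as a factor. -/
theorem IsDataCover.norm_toL2_sq_le (h : IsDataCover Ω B K) (hΩo : IsOpen Ω)
    (hΩb : Bornology.IsBounded Ω) (v : H1 Ω) :
    ‖toL2 v‖ ^ 2 ≤ mismatch B K * (maxDiam K ^ 2 * maxOverlap Ω K / Real.pi ^ 2 * ‖grad v‖ ^ 2
      + bForm B v v) := by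
  rw [norm_sq_eq_setIntegral, norm_sq_eq_setIntegral_vec, bForm_self]
  have hη := mismatch_nonneg (B := B) (K := K)
  calc ∫ x in Ω, toL2 v x ^ 2 ≤ ∑ i, ∫ x in interior (K i), toL2 v x ^ 2 :=
        h.setIntegral_le_sum hΩo (Lp.memLp (toL2 v)).integrable_sq fun x => sq_nonneg _
    _ ≤ ∑ i, mismatch B K
      * (maxDiam K ^ 2 / Real.pi ^ 2 * (∫ x in interior (K i), ‖grad v x‖ ^ 2)
        + volume.real (B i) * (⨍ x in B i, toL2 v x) ^ 2) :=
        Finset.sum_le_sum fun i _ => h.setIntegral_sq_le hΩo hΩb v.2 i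
    _ = mismatch B K * (maxDiam K ^ 2 / Real.pi ^ 2 * (∑ i, ∫ x in interior (K i), ‖grad v x‖ ^ 2)
        + ∑ i, volume.real (B i) * (⨍ x in B i, toL2 v x) ^ 2) := by
        rw [← Finset.mul_sum, Finset.sum_add_distrib, ← Finset.mul_sum]
    _ ≤ mismatch B K * (maxDiam K ^ 2 / Real.pi ^ 2
          * (maxOverlap Ω K * ∫ x in Ω, ‖grad v x‖ ^ 2)
        + ∑ i, volume.real (B i) * (⨍ x in B i, toL2 v x) ^ 2) := by
        refine mul_le_mul_of_nonneg_left (add_le_add_left (mul_le_mul_of_nonneg_left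
          (h.sum_setIntegral_le hΩo (integrable_norm_sq_grad _) fun x => sq_nonneg _)
          (by positivity)) _) hη
    _ = _ := by ring

variable {α σ : E d → ℝ} {αmin : ℝ}

theorem IsEllipticCoeff.integrable_α_mul (hα : IsEllipticCoeff Ω α σ αmin) {F : E d → ℝ}
    (hF : IntegrableOn F Ω) : IntegrableOn (fun x => α x * F x) Ω := by
  obtain ⟨αmax, hmax⟩ := hα.α_le
  refine hF.bdd_mul (c := αmax) hα.aestronglyMeasurable_α ?_
  filter_upwards [hmax, hα.le_α] with x h1 h2
  rw [Real.norm_of_nonneg (hα.pos.le.trans h2)]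
  exact h1

theorem IsEllipticCoeff.integrable_σ_mul (hα : IsEllipticCoeff Ω α σ αmin) {F : E d → ℝ}
    (hF : IntegrableOn F Ω) : IntegrableOn (fun x => σ x * F x) Ω := by
  obtain ⟨σmax, hmax⟩ := hα.σ_le
  refine hF.bdd_mul (c := σmax) hα.aestronglyMeasurable_σ ?_
  filter_upwards [hmax, hα.σ_nonneg] with x h1 h2
  rw [Real.norm_of_nonneg h2]
  exact h1

theorem IsEllipticCoeff.integrable_aForm_left (hα : IsEllipticCoeff Ω α σ αmin) (w v : H1 Ω) :
    IntegrableOn (fun x => α x * inner ℝ (grad w x) (grad v x)) Ω :=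
  hα.integrable_α_mul (MeasureTheory.L2.integrable_inner (grad w) (grad v))

theorem IsEllipticCoeff.integrable_aForm_right (hα : IsEllipticCoeff Ω α σ αmin) (w v : H1 Ω) :
    IntegrableOn (fun x => σ x * toL2 w x * toL2 v x) Ω := by
  simp only [mul_assoc]
  exact hα.integrable_σ_mul ((Lp.memLp (toL2 w)).integrable_mul (Lp.memLp (toL2 v)))

theorem IsEllipticCoeff.integrable_aForm (hα : IsEllipticCoeff Ω α σ αmin) (w v : H1 Ω) :
    IntegrableOn (fun x => α x * inner ℝ (grad w x) (grad v x) + σ x * toL2 w x * toL2 v x) Ω :=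
  (hα.integrable_aForm_left w v).add (hα.integrable_aForm_right w v)

theorem IsEllipticCoeff.le_aForm (hα : IsEllipticCoeff Ω α σ αmin) (v : H1 Ω) :
    αmin * ‖grad v‖ ^ 2 ≤ aForm α σ v v := by
  rw [norm_sq_eq_setIntegral_vec, ← integral_const_mul]
  refine integral_mono_ae ((integrable_norm_sq_grad _).const_mul _) (hα.integrable_aForm v v) ?_
  filter_upwards [hα.le_α, hα.σ_nonneg] with x h1 h2
  rw [real_inner_self_eq_norm_sq, mul_assoc]
  have := mul_le_mul_of_nonneg_right h1 (sq_nonneg ‖grad v x‖)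
  have := mul_nonneg h2 (mul_self_nonneg (toL2 v x))
  linarith

theorem IsEllipticCoeff.aForm_self_nonneg (hα : IsEllipticCoeff Ω α σ αmin) (v : H1 Ω) :
    0 ≤ aForm α σ v v :=
  (mul_nonneg hα.pos.le (sq_nonneg _)).trans (hα.le_aForm v)

theorem IsEllipticCoeff.cForm_self_nonneg (hα : IsEllipticCoeff Ω α σ αmin) {δ : ℝ} (hδ : 0 < δ)
    (v : H1 Ω) : 0 ≤ cForm α σ B δ v v :=
  add_nonneg (hα.aForm_self_nonneg v) (mul_nonneg (inv_pos.2 hδ).le (bForm_self_nonneg v))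

theorem Gam_nonneg {δ : ℝ} (hδ : 0 < δ) : 0 ≤ Gam Ω B K αmin δ :=
  mul_nonneg mismatch_nonneg (hδ.le.trans (le_max_right _ _))

/-- The augmented form controls the `L²` norm with the constant `Γ`. -/
theorem norm_toL2_sq_le_cForm (hΩo : IsOpen Ω) (hΩb : Bornology.IsBounded Ω)
    (hα : IsEllipticCoeff Ω α σ αmin) (h : IsDataCover Ω B K) {δ : ℝ} (hδ : 0 < δ) (v : H1 Ω) :
    ‖toL2 v‖ ^ 2 ≤ Gam Ω B K αmin δ * cForm α σ B δ v v := by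
  refine (h.norm_toL2_sq_le hΩo hΩb v).trans ?_
  rw [Gam, mul_assoc]
  refine mul_le_mul_of_nonneg_left ?_ mismatch_nonneg
  set Z := maxDiam K ^ 2 * (maxOverlap Ω K : ℝ) with hZ
  have hZ0 : 0 ≤ Z := by positivity
  have hpos := hα.pos
  have ha := hα.aForm_self_nonneg v
  have hb : 0 ≤ bForm B v v := bForm_self_nonneg v
  set X := max (Z / (Real.pi ^ 2 * αmin)) δ with hX
  have h1 : Z / Real.pi ^ 2 * ‖grad v‖ ^ 2 ≤ X * aForm α σ v v :=
    calc Z / Real.pi ^ 2 * ‖grad v‖ ^ 2 = Z / (Real.pi ^ 2 * αmin) * (αmin * ‖grad v‖ ^ 2) := by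
          field_simp
      _ ≤ Z / (Real.pi ^ 2 * αmin) * aForm α σ v v :=
          mul_le_mul_of_nonneg_left (hα.le_aForm v) (by positivity)
      _ ≤ X * aForm α σ v v := mul_le_mul_of_nonneg_right (le_max_left _ _) ha
  have h2 : bForm B v v ≤ X * (δ⁻¹ * bForm B v v) :=
    calc bForm B v v = δ * (δ⁻¹ * bForm B v v) := by field_simp
      _ ≤ _ := mul_le_mul_of_nonneg_right (le_max_right _ _)
          (mul_nonneg (inv_pos.2 hδ).le hb)
  rw [cForm, mul_add]
  exact add_le_add h1 h2

end globalEstimate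

/-! ### The variational problem -/

/-- The Lax–Milgram theorem on a closed subspace. -/
theorem exists_solution_of_coercive {X : Type*} [NormedAddCommGroup X] [InnerProductSpace ℝ X]
    [CompleteSpace X] {V : Submodule ℝ X} (hV : IsClosed (V : Set X))
    (b : LinearMap.BilinForm ℝ X) {A c : ℝ} (hA : ∀ w v, |b w v| ≤ A * ‖w‖ * ‖v‖) (hc : 0 < c)
    (hcoer : ∀ v, c * ‖v‖ * ‖v‖ ≤ b v v) (F : X →L[ℝ] ℝ) :
    ∃ u ∈ V, ∀ v ∈ V, b u v = F v := by
  have : CompleteSpace V := hV.completeSpace_coe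
  set b' : V →L[ℝ] V →L[ℝ] ℝ := LinearMap.mkContinuous₂ (b.compl₁₂ V.subtype V.subtype) A
    (fun w v => hA w v) with hb'
  have hcoer' : IsCoercive b' := ⟨c, hc, fun v => hcoer v⟩
  set u : V := hcoer'.continuousLinearEquivOfBilin.symm
    ((InnerProductSpace.toDual ℝ V).symm (F.comp V.subtypeL)) with hu
  refine ⟨u, u.2, fun v hv => ?_⟩
  have h1 := hcoer'.continuousLinearEquivOfBilin_apply u ⟨v, hv⟩
  rw [hu, ContinuousLinearEquiv.apply_symm_apply, InnerProductSpace.toDual_symm_apply, ← hu] at h1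
  exact h1.symm

section space

variable {d : ℕ} {Ω : Set (E d)}

/-- The embedding `H¹(Ω) → L²(Ω)`. -/
noncomputable def toL2L (Ω : Set (E d)) : H1 Ω →L[ℝ] L2 Ω :=
  (WithLp.fstL 2 ℝ (L2 Ω) (L2Vec Ω)).comp (H1 Ω).subtypeL

theorem norm_sq_H1 (v : H1 Ω) : ‖v‖ ^ 2 = ‖toL2 v‖ ^ 2 + ‖grad v‖ ^ 2 :=
  WithLp.prod_norm_sq_eq_of_L2 (v : WithLp 2 (L2 Ω × L2Vec Ω))

/-- Weak gradients are stable under limits, so that `H¹(Ω)` is complete. -/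
theorem isClosed_H1 : IsClosed (H1 Ω : Set (WithLp 2 (L2 Ω × L2Vec Ω))) := by
  have heq : (H1 Ω : Set (WithLp 2 (L2 Ω × L2Vec Ω))) = ⋂ (φ : E d → ℝ) (_ : IsTestFunction Ω φ)
      (j : Fin d), {p | ∫ x in Ω, p.fst x * partialDeriv j φ x = - ∫ x in Ω, p.snd x j * φ x} := by
    ext p
    simp only [mem_iInter]
    exact Iff.rfl
  rw [heq]
  refine isClosed_iInter fun φ => isClosed_iInter fun hφ => isClosed_iInter fun j =>
    isClosed_eq ?_ (Continuous.neg ?_)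
  · have h1 : ∀ p : WithLp 2 (L2 Ω × L2Vec Ω), ∫ x in Ω, p.fst x * partialDeriv j φ x
        = inner ℝ ((hφ.memLp_partialDeriv j).toLp _) p.fst := fun p => by
      rw [MeasureTheory.L2.inner_def]
      refine integral_congr_ae ?_
      filter_upwards [(hφ.memLp_partialDeriv j).coeFn_toLp] with x hx
      simp [hx]
    simp only [h1]
    exact continuous_const.inner (WithLp.fstL 2 ℝ (L2 Ω) (L2Vec Ω)).continuous
  · have h1 : ∀ p : WithLp 2 (L2 Ω × L2Vec Ω), ∫ x in Ω, p.snd x j * φ x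
        = inner ℝ (hφ.memLp.toLp _)
          ((EuclideanSpace.proj (𝕜 := ℝ) j : E d →L[ℝ] ℝ).compLpL 2 (volume.restrict Ω) p.snd) :=
      fun p => by
      rw [MeasureTheory.L2.inner_def]
      refine integral_congr_ae ?_
      filter_upwards [hφ.memLp.coeFn_toLp, ContinuousLinearMap.coeFn_compLpL
        (EuclideanSpace.proj (𝕜 := ℝ) j : E d →L[ℝ] ℝ) p.snd] with x hx hx'
      simp [hx, hx']
    simp only [h1]
    exact continuous_const.inner ((ContinuousLinearMap.continuous _).comp
      (WithLp.sndL 2 ℝ (L2 Ω) (L2Vec Ω)).continuous)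

instance : CompleteSpace (H1 Ω) := isClosed_H1.completeSpace_coe

end space

section forms

variable {d m : ℕ} {Ω : Set (E d)} {B K : Fin m → Set (E d)} {α σ : E d → ℝ} {αmin δ : ℝ}

theorem aForm_comm (w v : H1 Ω) : aForm α σ w v = aForm α σ v w := by
  refine integral_congr_ae (Eventually.of_forall fun x => ?_)
  simp only
  rw [real_inner_comm]
  ring

theorem bForm_comm (w v : H1 Ω) : bForm B w v = bForm B v w :=
  Finset.sum_congr rfl fun i _ => by ring

theorem cForm_comm (w v : H1 Ω) : cForm α σ B δ w v = cForm α σ B δ v w := by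
  rw [cForm, cForm, aForm_comm, bForm_comm]

theorem toL2_add_ae (w v : H1 Ω) :
    toL2 (w + v) =ᵐ[volume.restrict Ω] fun x => toL2 w x + toL2 v x := Lp.coeFn_add _ _

theorem toL2_smul_ae (c : ℝ) (v : H1 Ω) :
    toL2 (c • v) =ᵐ[volume.restrict Ω] fun x => c * toL2 v x := Lp.coeFn_smul _ _

theorem grad_add_ae (w v : H1 Ω) :
    grad (w + v) =ᵐ[volume.restrict Ω] fun x => grad w x + grad v x := Lp.coeFn_add _ _

theorem grad_smul_ae (c : ℝ) (v : H1 Ω) :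
    grad (c • v) =ᵐ[volume.restrict Ω] fun x => c • grad v x := Lp.coeFn_smul _ _

theorem IsEllipticCoeff.aForm_add_left (hα : IsEllipticCoeff Ω α σ αmin) (w w' v : H1 Ω) :
    aForm α σ (w + w') v = aForm α σ w v + aForm α σ w' v := by
  unfold aForm
  rw [← integral_add (hα.integrable_aForm w v) (hα.integrable_aForm w' v)]
  refine integral_congr_ae ?_
  filter_upwards [toL2_add_ae w w', grad_add_ae w w'] with x h1 h2
  rw [h1, h2, inner_add_left]
  ring

theorem aForm_smul_left (c : ℝ) (w v : H1 Ω) : aForm α σ (c • w) v = c * aForm α σ w v := by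
  unfold aForm
  rw [← integral_const_mul]
  refine integral_congr_ae ?_
  filter_upwards [toL2_smul_ae c w, grad_smul_ae c w] with x h1 h2
  rw [h1, h2, real_inner_smul_left]
  ring

/-- The functionals `v ↦ ∑ β_i |B_i| ⨍_{B_i} v` are represented by functions in `L²(Ω)`. -/
theorem IsDataCover.exists_dataTerm_eq_inner (h : IsDataCover Ω B K) (hΩb : Bornology.IsBounded Ω)
    (β : Fin m → ℝ) : ∃ G : L2 Ω, ∀ v : H1 Ω, dataTerm B β v = inner ℝ G (toL2 v) := by
  have hm : ∀ i, MemLp ((B i).indicator fun _ => β i) 2 (volume.restrict Ω) := fun i =>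
    memLp_indicator_const 2 (h.isOpen_B i).measurableSet _ (Or.inr (by
      rw [Measure.restrict_apply (h.isOpen_B i).measurableSet]
      exact ne_top_of_le_ne_top (h.volume_B_ne_top hΩb i) (measure_mono inter_subset_left)))
  refine ⟨∑ i, (hm i).toLp _, fun v => ?_⟩
  rw [sum_inner, dataTerm]
  refine Finset.sum_congr rfl fun i _ => ?_
  rw [mul_assoc, ← setIntegral_eq_volume_mul_average (h.volume_B_pos hΩb i).ne',
    MeasureTheory.L2.inner_def, ← integral_const_mul]
  have e : ∀ F : E d → ℝ, ∫ x in B i, F x = ∫ x in Ω, (B i).indicator F x := fun F => by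
    rw [integral_indicator (h.isOpen_B i).measurableSet,
      Measure.restrict_restrict (h.isOpen_B i).measurableSet, inter_eq_left.2 (h.B_subset i)]
  rw [e]
  refine integral_congr_ae ?_
  filter_upwards [(hm i).coeFn_toLp] with x hx
  rw [hx]
  by_cases hxB : x ∈ B i <;> simp [hxB, mul_comm]

theorem bForm_eq_dataTerm (w v : H1 Ω) :
    bForm B w v = dataTerm B (fun i => ⨍ x in B i, toL2 w x) v :=
  Finset.sum_congr rfl fun i _ => by ring

theorem load_eq_inner {f : E d → ℝ} (hf : MemLp f 2 (volume.restrict Ω)) (v : H1 Ω) :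
    load f v = inner ℝ (hf.toLp f) (toL2 v) := by
  rw [MeasureTheory.L2.inner_def, load]
  refine integral_congr_ae ?_
  filter_upwards [hf.coeFn_toLp] with x hx
  rw [hx]
  simp [mul_comm]

theorem IsDataCover.bForm_add_left (h : IsDataCover Ω B K) (hΩb : Bornology.IsBounded Ω)
    (w w' v : H1 Ω) : bForm B (w + w') v = bForm B w v + bForm B w' v := by
  rw [bForm_comm, bForm_comm w, bForm_comm w', bForm_eq_dataTerm, bForm_eq_dataTerm,
    bForm_eq_dataTerm]
  obtain ⟨G, hG⟩ := h.exists_dataTerm_eq_inner hΩb fun i => ⨍ x in B i, toL2 v x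
  rw [hG, hG, hG, ← inner_add_right]
  rfl

theorem IsDataCover.bForm_smul_left (h : IsDataCover Ω B K) (hΩb : Bornology.IsBounded Ω)
    (c : ℝ) (w v : H1 Ω) : bForm B (c • w) v = c * bForm B w v := by
  rw [bForm_comm, bForm_comm w, bForm_eq_dataTerm, bForm_eq_dataTerm]
  obtain ⟨G, hG⟩ := h.exists_dataTerm_eq_inner hΩb fun i => ⨍ x in B i, toL2 v x
  rw [hG, hG, ← real_inner_smul_right]
  rfl

theorem cForm_add_left (hα : IsEllipticCoeff Ω α σ αmin) (h : IsDataCover Ω B K)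
    (hΩb : Bornology.IsBounded Ω) (w w' v : H1 Ω) :
    cForm α σ B δ (w + w') v = cForm α σ B δ w v + cForm α σ B δ w' v := by
  rw [cForm, hα.aForm_add_left, h.bForm_add_left hΩb, cForm, cForm]
  ring

theorem cForm_smul_left (h : IsDataCover Ω B K) (hΩb : Bornology.IsBounded Ω) (c : ℝ)
    (w v : H1 Ω) : cForm α σ B δ (c • w) v = c * cForm α σ B δ w v := by
  rw [cForm, aForm_smul_left, h.bForm_smul_left hΩb, cForm]
  ring

/-- The augmented form as a bilinear form. -/
noncomputable def cBilin (hα : IsEllipticCoeff Ω α σ αmin) (h : IsDataCover Ω B K)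
    (hΩb : Bornology.IsBounded Ω) (δ : ℝ) : LinearMap.BilinForm ℝ (H1 Ω) :=
  LinearMap.mk₂ ℝ (cForm α σ B δ) (cForm_add_left hα h hΩb) (cForm_smul_left h hΩb)
    (fun w v v' => by
      rw [cForm_comm, cForm_add_left hα h hΩb, cForm_comm v, cForm_comm v'])
    (fun c w v => by
      rw [cForm_comm, cForm_smul_left h hΩb, cForm_comm v, smul_eq_mul])

theorem cBilin_apply (hα : IsEllipticCoeff Ω α σ αmin) (h : IsDataCover Ω B K)
    (hΩb : Bornology.IsBounded Ω) (w v : H1 Ω) :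
    cBilin hα h hΩb δ w v = cForm α σ B δ w v := rfl

theorem cForm_sub_left (hα : IsEllipticCoeff Ω α σ αmin) (h : IsDataCover Ω B K)
    (hΩb : Bornology.IsBounded Ω) (w w' v : H1 Ω) :
    cForm α σ B δ (w - w') v = cForm α σ B δ w v - cForm α σ B δ w' v := by
  simp only [← cBilin_apply hα h hΩb, map_sub, LinearMap.sub_apply]

theorem cForm_sq_le (hα : IsEllipticCoeff Ω α σ αmin) (h : IsDataCover Ω B K)
    (hΩb : Bornology.IsBounded Ω) (hδ : 0 < δ) (w v : H1 Ω) :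
    cForm α σ B δ w v ^ 2 ≤ cForm α σ B δ w w * cForm α σ B δ v v :=
  (cBilin hα h hΩb δ).apply_sq_le_of_symm (hα.cForm_self_nonneg hδ) ⟨fun w v => cForm_comm w v⟩ w v

theorem cNorm_nonneg (v : H1 Ω) : 0 ≤ cNorm α σ B δ v := Real.sqrt_nonneg _

theorem cNorm_sq (hα : IsEllipticCoeff Ω α σ αmin) (hδ : 0 < δ) (v : H1 Ω) :
    cNorm α σ B δ v ^ 2 = cForm α σ B δ v v := Real.sq_sqrt (hα.cForm_self_nonneg hδ v)

theorem cForm_add_self (hα : IsEllipticCoeff Ω α σ αmin) (h : IsDataCover Ω B K)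
    (hΩb : Bornology.IsBounded Ω) (w v : H1 Ω) :
    cForm α σ B δ (w + v) (w + v)
      = cForm α σ B δ w w + 2 * cForm α σ B δ w v + cForm α σ B δ v v := by
  simp only [← cBilin_apply hα h hΩb, map_add, LinearMap.add_apply]
  rw [cBilin_apply hα h hΩb v w, cForm_comm, ← cBilin_apply hα h hΩb]
  ring

theorem cNorm_add_le (hα : IsEllipticCoeff Ω α σ αmin) (h : IsDataCover Ω B K)
    (hΩb : Bornology.IsBounded Ω) (hδ : 0 < δ) (w v : H1 Ω) :
    cNorm α σ B δ (w + v) ≤ cNorm α σ B δ w + cNorm α σ B δ v := by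
  refine Real.sqrt_le_iff.2 ⟨add_nonneg (cNorm_nonneg _) (cNorm_nonneg _), ?_⟩
  rw [cForm_add_self hα h hΩb, add_sq, cNorm_sq hα hδ, cNorm_sq hα hδ]
  have h1 : cForm α σ B δ w v ≤ cNorm α σ B δ w * cNorm α σ B δ v := by
    refine abs_le_of_sq_le_sq' ?_ (mul_nonneg (cNorm_nonneg _) (cNorm_nonneg _)) |>.2
    rw [mul_pow, cNorm_sq hα hδ, cNorm_sq hα hδ]
    exact cForm_sq_le hα h hΩb hδ w v
  linarith

theorem cNorm_neg (hα : IsEllipticCoeff Ω α σ αmin) (h : IsDataCover Ω B K)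
    (hΩb : Bornology.IsBounded Ω) (v : H1 Ω) : cNorm α σ B δ (-v) = cNorm α σ B δ v := by
  simp only [cNorm, ← cBilin_apply hα h hΩb, map_neg, LinearMap.neg_apply, neg_neg]

theorem cNorm_sub_rev (hα : IsEllipticCoeff Ω α σ αmin) (h : IsDataCover Ω B K)
    (hΩb : Bornology.IsBounded Ω) (w v : H1 Ω) :
    cNorm α σ B δ (w - v) = cNorm α σ B δ (v - w) := by
  rw [← cNorm_neg hα h hΩb, neg_sub]

theorem cNorm_sub_le (hα : IsEllipticCoeff Ω α σ αmin) (h : IsDataCover Ω B K)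
    (hΩb : Bornology.IsBounded Ω) (hδ : 0 < δ) (x y z : H1 Ω) :
    cNorm α σ B δ (x - z) ≤ cNorm α σ B δ (x - y) + cNorm α σ B δ (y - z) := by
  have := cNorm_add_le hα h hΩb hδ (x - y) (y - z)
  rwa [sub_add_sub_cancel] at this

/-- The augmented form is bounded on `H¹(Ω)`. -/
theorem exists_cForm_self_le (hα : IsEllipticCoeff Ω α σ αmin) (h : IsDataCover Ω B K)
    (hΩb : Bornology.IsBounded Ω) (hδ : 0 < δ) :
    ∃ A : ℝ, 0 ≤ A ∧ ∀ v : H1 Ω, cForm α σ B δ v v ≤ A * ‖v‖ ^ 2 := by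
  obtain ⟨αmax, hαmax⟩ := hα.α_le
  obtain ⟨σmax, hσmax⟩ := hα.σ_le
  refine ⟨|αmax| + |σmax| + δ⁻¹ * m, by positivity, fun v => ?_⟩
  have hv := norm_sq_H1 v
  have h1 : aForm α σ v v ≤ |αmax| * ‖grad v‖ ^ 2 + |σmax| * ‖toL2 v‖ ^ 2 := by
    rw [norm_sq_eq_setIntegral_vec, norm_sq_eq_setIntegral, ← integral_const_mul,
      ← integral_const_mul, ← integral_add ((integrable_norm_sq_grad _).const_mul _)
        ((Lp.memLp (toL2 v)).integrable_sq.const_mul _)]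
    refine integral_mono_ae (hα.integrable_aForm v v) (((integrable_norm_sq_grad _).const_mul _).add
      ((Lp.memLp (toL2 v)).integrable_sq.const_mul _)) ?_
    filter_upwards [hαmax, hσmax] with x hx1 hx2
    rw [real_inner_self_eq_norm_sq, mul_assoc, ← pow_two]
    exact add_le_add
      (mul_le_mul_of_nonneg_right (hx1.trans (le_abs_self _)) (sq_nonneg _))
      (mul_le_mul_of_nonneg_right (hx2.trans (le_abs_self _)) (sq_nonneg _))
  have h2 : bForm B v v ≤ m * ‖toL2 v‖ ^ 2 := by
    rw [bForm_self]
    have : ∀ i ∈ Finset.univ, volume.real (B i) * (⨍ x in B i, toL2 v x) ^ 2 ≤ ‖toL2 v‖ ^ 2 := by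
      intro i _
      have hvB : MemLp (toL2 v) 2 (volume.restrict (B i)) :=
        (Lp.memLp (toL2 v)).mono_measure (Measure.restrict_mono_set volume (h.B_subset i))
      have := volume_mul_average_sub_sq_le (h.volume_B_ne_top hΩb i) (h.volume_B_pos hΩb i).ne'
        hvB 0
      simp only [sub_zero] at this
      rw [norm_sq_eq_setIntegral]
      exact this.trans (setIntegral_mono_set (Lp.memLp (toL2 v)).integrable_sq
        (Eventually.of_forall fun x => sq_nonneg _) (h.B_subset i).eventuallyLE)
    simpa using Finset.sum_le_sum this
  have h3 : δ⁻¹ * bForm B v v ≤ δ⁻¹ * (m * ‖toL2 v‖ ^ 2) :=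
    mul_le_mul_of_nonneg_left h2 (inv_pos.2 hδ).le
  rw [cForm, hv]
  have := mul_nonneg (abs_nonneg αmax) (sq_nonneg ‖toL2 v‖)
  have := mul_nonneg (abs_nonneg σmax) (sq_nonneg ‖grad v‖)
  have : 0 ≤ δ⁻¹ * (m * ‖grad v‖ ^ 2) := by positivity
  linarith

/-- The augmented form is coercive on `H¹(Ω)`, by the Payne–Weinberger inequality. -/
theorem norm_sq_le_cForm (hΩo : IsOpen Ω) (hΩb : Bornology.IsBounded Ω)
    (hα : IsEllipticCoeff Ω α σ αmin) (h : IsDataCover Ω B K) (hδ : 0 < δ) (v : H1 Ω) :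
    ‖v‖ ^ 2 ≤ (Gam Ω B K αmin δ + αmin⁻¹) * cForm α σ B δ v v := by
  have h1 := norm_toL2_sq_le_cForm hΩo hΩb hα h hδ v
  have h2 : ‖grad v‖ ^ 2 ≤ αmin⁻¹ * cForm α σ B δ v v := by
    rw [← div_eq_inv_mul, le_div_iff₀ hα.pos, mul_comm]
    exact (hα.le_aForm v).trans (le_add_of_nonneg_right
      (mul_nonneg (inv_pos.2 hδ).le (bForm_self_nonneg v)))
  rw [norm_sq_H1, add_mul]
  exact add_le_add h1 h2

theorem toL2_norm_le_cNorm (hΩo : IsOpen Ω) (hΩb : Bornology.IsBounded Ω)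
    (hα : IsEllipticCoeff Ω α σ αmin) (h : IsDataCover Ω B K) (hδ : 0 < δ) (v : H1 Ω) :
    ‖toL2 v‖ ≤ √(Gam Ω B K αmin δ) * cNorm α σ B δ v := by
  rw [cNorm, ← Real.sqrt_mul (Gam_nonneg hδ)]
  exact Real.le_sqrt_of_sq_le (norm_toL2_sq_le_cForm hΩo hΩb hα h hδ v)

/-- The Lax–Milgram theorem for the augmented problem. -/
theorem exists_variational_solution (hΩo : IsOpen Ω) (hΩb : Bornology.IsBounded Ω)
    {V : Submodule ℝ (H1 Ω)} (hVc : IsClosed (V : Set (H1 Ω)))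
    (hα : IsEllipticCoeff Ω α σ αmin) (h : IsDataCover Ω B K) (hδ : 0 < δ) (G : L2 Ω) :
    ∃ ut ∈ V, ∀ v ∈ V, cForm α σ B δ ut v = inner ℝ G (toL2 v) := by
  obtain ⟨A, hA0, hA⟩ := exists_cForm_self_le hα h hΩb hδ
  set c := Gam Ω B K αmin δ + αmin⁻¹ with hc
  have hc0 : 0 < c := add_pos_of_nonneg_of_pos (Gam_nonneg hδ) (inv_pos.2 hα.pos)
  refine exists_solution_of_coercive hVc (cBilin hα h hΩb δ) (A := A) (c := c⁻¹) (fun w v => ?_)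
    (inv_pos.2 hc0) (fun v => ?_) ((innerSL ℝ G).comp (toL2L Ω))
  · rw [cBilin_apply]
    refine abs_le_of_sq_le_sq ?_ (by positivity)
    refine (cForm_sq_le hα h hΩb hδ _ _).trans ?_
    calc cForm α σ B δ w w * cForm α σ B δ v v
        ≤ (A * ‖w‖ ^ 2) * (A * ‖v‖ ^ 2) :=
          mul_le_mul (hA w) (hA v) (hα.cForm_self_nonneg hδ _) (by positivity)
      _ = (A * ‖w‖ * ‖v‖) ^ 2 := by ring
  · rw [cBilin_apply, mul_assoc, ← pow_two, inv_mul_le_iff₀ hc0]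
    exact norm_sq_le_cForm hΩo hΩb hα h hδ v

end forms

section minimizers

variable {d m : ℕ} {Ω : Set (E d)} {B K : Fin m → Set (E d)} {α σ f : E d → ℝ} {αmin δ : ℝ}
  {β : Fin m → ℝ}

theorem exists_rhs_eq_inner (h : IsDataCover Ω B K) (hΩb : Bornology.IsBounded Ω)
    (hf : MemLp f 2 (volume.restrict Ω)) (β : Fin m → ℝ) (δ : ℝ) :
    ∃ G : L2 Ω, ∀ v : H1 Ω, rhs f B β δ v = inner ℝ G (toL2 v) := by
  obtain ⟨G, hG⟩ := h.exists_dataTerm_eq_inner hΩb β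
  refine ⟨hf.toLp f + δ⁻¹ • G, fun v => ?_⟩
  rw [rhs, load_eq_inner hf, hG, inner_add_left, real_inner_smul_left]

/-- The functional `J` exceeds its value at the variational solution by half the squared energy
norm of the difference. -/
theorem J_sub_J (hα : IsEllipticCoeff Ω α σ αmin) (h : IsDataCover Ω B K)
    (hΩb : Bornology.IsBounded Ω) (hδ : 0 < δ) (hf : MemLp f 2 (volume.restrict Ω))
    {V : Submodule ℝ (H1 Ω)} {ut w : H1 Ω} (hutV : ut ∈ V)
    (hut : ∀ v ∈ V, cForm α σ B δ ut v = rhs f B β δ v) (hw : w ∈ V) :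
    J α σ f B β δ w = J α σ f B β δ ut + 1 / 2 * cNorm α σ B δ (w - ut) ^ 2 := by
  obtain ⟨G, hG⟩ := exists_rhs_eq_inner h hΩb hf β δ
  have h1 := cForm_add_self (δ := δ) hα h hΩb ut (w - ut)
  rw [add_sub_cancel] at h1
  have h2 : rhs f B β δ w = rhs f B β δ ut + rhs f B β δ (w - ut) := by
    rw [hG, hG, hG, ← inner_add_right]
    congr 1
    change toL2L Ω w = toL2L Ω ut + toL2L Ω (w - ut)
    rw [← map_add, add_sub_cancel]
  rw [J, J, h1, h2, cNorm_sq hα hδ, hut _ (V.sub_mem hw hutV)]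
  ring

/-- A lower bound over all representing functions passes to the `L²` norm of a functional. -/
theorem le_add_mul_functionalL2Norm {V : Submodule ℝ (H1 Ω)} {F F' : H1 Ω → ℝ}
    (hF : IsL2Functional V F) (hF' : IsL2Functional V F') {x c s : ℝ} (hc : 0 < c) (hs : 0 < s)
    (hx : ∀ g g' : L2 Ω, Represents V F g → Represents V F' g' → x ≤ c * (‖g‖ + s * ‖g'‖)) :
    x ≤ c * (functionalL2Norm V F + s * functionalL2Norm V F') := by
  obtain ⟨g₀, hg₀⟩ := hF
  obtain ⟨g₀', hg₀'⟩ := hF'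
  have h1 : ∀ g', Represents V F' g' → x ≤ c * (functionalL2Norm V F + s * ‖g'‖) := fun g' hg' => by
    have : x / c - s * ‖g'‖ ≤ functionalL2Norm V F := by
      refine le_csInf ⟨_, g₀, hg₀, rfl⟩ ?_
      rintro _ ⟨g, hg, rfl⟩
      rw [sub_le_iff_le_add, div_le_iff₀' hc]
      exact hx g g' hg hg'
    rw [sub_le_iff_le_add, div_le_iff₀' hc] at this
    exact this
  have : (x / c - functionalL2Norm V F) / s ≤ functionalL2Norm V F' := by
    refine le_csInf ⟨_, g₀', hg₀', rfl⟩ ?_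
    rintro _ ⟨g, hg, rfl⟩
    rw [div_le_iff₀' hs, sub_le_iff_le_add', div_le_iff₀' hc]
    exact h1 g hg
  rwa [div_le_iff₀' hs, sub_le_iff_le_add', div_le_iff₀' hc] at this

theorem represents_iff_inner {V : Submodule ℝ (H1 Ω)} {F : H1 Ω → ℝ} {g : L2 Ω} :
    Represents V F g ↔ ∀ v ∈ V, F v = inner ℝ g (toL2 v) := by
  have : ∀ v : H1 Ω, ∫ x in Ω, g x * toL2 v x = inner ℝ g (toL2 v) := fun v => by
    rw [MeasureTheory.L2.inner_def]
    refine integral_congr_ae (Eventually.of_forall fun x => ?_)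
    simp [mul_comm]
  simp only [Represents, this]

theorem isL2Functional_dataError (h : IsDataCover Ω B K) (hΩb : Bornology.IsBounded Ω)
    (V : Submodule ℝ (H1 Ω)) (u : H1 Ω) :
    IsL2Functional V fun v => dataTerm B β v - bForm B u v := by
  obtain ⟨G, hG⟩ := h.exists_dataTerm_eq_inner hΩb β
  obtain ⟨G', hG'⟩ := h.exists_dataTerm_eq_inner hΩb fun i => ⨍ x in B i, toL2 u x
  refine ⟨G - G', represents_iff_inner.2 fun v _ => ?_⟩
  rw [hG, bForm_eq_dataTerm, hG', inner_sub_left]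

theorem Gam_pos (h : IsDataCover Ω B K) (hΩb : Bornology.IsBounded Ω) (hΩn : Ω.Nonempty)
    (hδ : 0 < δ) : 0 < Gam Ω B K αmin δ := by
  refine mul_pos ?_ (hδ.trans_le (le_max_right _ _))
  unfold mismatch
  split_ifs
  · exact zero_lt_one
  · obtain ⟨x, hx⟩ := hΩn
    obtain ⟨i, -⟩ := mem_iUnion.1 (h.cover hx)
    refine mul_pos (by norm_num) (lt_of_lt_of_le ?_
      (le_ciSup (Finite.bddAbove_range fun i => volume.real (K i) / volume.real (B i)) i))
    have hb := h.volume_B_pos hΩb i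
    exact div_pos (hb.trans_le (measureReal_mono (h.B_subset_K i)
      (h.isBounded_K hΩb i).measure_lt_top.ne)) hb

/-- The consistency error is estimated by testing the equation for `ut - u` with `ut - u`. -/
theorem cNorm_sub_le_errors (hΩo : IsOpen Ω) (hΩb : Bornology.IsBounded Ω)
    (hα : IsEllipticCoeff Ω α σ αmin) (h : IsDataCover Ω B K) (hδ : 0 < δ)
    {V : Submodule ℝ (H1 Ω)} {u ut : H1 Ω} (hu : u ∈ V) (hutV : ut ∈ V)
    (hut : ∀ v ∈ V, cForm α σ B δ ut v = rhs f B β δ v)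
    (hres : IsL2Functional V fun v => load f v - aForm α σ u v)
    (hΓ : 0 < Gam Ω B K αmin δ) :
    cNorm α σ B δ (ut - u)
      ≤ √(Gam Ω B K αmin δ) * (Epde V α σ f u + δ⁻¹ * Edata V B β u) := by
  refine le_add_mul_functionalL2Norm hres (isL2Functional_dataError h hΩb V u)
    (Real.sqrt_pos.2 hΓ) (inv_pos.2 hδ) fun g g' hg hg' => ?_
  rw [represents_iff_inner] at hg hg'
  set e := ut - u with he
  have heV : e ∈ V := V.sub_mem hutV hu
  have hδ' : 0 < δ⁻¹ := inv_pos.2 hδ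
  have h1 : cNorm α σ B δ e ^ 2 = inner ℝ g (toL2 e) + δ⁻¹ * inner ℝ g' (toL2 e) := by
    rw [cNorm_sq hα hδ, ← hg e heV, ← hg' e heV]
    have : cForm α σ B δ e e = cForm α σ B δ ut e - cForm α σ B δ u e := cForm_sub_left hα h hΩb ut u e
    rw [this, hut e heV, rhs, cForm]
    ring
  have h2 : inner ℝ g (toL2 e) + δ⁻¹ * inner ℝ g' (toL2 e) ≤ (‖g‖ + δ⁻¹ * ‖g'‖) * ‖toL2 e‖ := by
    have a1 := real_inner_le_norm g (toL2 e)
    have a2 := mul_le_mul_of_nonneg_left (real_inner_le_norm g' (toL2 e)) hδ'.le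
    linarith
  have hN : 0 ≤ ‖g‖ + δ⁻¹ * ‖g'‖ := by positivity
  have h3 := mul_le_mul_of_nonneg_left (toL2_norm_le_cNorm hΩo hΩb hα h hδ e) hN
  rcases (cNorm_nonneg (α := α) (σ := σ) (B := B) (δ := δ) e).eq_or_lt with h0 | h0
  · rw [← h0]
    positivity
  · refine le_of_mul_le_mul_right ?_ h0
    linarith

end minimizers

end PDELearning

open PDELearning

theorem mainTheorem2 {d m : ℕ} (Ω : Set (E d))
    (hΩo : IsOpen Ω) (hΩb : Bornology.IsBounded Ω) (hΩn : Ω.Nonempty)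
    -- the closed subspace `V` with `H¹₀(Ω) ⊆ V ⊆ H¹(Ω)`
    (V : Submodule ℝ (H1 Ω)) (hVc : IsClosed (V : Set (H1 Ω)))
    (hV0 : H10 Ω ⊆ (V : Set (H1 Ω)))
    -- the exact PDE, whose bilinear form is coercive on `V`, and its solution `u`
    (α σ f : E d → ℝ) (αmin : ℝ)
    (hα : IsEllipticCoeff Ω α σ αmin) (hf : MemLp f 2 (volume.restrict Ω))
    (hcoercive : ∃ κ : ℝ, 0 < κ ∧ ∀ v ∈ V, κ * ‖v‖ ^ 2 ≤ aForm α σ v v)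
    (u : H1 Ω) (huV : u ∈ V)
    (hu : ∀ v ∈ V, aForm α σ u v = load f v)
    -- the inexact auxiliary PDE
    (α' σ' f' : E d → ℝ) (αmin' : ℝ)
    (hα' : IsEllipticCoeff Ω α' σ' αmin') (hf' : MemLp f' 2 (volume.restrict Ω))
    -- the data and the regularization parameter
    (B K : Fin m → Set (E d)) (hBK : IsDataCover Ω B K)
    (β : Fin m → ℝ) (δ : ℝ) (hδ : 0 < δ)
    -- the residual `ℓ' - a'(u,·)` is in `L²(Ω)`
    (hres : IsL2Functional V
      fun v => load f' v - aForm α' σ' u v)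
    -- the generalized Galerkin discretization
    (Vh : Set (H1 Ω)) (hVh : Vh ⊆ (V : Set (H1 Ω)))
    (uh : H1 Ω)
    (huh : IsMinimizer (J α' σ' f' B β δ) Vh uh) :
    -- the regularized problem on `V` has a unique solution, and it satisfies the error bounds
    ∃ ut : H1 Ω,
      IsMinimizer (J α' σ' f' B β δ) (V : Set (H1 Ω)) ut ∧
      (∀ w, IsMinimizer (J α' σ' f' B β δ)
        (V : Set (H1 Ω)) w → w = ut) ∧
      ‖toL2 (uh - u)‖
        ≤ √(Gam Ω B K αmin' δ) * cNorm α' σ' B δ (uh - u) ∧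
      √(Gam Ω B K αmin' δ) * cNorm α' σ' B δ (uh - u)
        ≤ 2 * √(Gam Ω B K αmin' δ) * cNorm α' σ' B δ (ut - u)
          + (⨅ v : Vh, √(Gam Ω B K αmin' δ)
              * cNorm α' σ' B δ ((v : H1 Ω) - u)) ∧
      2 * √(Gam Ω B K αmin' δ) * cNorm α' σ' B δ (ut - u)
          + (⨅ v : Vh, √(Gam Ω B K αmin' δ)
              * cNorm α' σ' B δ ((v : H1 Ω) - u))
        ≤ 2 * Gam Ω B K αmin' δ
            * (Epde V α' σ' f' u + δ⁻¹ * Edata V B β u)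
          + (⨅ v : Vh, √(Gam Ω B K αmin' δ)
              * cNorm α' σ' B δ ((v : H1 Ω) - u)) := by
  have hΓ0 : 0 ≤ Gam Ω B K αmin' δ := Gam_nonneg hδ
  obtain ⟨G, hG⟩ := exists_rhs_eq_inner hBK hΩb hf' β δ
  obtain ⟨ut, hutV, hut'⟩ := exists_variational_solution hΩo hΩb hVc hα' hBK hδ G
  have hut : ∀ v ∈ V, cForm α' σ' B δ ut v = rhs f' B β δ v := fun v hv => by
    rw [hut' v hv, hG]
  have hJ : ∀ w ∈ V, J α' σ' f' B β δ w
      = J α' σ' f' B β δ ut + 1 / 2 * cNorm α' σ' B δ (w - ut) ^ 2 := fun w hw =>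
    J_sub_J hα' hBK hΩb hδ hf' hutV hut hw
  have hbdd : BddBelow (range fun v : Vh =>
      √(Gam Ω B K αmin' δ) * cNorm α' σ' B δ ((v : H1 Ω) - u)) :=
    ⟨0, by rintro _ ⟨v, rfl⟩; exact mul_nonneg (Real.sqrt_nonneg _) (cNorm_nonneg _)⟩
  have : Nonempty Vh := ⟨⟨uh, huh.1⟩⟩
  have hsqrt := Real.sqrt_nonneg (Gam Ω B K αmin' δ)
  refine ⟨ut, ⟨hutV, fun w hw => ?_⟩, ?_, toL2_norm_le_cNorm hΩo hΩb hα' hBK hδ _, ?_, ?_⟩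
  · rw [hJ w hw]
    have := sq_nonneg (cNorm α' σ' B δ (w - ut))
    linarith
  · rintro w ⟨hwV, hw⟩
    have h1 := hw ut hutV
    rw [hJ w hwV, cNorm_sq hα' hδ] at h1
    have h2 := norm_sq_le_cForm hΩo hΩb hα' hBK hδ (w - ut)
    have h3 : cForm α' σ' B δ (w - ut) (w - ut) = 0 :=
      le_antisymm (by linarith) (hα'.cForm_self_nonneg hδ _)
    rw [h3, mul_zero] at h2
    have h4 : ‖w - ut‖ = 0 := pow_eq_zero_iff two_ne_zero |>.1 (le_antisymm h2 (sq_nonneg _))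
    exact sub_eq_zero.1 (norm_eq_zero.1 h4)
  · rw [← sub_le_iff_le_add']
    refine le_ciInf fun v => ?_
    have hvV := hVh v.2
    -- `uh` is a best approximation of `ut` in `Vh` with respect to the energy norm
    have h1 : cNorm α' σ' B δ (uh - ut) ≤ cNorm α' σ' B δ ((v : H1 Ω) - ut) := by
      have := huh.2 v v.2
      rw [hJ uh (hVh huh.1), hJ v hvV] at this
      exact le_of_sq_le_sq (by linarith) (cNorm_nonneg _)
    have h2 := cNorm_sub_le hα' hBK hΩb hδ uh ut u
    have h3 := cNorm_sub_le hα' hBK hΩb hδ (v : H1 Ω) u ut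
    rw [cNorm_sub_rev hα' hBK hΩb u ut] at h3
    rw [sub_le_iff_le_add', mul_comm 2, mul_assoc, ← mul_add]
    exact mul_le_mul_of_nonneg_left (by linarith) hsqrt
  · refine add_le_add_left ?_ _
    have h1 := cNorm_sub_le_errors hΩo hΩb hα' hBK hδ huV hutV hut hres
      (Gam_pos hBK hΩb hΩn hδ)
    have h2 := mul_le_mul_of_nonneg_left h1 hsqrt
    rw [← mul_assoc, Real.mul_self_sqrt hΓ0] at h2
    linarith
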